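/- **Setting.** Constants, variables and predicate symbols are finite bit strings. A *schema* $\mathcal S$ is a finite set of predicate symbols, each with an arity, and an *$\mathcal S$-database* $D$ is a finite set of facts $s(c_1,\dots,c_k)$ over $\mathcal S$ with constants $c_i$; $\mathrm{dom}(D)$ is the set of constants occurring in $D$. A *$D$-dataset* of arity $n$ is a finite set $\lambda\subseteq \mathrm{dom}(D)^n$. A *conjunctive query* (CQ) is an expression $\{\vec x\mid\exists\vec y.\,\phi(\vec x,\vec y)\}$, where $\phi$ is a finite conjunction of atoms whose arguments are variables; a *union of conjunctive queries* (UCQ) is a finite set of CQs of the same arity. A *DL-Lite$_{\mathcal R}$ ontology* $\mathcal O$ consists of a finite alphabet of atomic concepts (besides $\top$ and $\bot$) and atomic roles and of a finite set of assertions $B_1\sqsubseteq B_2$, $B_1\sqsubseteq\neg B_2$, $R_1\sqsubseteq R_2$, $R_1\sqsubseteq\neg R_2$ over that alphabet, where the $R_i$ are of the form $P$ or $P^-$ with $P$ an atomic role, and the $B_i$ are of the form $A$, $\exists P$ or $\exists P^-$ with $A$ an atomic concept (possibly $\top$ or $\bot$). Queries over $\mathcal O$ use the atomic concepts (including $\top$,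 $\bot$) as unary and the atomic roles as binary predicates. A *GLAV mapping* $\mathcal M$ from $\mathcal S$ to $\mathcal O$ is a finite set of assertions $q_{\mathcal S}\to q_{\mathcal O}$, where $q_{\mathcal S}$ and $q_{\mathcal O}$ are CQs over $\mathcal S$ and over $\mathcal O$ with the same target list $\vec x$. An *OBDM system* is $\Sigma=\langle\langle\mathcal O,\mathcal S,\mathcal M\rangle,D\rangle$ with $\mathcal O,\mathcal S,\mathcal M,D$ as above. An interpretation $\mathcal I$ has a non-empty domain $\Delta^{\mathcal I}$ and interprets atomic concepts, atomic roles and constants by subsets of $\Delta^{\mathcal I}$, subsets of $\Delta^{\mathcal I}\times\Delta^{\mathcal I}$ and elements of $\Delta^{\mathcal I}$, with the usual extension to $\top,\bot,\exists P,\exists P^-,P^-$. It is a *model* of $\Sigma$ if it satisfies all assertions of $\mathcal O$ and if, for every $q_{\mathcal S}\to q_{\mathcal O}$ in $\mathcal M$ and every answer $\vec c\in q_{\mathcal S}^D$ (a tuple over $\mathrm{dom}(D)$), $\vec c^{\,\mathcal I}\in q_{\mathcal O}^{\mathcal I}$. For a UCQ $q$ over $\mathcal O$ of arity $m$, the set of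 *certain answers* $\mathit{cert}(q,\Sigma)$ consists of all $\vec c\in\mathrm{dom}(D)^m$ with $\vec c^{\,\mathcal I}\in q^{\mathcal I}$ for every model $\mathcal I$ of $\Sigma$ (so it is all of $\mathrm{dom}(D)^m$ if $\Sigma$ has no model). The query $q$ is a *complete $\Sigma$-characterization* of $\lambda$ if $\lambda\subseteq\mathit{cert}(q,\Sigma)$. **Theorem.** Let Complete-VQDEF(DL-Lite$_{\mathcal R}$, GLAV, UCQ) be the following decision problem. *Input:* an OBDM system $\Sigma=\langle\langle\mathcal O,\mathcal S,\mathcal M\rangle,D\rangle$ with $\mathcal O$ a DL-Lite$_{\mathcal R}$ ontology and $\mathcal M$ a GLAV mapping, a $D$-dataset $\lambda$, and a UCQ $q$ over $\mathcal O$, all of them part of the input and encoded as a string in a standard way (sets as lists, arities in unary). *Question:* is $q$ a complete $\Sigma$-characterization of $\lambda$? Then this problem, as the language of the encodings of its yes-instances, is in $\mathrm{NP}$. -/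

import Mathlib

/-! ### The class NP, over Mathlib's multi-stack Turing machines -/

namespace Complexity

/-- The string presented to a verifier: the input `x` followed by the certificate `w`, the two
being written in disjoint alphabets, so that the pair can be read off the string. -/
def pairEncoding {Γ Δ : Type} (p : List Γ × List Δ) : List (Γ ⊕ Δ) :=
  p.1.map Sum.inl ++ p.2.map Sum.inr

/-- A language over a finite alphabet is in NP if there are a finite certificate alphabet, a
polynomial `p` and a verifier that runs in polynomial time on a Turing machine such that `x`
belongs to the language iff the verifier accepts `x` with some certificate of length at most
`p |x|`. -/
def InNP {Γ : Type} [Fintype Γ] (L : Language Γ) : Prop :=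
  ∃ (Δ : Type) (_ : Fintype Δ) (p : Polynomial ℕ) (V : List Γ × List Δ → Bool),
    Nonempty (Turing.TM2ComputableInPolyTime pairEncoding Computability.encodeBool V) ∧
    ∀ x : List Γ, x ∈ L ↔ ∃ w : List Δ, w.length ≤ p.eval x.length ∧ V (x, w) = true

end Complexity

namespace OBDM

/-! ### Databases and queries over a schema

Symbols of every sort (constants, variables, predicate, concept and role symbols) are finite
bit strings; the sorts are kept apart by the syntax. Finite sets are given by lists. -/

/-- Constants, a countably infinite set. -/
abbrev Const := List Bool

/-- Variables, a countably infinite set. -/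
abbrev Var := List Bool

/-- Predicate symbols, atomic concept symbols and atomic role symbols. -/
abbrev PredSym := List Bool

/-- A relational schema: finitely many predicate symbols with their arities. -/
abbrev Schema := List (PredSym × ℕ)

/-- Every predicate symbol of the schema has one arity. -/
def Schema.WF (S : Schema) : Prop :=
  ∀ p ∈ S, ∀ p' ∈ S, p.1 = p'.1 → p.2 = p'.2

/-- A relational atom `s(t₁, …, tₖ)` with terms from `T`. -/
structure RelAtom (T : Type) where
  pred : PredSym
  args : List T

/-- The atom is over the schema `S`. -/
def RelAtom.Over {T : Type} (a : RelAtom T) (S : Schema) : Prop :=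
  (a.pred, a.args.length) ∈ S

/-- The image of an atom under a map of its terms. -/
def RelAtom.map {T U : Type} (h : T → U) (a : RelAtom T) : RelAtom U :=
  ⟨a.pred, a.args.map h⟩

/-- A database: a finite set of facts. -/
abbrev Database := List (RelAtom Const)

/-- `D` is an `S`-database. -/
def Database.WF (S : Schema) (D : Database) : Prop :=
  ∀ a ∈ D, a.Over S

/-- The constants that occur in the database. -/
def Database.dom (D : Database) : Set Const :=
  {c | ∃ a ∈ D, c ∈ a.args}

/-- `dom(D)ⁿ`. -/
def Database.tuples (D : Database) (n : ℕ) : Set (List Const) :=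
  {c | c.length = n ∧ ∀ d ∈ c, d ∈ D.dom}

/-- A conjunctive query over a schema, or over an ontology, `Atom` being the type of the atoms of
the body. Its existential variables are those variables of the body that are not in the target
list. -/
structure CQ (Atom : Type) where
  target : List Var
  body : List Atom

/-- The evaluation of a conjunctive query over a database. -/
def answers (q : CQ (RelAtom Var)) (D : Database) : Set (List Const) :=
  {c | c ∈ D.tuples q.target.length ∧
    ∃ h : Var → Const, (∀ a ∈ q.body, a.map h ∈ D) ∧ q.target.map h = c}

/-! ### DL-Lite_R -/

/-- Atomic concepts, including the universal one and the bottom one. -/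
inductive AtomicConcept where
  | top
  | bot
  | named (A : PredSym)

/-- Basic roles `P` and `P⁻`. -/
inductive Role where
  | atomic (P : PredSym)
  | inv (P : PredSym)

/-- Basic concepts `A`, `∃P` and `∃P⁻`. -/
inductive Concept where
  | atomic (A : AtomicConcept)
  | ex (R : Role)

/-- Assertions of DL-Lite_R. -/
inductive Assertion where
  | conceptIncl (B₁ B₂ : Concept)
  | roleIncl (R₁ R₂ : Role)
  | conceptDisj (B₁ B₂ : Concept)
  | roleDisj (R₁ R₂ : Role)

/-- A DL-Lite_R ontology: its alphabet (besides `⊤` and `⊥`) and its assertions. -/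
structure Ontology where
  concepts : List PredSym
  roles : List PredSym
  assertions : List Assertion

def AtomicConcept.Over (O : Ontology) : AtomicConcept → Prop
  | .top => True
  | .bot => True
  | .named A => A ∈ O.concepts

def Role.Over (O : Ontology) : Role → Prop
  | .atomic P => P ∈ O.roles
  | .inv P => P ∈ O.roles

def Concept.Over (O : Ontology) : Concept → Prop
  | .atomic A => A.Over O
  | .ex R => R.Over O

def Assertion.Over (O : Ontology) : Assertion → Prop
  | .conceptIncl B₁ B₂ => B₁.Over O ∧ B₂.Over O
  | .roleIncl R₁ R₂ => R₁.Over O ∧ R₂.Over O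
  | .conceptDisj B₁ B₂ => B₁.Over O ∧ B₂.Over O
  | .roleDisj R₁ R₂ => R₁.Over O ∧ R₂.Over O

/-- The assertions use symbols of the alphabet only. -/
def Ontology.WF (O : Ontology) : Prop :=
  ∀ α ∈ O.assertions, α.Over O

/-- An interpretation, with a non-empty domain; it interprets the constants as well, and distinct
constants may denote the same object. -/
structure Interp where
  Dom : Type
  nonempty : Nonempty Dom
  concept : PredSym → Set Dom
  role : PredSym → Set (Dom × Dom)
  const : Const → Dom

namespace Interp

variable (I : Interp)

def atomicConcept : AtomicConcept → Set I.Dom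
  | .top => Set.univ
  | .bot => ∅
  | .named A => I.concept A

def basicRole : Role → Set (I.Dom × I.Dom)
  | .atomic P => I.role P
  | .inv P => {p | (p.2, p.1) ∈ I.role P}

def basicConcept : Concept → Set I.Dom
  | .atomic A => I.atomicConcept A
  | .ex R => {o | ∃ o', (o, o') ∈ I.basicRole R}

def Sat : Assertion → Prop
  | .conceptIncl B₁ B₂ => I.basicConcept B₁ ⊆ I.basicConcept B₂
  | .roleIncl R₁ R₂ => I.basicRole R₁ ⊆ I.basicRole R₂
  | .conceptDisj B₁ B₂ => I.basicConcept B₁ ∩ I.basicConcept B₂ = ∅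
  | .roleDisj R₁ R₂ => I.basicRole R₁ ∩ I.basicRole R₂ = ∅

end Interp

/-! ### Queries over an ontology -/

/-- Atoms `A(x)` and `P(x, y)` over the alphabet of an ontology. -/
inductive OntAtom where
  | concept (A : AtomicConcept) (x : Var)
  | role (P : PredSym) (x y : Var)

def OntAtom.Over (O : Ontology) : OntAtom → Prop
  | .concept A _ => A.Over O
  | .role P _ _ => P ∈ O.roles

/-- Truth of an atom in an interpretation under an assignment of the variables. -/
def Interp.Holds (I : Interp) (h : Var → I.Dom) : OntAtom → Prop
  | .concept A x => h x ∈ I.atomicConcept A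
  | .role P x y => (h x, h y) ∈ I.role P

/-- The evaluation of a conjunctive query over an interpretation. -/
def Interp.answers (I : Interp) (q : CQ OntAtom) : Set (List I.Dom) :=
  {o | ∃ h : Var → I.Dom, (∀ a ∈ q.body, I.Holds h a) ∧ q.target.map h = o}

/-- A union of conjunctive queries over an ontology, with its arity. -/
structure UCQ where
  arity : ℕ
  disjuncts : List (CQ OntAtom)

/-- The query is over the ontology `O`, and its disjuncts have the stated arity. -/
def UCQ.WF (O : Ontology) (q : UCQ) : Prop :=
  ∀ d ∈ q.disjuncts, d.target.length = q.arity ∧ ∀ a ∈ d.body, a.Over O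

/-! ### Mappings, OBDM systems and certain answers -/

/-- A GLAV assertion `q_S → q_O`; the two queries have the same target list. -/
structure GLAV where
  target : List Var
  srcBody : List (RelAtom Var)
  ontBody : List OntAtom

/-- The query over the schema. -/
def GLAV.src (m : GLAV) : CQ (RelAtom Var) := ⟨m.target, m.srcBody⟩

/-- The query over the ontology. -/
def GLAV.ont (m : GLAV) : CQ OntAtom := ⟨m.target, m.ontBody⟩

/-- The assertion relates the schema `S` to the ontology `O`. -/
def GLAV.WF (S : Schema) (O : Ontology) (m : GLAV) : Prop :=
  (∀ a ∈ m.srcBody, a.Over S) ∧ ∀ a ∈ m.ontBody, a.Over O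

/-- An OBDM system: a specification, consisting of an ontology, a schema and a mapping, together
with a database. -/
structure System where
  ontology : Ontology
  schema : Schema
  mapping : List GLAV
  database : Database

def System.WF (Sys : System) : Prop :=
  Sys.ontology.WF ∧ Sys.schema.WF ∧
    (∀ m ∈ Sys.mapping, m.WF Sys.schema Sys.ontology) ∧ Sys.database.WF Sys.schema

/-- The interpretation satisfies the ontology, and with the database it satisfies the mapping. -/
def System.IsModel (Sys : System) (I : Interp) : Prop :=
  (∀ α ∈ Sys.ontology.assertions, I.Sat α) ∧
    ∀ m ∈ Sys.mapping, ∀ c ∈ answers m.src Sys.database, c.map I.const ∈ I.answers m.ont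

/-- The certain answers; these are all tuples of constants of the database if there is no
model. -/
def System.cert (Sys : System) (q : UCQ) : Set (List Const) :=
  {c | c ∈ Sys.database.tuples q.arity ∧
    ∀ I : Interp, Sys.IsModel I → ∃ d ∈ q.disjuncts, c.map I.const ∈ I.answers d}

/-! ### The decision problem -/

/-- A set of tuples of constants, with its arity. -/
structure Dataset where
  arity : ℕ
  tuples : List (List Const)

/-- `l` is a `D`-dataset. -/
def Dataset.WF (D : Database) (l : Dataset) : Prop :=
  ∀ c ∈ l.tuples, c ∈ D.tuples l.arity

/-- `q` is a complete characterization of `l` with respect to the system. -/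
def System.IsCompleteCharacterization (Sys : System) (l : Dataset) (q : UCQ) : Prop :=
  {c | c ∈ l.tuples} ⊆ Sys.cert q

/-- An input of the verification problem. -/
structure Instance where
  system : System
  dataset : Dataset
  query : UCQ

def Instance.WF (J : Instance) : Prop :=
  J.system.WF ∧ J.dataset.WF J.system.database ∧ J.query.WF J.system.ontology

/-! ### Encoding of the inputs as strings

A bit string is written bit by bit and ended by `close`; a number is written in unary (numbers
occur as arities only); the items of a list are each preceded by `item`, and the list is ended by
`close`; the components of a structure are written one after the other, and a constructor is
indicated by one or two leading bits. -/

/-- The alphabet of the encoding. -/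
inductive Sym where
  | bit (b : Bool)
  | item
  | close
  deriving DecidableEq, Fintype

def encBits (s : List Bool) : List Sym := s.map Sym.bit ++ [Sym.close]

def encNat (n : ℕ) : List Sym := List.replicate n Sym.item ++ [Sym.close]

def encList {α : Type} (e : α → List Sym) : List α → List Sym
  | [] => [Sym.close]
  | a :: l => Sym.item :: (e a ++ encList e l)

def encSchema (S : Schema) : List Sym := encList (fun p => encBits p.1 ++ encNat p.2) S

def encRelAtom (a : RelAtom (List Bool)) : List Sym := encBits a.pred ++ encList encBits a.args

def encAtomicConcept : AtomicConcept → List Sym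
  | .top => [Sym.bit false, Sym.bit false]
  | .bot => [Sym.bit false, Sym.bit true]
  | .named A => Sym.bit true :: encBits A

def encRole : Role → List Sym
  | .atomic P => Sym.bit false :: encBits P
  | .inv P => Sym.bit true :: encBits P

def encConcept : Concept → List Sym
  | .atomic A => Sym.bit false :: encAtomicConcept A
  | .ex R => Sym.bit true :: encRole R

def encAssertion : Assertion → List Sym
  | .conceptIncl B₁ B₂ => Sym.bit false :: Sym.bit false :: (encConcept B₁ ++ encConcept B₂)
  | .roleIncl R₁ R₂ => Sym.bit false :: Sym.bit true :: (encRole R₁ ++ encRole R₂)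
  | .conceptDisj B₁ B₂ => Sym.bit true :: Sym.bit false :: (encConcept B₁ ++ encConcept B₂)
  | .roleDisj R₁ R₂ => Sym.bit true :: Sym.bit true :: (encRole R₁ ++ encRole R₂)

def encOntology (O : Ontology) : List Sym :=
  encList encBits O.concepts ++ (encList encBits O.roles ++ encList encAssertion O.assertions)

def encOntAtom : OntAtom → List Sym
  | .concept A x => Sym.bit false :: (encAtomicConcept A ++ encBits x)
  | .role P x y => Sym.bit true :: (encBits P ++ (encBits x ++ encBits y))

def encCQ (q : CQ OntAtom) : List Sym := encList encBits q.target ++ encList encOntAtom q.body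

def encUCQ (q : UCQ) : List Sym := encNat q.arity ++ encList encCQ q.disjuncts

def encGLAV (m : GLAV) : List Sym :=
  encList encBits m.target ++ (encList encRelAtom m.srcBody ++ encList encOntAtom m.ontBody)

def encSystem (Sys : System) : List Sym :=
  encOntology Sys.ontology ++ (encSchema Sys.schema ++
    (encList encGLAV Sys.mapping ++ encList encRelAtom Sys.database))

def encDataset (l : Dataset) : List Sym :=
  encNat l.arity ++ encList (encList encBits) l.tuples

def encInstance (J : Instance) : List Sym :=
  encSystem J.system ++ (encDataset J.dataset ++ encUCQ J.query)

/-- Complete-VQDEF(DL-Lite_R, GLAV, UCQ): the encodings of the inputs whose query is a complete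
characterization of the dataset. -/
def completeVQDEF : Language Sym :=
  {s | ∃ J : Instance, J.WF ∧
    J.system.IsCompleteCharacterization J.dataset J.query ∧ encInstance J = s}

/-! ### Distinct inputs have distinct encodings -/

/-- From a string that begins with a code word, the word and what it encodes can be recovered. -/
def PrefixCode {α : Type} (e : α → List Sym) : Prop :=
  ∀ a b s t, e a ++ s = e b ++ t → a = b ∧ s = t

theorem prefixCode_bits : PrefixCode encBits := by
  intro a
  induction a with
  | nil => intro b s t h; cases b <;> simp_all [encBits]
  | cons x a ih =>
    intro b s t h
    cases b with
    | nil => simp [encBits] at h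
    | cons y b =>
      simp only [encBits, List.map_cons, List.cons_append, List.cons.injEq, Sym.bit.injEq] at h
      obtain ⟨h1, h2⟩ := ih b s t h.2
      exact ⟨by rw [h.1, h1], h2⟩

theorem prefixCode_nat : PrefixCode encNat := by
  intro a
  induction a with
  | zero => intro b s t h; cases b <;> simp_all [encNat, List.replicate_succ]
  | succ a ih =>
    intro b s t h
    cases b with
    | zero => simp [encNat, List.replicate_succ] at h
    | succ b =>
      simp only [encNat, List.replicate_succ, List.cons_append, List.cons.injEq, true_and] at h
      obtain ⟨h1, h2⟩ := ih b s t h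
      exact ⟨by rw [h1], h2⟩

theorem PrefixCode.list {α : Type} {e : α → List Sym} (he : PrefixCode e) :
    PrefixCode (encList e) := by
  intro a
  induction a with
  | nil => intro b s t h; cases b <;> simp_all [encList]
  | cons x a ih =>
    intro b s t h
    cases b with
    | nil => simp [encList] at h
    | cons y b =>
      simp only [encList, List.cons_append, List.append_assoc, List.cons.injEq, true_and] at h
      obtain ⟨h1, h2⟩ := he _ _ _ _ h
      obtain ⟨h3, h4⟩ := ih b s t h2
      exact ⟨by rw [h1, h3], h4⟩

theorem PrefixCode.pair {α β : Type} {e : α → List Sym} {f : β → List Sym} (he : PrefixCode e)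
    (hf : PrefixCode f) : PrefixCode (fun p : α × β => e p.1 ++ f p.2) := by
  rintro ⟨a, b⟩ ⟨a', b'⟩ s t h
  simp only [List.append_assoc] at h
  obtain ⟨rfl, h2⟩ := he _ _ _ _ h
  obtain ⟨rfl, h4⟩ := hf _ _ _ _ h2
  exact ⟨rfl, h4⟩

theorem PrefixCode.comp {α β : Type} {e : α → List Sym} (he : PrefixCode e) (f : β → α)
    (hf : Function.Injective f) : PrefixCode (fun b => e (f b)) := by
  intro a b s t h
  obtain ⟨h1, h2⟩ := he _ _ _ _ h
  exact ⟨hf h1, h2⟩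

theorem prefixCode_relAtom : PrefixCode encRelAtom :=
  (prefixCode_bits.pair prefixCode_bits.list).comp (fun a : RelAtom (List Bool) => (a.pred, a.args))
    (by rintro ⟨⟩ ⟨⟩ h; simp_all)

theorem prefixCode_atomicConcept : PrefixCode encAtomicConcept := by
  rintro (_ | _ | A) (_ | _ | B) s t h <;> simp [encAtomicConcept] at h ⊢
  · exact h
  · exact h
  · exact prefixCode_bits _ _ _ _ h

theorem prefixCode_role : PrefixCode encRole := by
  rintro (A | A) (B | B) s t h <;> simp [encRole] at h ⊢ <;> exact prefixCode_bits _ _ _ _ h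

theorem prefixCode_concept : PrefixCode encConcept := by
  rintro (A | A) (B | B) s t h <;> simp [encConcept] at h ⊢
  · exact prefixCode_atomicConcept _ _ _ _ h
  · exact prefixCode_role _ _ _ _ h

theorem prefixCode_assertion : PrefixCode encAssertion := by
  have hC := prefixCode_concept.pair prefixCode_concept
  have hR := prefixCode_role.pair prefixCode_role
  rintro (⟨A, B⟩ | ⟨A, B⟩ | ⟨A, B⟩ | ⟨A, B⟩) (⟨A', B'⟩ | ⟨A', B'⟩ | ⟨A', B'⟩ | ⟨A', B'⟩) s t h <;>
    simp only [encAssertion, List.cons_append, List.cons.injEq, Sym.bit.injEq, reduceCtorEq,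
      true_and, false_and] at h
  · simpa using hC (A, B) (A', B') s t h
  · simpa using hR (A, B) (A', B') s t h
  · simpa using hC (A, B) (A', B') s t h
  · simpa using hR (A, B) (A', B') s t h

theorem prefixCode_ontAtom : PrefixCode encOntAtom := by
  have hC := prefixCode_atomicConcept.pair prefixCode_bits
  have hR := prefixCode_bits.pair (prefixCode_bits.pair prefixCode_bits)
  rintro (⟨A, x⟩ | ⟨A, x, y⟩) (⟨B, x'⟩ | ⟨B, x', y'⟩) s t h <;>
    simp only [encOntAtom, List.cons_append, List.cons.injEq, Sym.bit.injEq, reduceCtorEq,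
      true_and, false_and] at h
  · simpa using hC (A, x) (B, x') s t h
  · simpa using hR (A, x, y) (B, x', y') s t h

theorem prefixCode_instance : PrefixCode encInstance := by
  have hO : PrefixCode encOntology :=
    (prefixCode_bits.list.pair (prefixCode_bits.list.pair prefixCode_assertion.list)).comp
      (fun O : Ontology => (O.concepts, O.roles, O.assertions)) (by rintro ⟨⟩ ⟨⟩ h; simp_all)
  have hS : PrefixCode encSchema := (prefixCode_bits.pair prefixCode_nat).list
  have hM : PrefixCode encGLAV :=
    (prefixCode_bits.list.pair (prefixCode_relAtom.list.pair prefixCode_ontAtom.list)).comp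
      (fun m : GLAV => (m.target, m.srcBody, m.ontBody)) (by rintro ⟨⟩ ⟨⟩ h; simp_all)
  have hQ : PrefixCode encCQ :=
    (prefixCode_bits.list.pair prefixCode_ontAtom.list).comp
      (fun q : CQ OntAtom => (q.target, q.body)) (by rintro ⟨⟩ ⟨⟩ h; simp_all)
  have hU : PrefixCode encUCQ :=
    (prefixCode_nat.pair hQ.list).comp
      (fun q : UCQ => (q.arity, q.disjuncts)) (by rintro ⟨⟩ ⟨⟩ h; simp_all)
  have hD : PrefixCode encDataset :=
    (prefixCode_nat.pair prefixCode_bits.list.list).comp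
      (fun l : Dataset => (l.arity, l.tuples)) (by rintro ⟨⟩ ⟨⟩ h; simp_all)
  have hSys : PrefixCode encSystem :=
    (hO.pair (hS.pair (hM.list.pair prefixCode_relAtom.list))).comp
      (fun Sys : System => (Sys.ontology, Sys.schema, Sys.mapping, Sys.database))
      (by rintro ⟨⟩ ⟨⟩ h; simp_all)
  exact (hSys.pair (hD.pair hU)).comp (fun J : Instance => (J.system, J.dataset, J.query))
    (by rintro ⟨⟩ ⟨⟩ h; simp_all)

/-- Distinct inputs have distinct encodings. -/
theorem encInstance_injective : Function.Injective encInstance := by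
  intro a b h
  exact (prefixCode_instance a b [] [] (by rw [h])).1

end OBDM

/-! A tuple is a certain answer for a reason of polynomial size, and the dataset lists its tuples,
so it is enough to certify each tuple in turn.

The reason lives in a canonical model. Its roots are the constants, a null for every existential
variable of a mapping assertion applied to an answer, and one extra point; below the roots hang the
sequences of roles that the positive inclusions force to exist. The concepts of an element that is
not a root are determined by its last role. This model maps to every model of the system
(`holdsC_sound`, `holdsR_sound`), and it is a model itself unless it violates a negative assertion
or gives an element to ⊥, in which case no model exists. So a tuple over the database is a certain
answer iff there is a violation or some disjunct has a match in the canonical model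
(`System.mem_cert_iff`).

Elements of the canonical model can be arbitrarily deep, but witnesses can be pruned. A path from
the extra point may start with any role that is non-empty in every model. An element whose parent is
not used by the witness can therefore be moved directly below that point, keeping only its last
role: its concepts are unchanged, and so are its relations to the other elements in use
(`HoldsC.cut`, `HoldsR.cut`). Afterwards the number of roles in a path exceeds the number of
elements in use by at most one, and matches have polynomial size (`System.exists_short_match`). What
remains to be checked is easy to certify: a derived inclusion by a repetition-free path in the graph
of inclusions, an answer over the database by an assignment.

For the machine model, a program is a regular expression over the actions push, pop and test for
emptiness on finitely many stacks. The certificate is the word of actions itself; a Turing machine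
executes it while a finite automaton checks that it belongs to the expression (`inNP_of_program`).
On top of such programs, `Checkable`, `NPPred` and `NPFun` give a calculus closed under conjunction,
disjunction, polynomially bounded existence, iteration of length-decreasing relations, and hence
quantification over the elements of a list. The final proof writes the decision problem in this
calculus. Negation is not available, so the few negative conditions that occur are reduced to
inequality of bit strings, which has certificates of its own (`NPPred.bits_ne`). -/

/-! ### Regular expressions denote regular languages -/

namespace Language

variable {α : Type}

/-- Myhill–Nerode: finitely many left quotients suffice, and there are finitely many when the
quotient by `x` depends only on a datum with finitely many values. -/
theorem IsRegular.of_leftQuotient_eq {β : Type} {L : Language α} (f : β → Language α)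
    (g : List α → β) (hg : (Set.range g).Finite) (h : ∀ x, L.leftQuotient x = f (g x)) :
    L.IsRegular := by
  apply IsRegular.of_finite_range_leftQuotient
  refine (hg.image f).subset ?_
  rintro _ ⟨x, rfl⟩
  exact ⟨g x, ⟨x, rfl⟩, (h x).symm⟩

theorem isRegular_zero : (0 : Language α).IsRegular :=
  IsRegular.of_leftQuotient_eq (fun _ : Unit => 0) (fun _ => ()) (Set.toFinite _) fun _ => rfl

theorem isRegular_one : (1 : Language α).IsRegular := by
  classical
  refine IsRegular.of_leftQuotient_eq (fun b : Bool => if b then 1 else 0)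
    (fun x => decide (x = [])) (Set.toFinite _) fun x => ?_
  ext y
  by_cases hx : x = [] <;> simp [hx, mem_leftQuotient, mem_one, notMem_zero]

theorem isRegular_singleton (a : α) : ({[a]} : Language α).IsRegular := by
  classical
  refine IsRegular.of_leftQuotient_eq
    (fun b : Bool × Bool => if b.1 then {[a]} else if b.2 then 1 else 0)
    (fun x => (decide (x = []), decide (x = [a]))) (Set.toFinite _) fun x => ?_
  ext y
  rw [mem_leftQuotient]
  rcases x with _ | ⟨b, _ | ⟨c, x⟩⟩
  · simp
  · by_cases hb : b = a
    · subst hb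
      simp only [List.cons_append, List.nil_append, reduceCtorEq, decide_false, decide_true,
        Bool.false_eq_true, if_true, if_false, mem_one]
      exact ⟨fun h => (List.cons.inj h).2, fun h => by subst h; rfl⟩
    · simp only [List.cons_append, List.nil_append, reduceCtorEq, decide_false, List.cons.injEq, hb,
        and_true, Bool.false_eq_true, if_false, notMem_zero, iff_false]
      exact fun h => hb (List.cons.inj h).1
  · simp only [List.cons_append, reduceCtorEq, decide_false, List.cons.injEq, and_false,
      Bool.false_eq_true, if_false, notMem_zero, iff_false]
    exact fun h => by simpa using congrArg List.length h

/-- The left quotients of `L` by the words `v` such that `x = u ++ v` with `u ∈ K`. -/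
def splitQuotients (K L : Language α) (x : List α) : Set (Language α) :=
  {Q | ∃ u v, x = u ++ v ∧ u ∈ K ∧ Q = L.leftQuotient v}

/-- Each value is a set of left quotients of `L`, and a finite set has finitely many subsets. -/
theorem finite_range_splitQuotients (K : Language α) {L : Language α} (hL : L.IsRegular) :
    (Set.range (splitQuotients K L)).Finite := by
  refine hL.finite_range_leftQuotient.finite_subsets.subset ?_
  rintro _ ⟨x, rfl⟩ _ ⟨u, v, _, _, rfl⟩
  exact ⟨v, rfl⟩

/-- When `x` has been read, either the first factor is still unfinished, which the quotient of `K`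
by `x` records, or it ended inside `x`, and then `splitQuotients` records what may be left of the
second factor. -/
theorem IsRegular.mul {K L : Language α} (hK : K.IsRegular) (hL : L.IsRegular) :
    (K * L).IsRegular := by
  refine IsRegular.of_leftQuotient_eq
    (fun p : Language α × Set (Language α) => {y | y ∈ p.1 * L ∨ ∃ Q ∈ p.2, y ∈ Q})
    (fun x => (K.leftQuotient x, splitQuotients K L x)) ?_ fun x => ?_
  · refine (hK.finite_range_leftQuotient.prod (finite_range_splitQuotients K hL)).subset ?_
    rintro _ ⟨x, rfl⟩
    exact ⟨⟨x, rfl⟩, ⟨x, rfl⟩⟩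
  · ext y
    change x ++ y ∈ K * L ↔ (y ∈ K.leftQuotient x * L ∨ ∃ Q ∈ splitQuotients K L x, y ∈ Q)
    constructor
    · rintro ⟨u, hu, v, hv, huv⟩
      rcases List.append_eq_append_iff.1 huv with ⟨r, hr, hv'⟩ | ⟨r, hr, hv'⟩
      · subst hr
        subst hv'
        exact Or.inr ⟨_, ⟨u, r, rfl, hu, rfl⟩, hv⟩
      · subst hr
        subst hv'
        exact Or.inl ⟨r, hu, v, hv, rfl⟩
    · rintro (⟨u, hu, v, hv, rfl⟩ | ⟨_, ⟨u, v, rfl, hu, rfl⟩, hy⟩)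
      · exact ⟨x ++ u, hu, v, hv, by simp⟩
      · exact ⟨u, hu, v ++ y, hy, by simp⟩

/-- In a factorization of `x ++ y`, some factor straddles the boundary, unless there are no factors
after it: the first datum covers the case that the boundary falls between factors, the second the
case of a straddling factor. -/
theorem IsRegular.kstar {L : Language α} (hL : L.IsRegular) : (KStar.kstar L).IsRegular := by
  refine IsRegular.of_leftQuotient_eq
    (fun p : Prop × Set (Language α) =>
      {y | (p.1 ∧ y ∈ KStar.kstar L) ∨ ∃ Q ∈ p.2, y ∈ Q * KStar.kstar L})
    (fun x => (x ∈ KStar.kstar L, splitQuotients (KStar.kstar L) L x)) ?_ fun x => ?_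
  · refine ((Set.toFinite (Set.univ : Set Prop)).prod
      (finite_range_splitQuotients (KStar.kstar L) hL)).subset ?_
    rintro _ ⟨x, rfl⟩
    exact ⟨trivial, ⟨x, rfl⟩⟩
  · have app : ∀ u ∈ KStar.kstar L, ∀ v ∈ KStar.kstar L, u ++ v ∈ KStar.kstar L := by
      rintro _ ⟨S, rfl, hS⟩ _ ⟨T, rfl, hT⟩
      refine ⟨S ++ T, by simp, fun y hy => ?_⟩
      rcases List.mem_append.1 hy with h | h
      exacts [hS y h, hT y h]
    have one : ∀ u ∈ L, u ∈ KStar.kstar L := fun u hu => ⟨[u], by simp, by simpa using hu⟩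
    ext y
    change x ++ y ∈ KStar.kstar L ↔ ((x ∈ KStar.kstar L ∧ y ∈ KStar.kstar L) ∨
      ∃ Q ∈ splitQuotients (KStar.kstar L) L x, y ∈ Q * KStar.kstar L)
    constructor
    · rintro ⟨S, hS, hL'⟩
      induction S generalizing x with
      | nil =>
        simp only [List.flatten_nil, List.append_eq_nil_iff] at hS
        obtain ⟨rfl, rfl⟩ := hS
        exact Or.inl ⟨⟨[], rfl, by simp⟩, ⟨[], rfl, by simp⟩⟩
      | cons w S ih =>
        have hw : w ∈ L := hL' w (by simp)
        have hS' : ∀ z ∈ S, z ∈ L := fun z hz => hL' z (by simp [hz])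
        rw [List.flatten_cons] at hS
        rcases List.append_eq_append_iff.1 hS with ⟨r, hr, hv⟩ | ⟨r, hr, hv⟩
        · subst hr
          subst hv
          exact Or.inr ⟨L.leftQuotient x, ⟨[], x, rfl, ⟨[], rfl, by simp⟩, rfl⟩,
            ⟨r, hw, _, ⟨S, rfl, hS'⟩, rfl⟩⟩
        · subst hr
          rcases ih r hv.symm hS' with ⟨h1, h2⟩ | ⟨_, ⟨u, v, rfl, hu, rfl⟩, hy⟩
          · exact Or.inl ⟨app _ (one _ hw) _ h1, h2⟩
          · exact Or.inr ⟨_, ⟨w ++ u, v, by simp, app _ (one _ hw) _ hu, rfl⟩, hy⟩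
    · rintro (⟨h1, h2⟩ | ⟨_, ⟨u, v, rfl, hu, rfl⟩, ⟨a, ha, b, hb, rfl⟩⟩)
      · exact app _ h1 _ h2
      · have := app _ (app _ hu _ (one _ ha)) _ hb
        simpa using this

end Language

theorem RegularExpression.isRegular_matches' {α : Type} (P : RegularExpression α) :
    P.matches'.IsRegular := by
  induction P with
  | zero => exact Language.isRegular_zero
  | epsilon => exact Language.isRegular_one
  | char a => exact Language.isRegular_singleton a
  | plus P Q hP hQ => exact hP.add hQ
  | comp P Q hP hQ => exact hP.mul hQ
  | star P hP => exact hP.kstar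

/-! ### Stack programs and the Turing machine that executes them -/

namespace StackProg

open OBDM (Sym)

/-- The strings held in the registers of a program. -/
abbrev Str := List Sym

/-- The actions of a program on its registers, which are stacks indexed by `K`. -/
inductive Act (K : Type) where
  | push (i : K) (a : Sym)
  | pop (i : K) (a : Sym)
  | empty (i : K)

namespace Act

variable {K K' : Type}

/-- The register on which an action works. -/
def reg : Act K → K
  | push i _ => i
  | pop i _ => i
  | empty i => i

def map (f : K → K') : Act K → Act K'
  | push i a => push (f i) a
  | pop i a => pop (f i) a
  | empty i => empty (f i)

instance [Finite K] : Finite (Act K) := by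
  refine Finite.of_surjective
    (fun x : (K × Sym) ⊕ (K × Sym) ⊕ K => match x with
      | .inl (i, a) => push i a
      | .inr (.inl (i, a)) => pop i a
      | .inr (.inr i) => empty i) ?_
  rintro (⟨i, a⟩ | ⟨i, a⟩ | i)
  exacts [⟨.inl (i, a), rfl⟩, ⟨.inr (.inl (i, a)), rfl⟩, ⟨.inr (.inr i), rfl⟩]

/-- The effect of an action: `pop i a` requires `a` to be on top of register `i`, and `empty i`
requires register `i` to be empty. -/
def Rel [DecidableEq K] : Act K → (K → Str) → (K → Str) → Prop
  | push i a, s, t => t = Function.update s i (a :: s i)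
  | pop i a, s, t => s i = a :: t i ∧ t = Function.update s i (t i)
  | empty i, s, t => s i = [] ∧ t = s

theorem map_rel [DecidableEq K] [DecidableEq K'] {f : K → K'} (hf : Function.Injective f)
    (a : Act K) (s t : K' → Str) :
    (a.map f).Rel s t ↔ a.Rel (s ∘ f) (t ∘ f) ∧ ∀ k, k ∉ Set.range f → t k = s k := by
  have key : ∀ (i : K) (l : Str), t = Function.update s (f i) l ↔
      t ∘ f = Function.update (s ∘ f) i l ∧ ∀ k, k ∉ Set.range f → t k = s k := by
    intro i l
    constructor
    · rintro rfl
      refine ⟨Function.update_comp_eq_of_injective _ hf _ _, fun k hk => ?_⟩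
      exact Function.update_of_ne (fun h => hk ⟨i, h.symm⟩) _ _
    · rintro ⟨h1, h2⟩
      funext k
      by_cases hk : k ∈ Set.range f
      · obtain ⟨j, rfl⟩ := hk
        have := congrFun h1 j
        rw [← Function.update_comp_eq_of_injective s hf] at this
        exact this
      · rw [h2 k hk, Function.update_of_ne (fun h => hk ⟨i, h.symm⟩)]
  cases a with
  | push i a => exact key i _
  | pop i a =>
    simp only [map, Rel, Function.comp_apply]
    rw [key i (t (f i)), and_assoc]
  | empty i =>
    simp only [map, Rel, Function.comp_apply, and_assoc]
    refine and_congr_right fun _ => ⟨?_, ?_⟩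
    · rintro rfl
      exact ⟨rfl, fun _ _ => rfl⟩
    · rintro ⟨h1, h2⟩
      funext k
      by_cases hk : k ∈ Set.range f
      · obtain ⟨j, rfl⟩ := hk
        exact congrFun h1 j
      · exact h2 k hk

end Act

/-- The effect of a word of actions. -/
def Run {K : Type} [DecidableEq K] : List (Act K) → (K → Str) → (K → Str) → Prop
  | [], s, t => s = t
  | a :: w, s, t => ∃ u, a.Rel s u ∧ Run w u t

section Run

variable {K K' : Type} [DecidableEq K] [DecidableEq K']

theorem run_append {v w : List (Act K)} {s t : K → Str} :
    Run (v ++ w) s t ↔ ∃ u, Run v s u ∧ Run w u t := by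
  induction v generalizing s with
  | nil => simp [Run]
  | cons a v ih =>
    simp only [List.cons_append, Run, ih]
    constructor
    · rintro ⟨u, h1, u', h2, h3⟩
      exact ⟨u', ⟨u, h1, h2⟩, h3⟩
    · rintro ⟨u', ⟨u, h1, h2⟩, h3⟩
      exact ⟨u, h1, u', h2, h3⟩

/-- Used twice: to pass from registers indexed by `ℕ` to the finitely many stacks of a machine, and
to move a program to higher registers so that it can serve as a subroutine. -/
theorem run_map {f : K → K'} (hf : Function.Injective f) (w : List (Act K)) (s t : K' → Str) :
    Run (w.map (Act.map f)) s t ↔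
      Run w (s ∘ f) (t ∘ f) ∧ ∀ k, k ∉ Set.range f → t k = s k := by
  classical
  induction w generalizing s with
  | nil =>
    simp only [List.map_nil, Run]
    constructor
    · rintro rfl
      exact ⟨rfl, fun _ _ => rfl⟩
    · rintro ⟨h1, h2⟩
      funext k
      by_cases hk : k ∈ Set.range f
      · obtain ⟨j, rfl⟩ := hk
        exact congrFun h1 j
      · exact (h2 k hk).symm
  | cons a w ih =>
    simp only [List.map_cons, Run, Act.map_rel hf, ih]
    constructor
    · rintro ⟨u, ⟨h1, h2⟩, h3, h4⟩
      exact ⟨⟨u ∘ f, h1, h3⟩, fun k hk => (h4 k hk).trans (h2 k hk)⟩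
    · rintro ⟨⟨u, h1, h3⟩, h4⟩
      -- The intermediate state is `u` on the renamed registers and, elsewhere, the initial
      -- contents, which no action of the word touches.
      have hu : (fun k => if h : k ∈ Set.range f then u h.choose else s k) ∘ f = u := by
        funext j
        have hj : f j ∈ Set.range f := ⟨j, rfl⟩
        simp only [Function.comp_apply, dif_pos hj]
        rw [hf hj.choose_spec]
      refine ⟨fun k => if h : k ∈ Set.range f then u h.choose else s k, ⟨?_, ?_⟩, ?_, ?_⟩
      · rwa [hu]
      · intro k hk
        simp [hk]
      · rwa [hu]
      · intro k hk
        simp only [hk, dif_neg, not_false_eq_true, h4 k hk]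

theorem exists_run_map {f : K → K'} (hf : Function.Injective f) (w : List (Act K))
    (s : K' → Str) : (∃ t, Run (w.map (Act.map f)) s t) ↔ ∃ t, Run w (s ∘ f) t := by
  classical
  constructor
  · rintro ⟨t, ht⟩
    exact ⟨_, ((run_map hf w s t).1 ht).1⟩
  · rintro ⟨t, ht⟩
    have hu : (fun k => if h : k ∈ Set.range f then t h.choose else s k) ∘ f = t := by
      funext j
      have hj : f j ∈ Set.range f := ⟨j, rfl⟩
      simp only [Function.comp_apply, dif_pos hj]
      rw [hf hj.choose_spec]
    refine ⟨fun k => if h : k ∈ Set.range f then t h.choose else s k, (run_map hf w s _).2 ⟨?_, ?_⟩⟩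
    · rwa [hu]
    · intro k hk
      simp [hk]

end Run

/-! ### The machine that executes a word of actions -/

section Machine

variable {K : Type} [DecidableEq K]

/-- The effect of an action on a machine that records in a flag whether an action has failed. -/
def flagStep : Act K → (K → Str) × Bool → (K → Str) × Bool
  | .push i a, (s, b) => (Function.update s i (a :: s i), b)
  | .pop i a, (s, b) => (Function.update s i (s i).tail, b && decide ((s i).head? = some a))
  | .empty i, (s, b) => (s, b && decide ((s i).head? = none))

def flagRun (w : List (Act K)) (c : (K → Str) × Bool) : (K → Str) × Bool :=
  w.foldl (fun c a => flagStep a c) c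

theorem flagRun_false (w : List (Act K)) (s : K → Str) : (flagRun w (s, false)).2 = false := by
  induction w generalizing s with
  | nil => rfl
  | cons a w ih =>
    cases a <;> exact ih _

/-- The machine does not abort: a failed action only lowers the flag, which never rises again by
`flagRun_false`. As long as the flag is up, the deterministic execution is the unique run of the
word. -/
theorem flagRun_eq_true_iff (w : List (Act K)) (s : K → Str) :
    (flagRun w (s, true)).2 = true ↔ ∃ t, Run w s t := by
  induction w generalizing s with
  | nil => simp [flagRun, Run]
  | cons a w ih =>
    change (flagRun w (flagStep a (s, true))).2 = true ↔ ∃ t u, a.Rel s u ∧ Run w u t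
    rw [exists_comm]
    cases a with
    | push i a => simp [flagStep, Act.Rel, ih]
    | pop i a =>
      rcases h : s i with _ | ⟨b, l⟩
      · simp [flagStep, Act.Rel, h, flagRun_false]
      · by_cases hb : b = a
        · subst hb
          simp only [flagStep, h, List.tail_cons, List.head?_cons, decide_true, Bool.and_self, ih,
            Act.Rel, List.cons.injEq, true_and]
          constructor
          · rintro ⟨t, ht⟩
            exact ⟨_, t, ⟨by simp, by simp⟩, ht⟩
          · rintro ⟨u, t, ⟨h1, h2⟩, ht⟩
            rw [← h1] at h2
            exact ⟨t, h2 ▸ ht⟩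
        · simp [flagStep, Act.Rel, h, flagRun_false, hb]
    | empty i =>
      rcases h : s i with _ | ⟨b, l⟩
      · simp [flagStep, Act.Rel, h, ih]
      · simp [flagStep, Act.Rel, h, flagRun_false]

theorem flagStep_length_le {n : ℕ} (a : Act K) (s : K → Str) (b : Bool)
    (h : ∀ i, (s i).length ≤ n) (i : K) : ((flagStep a (s, b)).1 i).length ≤ n + 1 := by
  have h0 := h i
  cases a with
  | push j a =>
    simp only [flagStep, Function.update_apply]
    split_ifs with hij
    · subst hij; simpa using h0
    · lia
  | pop j a =>
    simp only [flagStep, Function.update_apply]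
    split_ifs with hij
    · subst hij; simp only [List.length_tail]; lia
    · lia
  | empty j => simp only [flagStep]; lia

end Machine

/-- The stacks of the machine. -/
inductive Stack (N : ℕ) where
  | inp
  | out
  | work (i : Fin N)
  deriving DecidableEq

/-- The labels of the machine. -/
inductive Label (N : ℕ) where
  | read
  | load (a : Sym)
  | exec (a : Act (Fin N))
  | clear
  | finish

instance (N : ℕ) : Finite (Stack N) := by
  refine Finite.of_surjective
    (fun x : Option (Option (Fin N)) => match x with
      | none => Stack.inp
      | some none => Stack.out
      | some (some i) => Stack.work i) ?_
  rintro (_ | _ | i)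
  exacts [⟨none, rfl⟩, ⟨some none, rfl⟩, ⟨some (some i), rfl⟩]

instance (N : ℕ) : Finite (Label N) := by
  refine Finite.of_surjective
    (fun x : Fin 3 ⊕ Sym ⊕ Act (Fin N) => match x with
      | .inl 0 => Label.read
      | .inl 1 => Label.clear
      | .inl 2 => Label.finish
      | .inr (.inl a) => Label.load a
      | .inr (.inr a) => Label.exec a) ?_
  rintro (_ | a | a | _ | _)
  exacts [⟨.inl 0, rfl⟩, ⟨.inr (.inl a), rfl⟩, ⟨.inr (.inr a), rfl⟩, ⟨.inl 1, rfl⟩,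
    ⟨.inl 2, rfl⟩]

/-- The alphabets of the stacks. -/
abbrev stackAlphabet (N : ℕ) : Stack N → Type
  | .inp => Sym ⊕ Act (Fin N)
  | .out => Bool
  | .work _ => Sym

/-- The internal state: the state of the control automaton, whether all actions have succeeded so
far, the last symbol read, and whether a non-empty register was seen while clearing. -/
structure Control (Q : Type) (N : ℕ) where
  state : Q
  ok : Bool
  cur : Option (Sym ⊕ Act (Fin N))
  seen : Bool

instance (Q : Type) [Finite Q] (N : ℕ) : Finite (Control Q N) := by
  refine Finite.of_surjective
    (fun x : Q × Bool × Option (Sym ⊕ Act (Fin N)) × Bool =>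
      (⟨x.1, x.2.1, x.2.2.1, x.2.2.2⟩ : Control Q N)) ?_
  rintro ⟨a, b, c, d⟩
  exact ⟨(a, b, c, d), rfl⟩

section Program

open Turing.TM2 Turing.TM2.Stmt

variable {Q : Type} {N : ℕ} (M : DFA (Act (Fin N)) Q) (r₀ : Fin N)

def nextLabel : Option (Sym ⊕ Act (Fin N)) → Label N
  | none => .clear
  | some (.inl a) => .load a
  | some (.inr a) => .exec a

/-- Execute an action and advance the control automaton. -/
def execStmt (a : Act (Fin N)) : Stmt (stackAlphabet N) (Label N) (Control Q N) :=
  match a with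
  | .push i b => push (.work i) (fun _ => b)
      (load (fun v => { v with state := M.step v.state a }) (goto fun _ => .read))
  | .pop i b => pop (.work i) (fun v o => { v with ok := v.ok && decide (o = some b) })
      (load (fun v => { v with state := M.step v.state a }) (goto fun _ => .read))
  | .empty i => peek (.work i) (fun v o => { v with ok := v.ok && decide (o = none) })
      (load (fun v => { v with state := M.step v.state a }) (goto fun _ => .read))

/-- Pop the listed registers and start again if one of them was not empty. -/
def clearStmt : List (Fin N) → Stmt (stackAlphabet N) (Label N) (Control Q N)
  | [] => goto fun v => if v.seen then .clear else .finish
  | i :: l => pop (.work i) (fun v o => { v with seen := v.seen || o.isSome }) (clearStmt l)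

open Classical in
-- The halting configuration required of a `TM2` computation has the initial internal state and only
-- the output stack non-empty. This is the reason for the clearing phase and for the reset in
-- `finish`.
noncomputable def program : Label N → Stmt (stackAlphabet N) (Label N) (Control Q N)
  | .read => pop .inp (fun v o => { v with cur := o }) (goto fun v => nextLabel v.cur)
  | .load a => push (.work r₀) (fun _ => a) (goto fun _ => .read)
  | .exec a => execStmt M a
  | .clear => load (fun v => { v with seen := false }) (clearStmt (List.finRange N))
  | .finish => push .out (fun v => v.ok && decide (v.state ∈ M.accept))
      (load (fun _ => ⟨M.start, true, none, false⟩) halt)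

/-- The contents of the stacks. -/
def contents (x : List (Sym ⊕ Act (Fin N))) (o : List Bool) (s : Fin N → Str) :
    ∀ k, List (stackAlphabet N k)
  | .inp => x
  | .out => o
  | .work i => s i

theorem update_contents_inp (x y : List (Sym ⊕ Act (Fin N))) (o : List Bool) (s : Fin N → Str) :
    Function.update (contents x o s) .inp y = contents y o s := by
  funext k
  cases k <;> simp [contents]

theorem update_contents_out (x : List (Sym ⊕ Act (Fin N))) (o o' : List Bool) (s : Fin N → Str) :
    Function.update (contents x o s) .out o' = contents x o' s := by
  funext k
  cases k <;> simp [contents]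

theorem update_contents_work (x : List (Sym ⊕ Act (Fin N))) (o : List Bool) (s : Fin N → Str)
    (i : Fin N) (l : Str) :
    Function.update (contents x o s) (.work i) l = contents x o (Function.update s i l) := by
  funext k
  cases k with
  | inp => simp [contents]
  | out => simp [contents]
  | work j =>
    by_cases h : j = i
    · subst h; simp [contents]
    · rw [Function.update_of_ne (by simpa using h)]
      simp [contents, h]

/-- `n` steps lead from one configuration to the other. -/
def Steps (n : ℕ) (c d : Cfg (stackAlphabet N) (Label N) (Control Q N)) : Prop :=
  (flip bind (step (program M r₀)))^[n] (some c) = some d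

variable {M r₀}

theorem Steps.cons {n : ℕ} {c c' d : Cfg (stackAlphabet N) (Label N) (Control Q N)}
    (h : step (program M r₀) c = some c') (h' : Steps M r₀ n c' d) : Steps M r₀ (n + 1) c d := by
  rw [Steps, Function.iterate_succ_apply]
  have : flip bind (step (program M r₀)) (some c) = some c' := h
  rw [this]
  exact h'

theorem stepAux_execStmt (a : Act (Fin N)) (q : Q) (b d : Bool) (cur) (x o) (s : Fin N → Str) :
    stepAux (execStmt M a) ⟨q, b, cur, d⟩ (contents x o s) =
      ⟨some .read, ⟨M.step q a, (flagStep a (s, b)).2, cur, d⟩,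
        contents x o (flagStep a (s, b)).1⟩ := by
  cases a with
  | push i a => simp [execStmt, flagStep, update_contents_work, contents]
  | pop i a =>
    simp [execStmt, flagStep, update_contents_work, contents]
    rfl
  | empty i => simp [execStmt, flagStep, contents]

/-- One pass pops one symbol from each listed register. Without repetitions in `l`, earlier pops do
not affect later tests. -/
theorem stepAux_clearStmt (l : List (Fin N)) (hl : l.Nodup) (v : Control Q N) (x o)
    (s : Fin N → Str) :
    stepAux (clearStmt l) v (contents x o s) =
      ⟨some (if v.seen || l.any (fun i => !(s i).isEmpty) then .clear else .finish),
        { v with seen := v.seen || l.any (fun i => !(s i).isEmpty) },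
        contents x o (fun i => if i ∈ l then (s i).tail else s i)⟩ := by
  induction l generalizing v s with
  | nil => simp [clearStmt]
  | cons i l ih =>
    have hi : i ∉ l := (List.nodup_cons.1 hl).1
    have h1 : (l.any fun j => !(Function.update s i (s i).tail j).isEmpty) =
        l.any fun j => !(s j).isEmpty := by
      rw [Bool.eq_iff_iff, List.any_eq_true, List.any_eq_true]
      refine exists_congr fun j => and_congr_right fun hj => ?_
      rw [Function.update_of_ne (fun h : j = i => hi (h ▸ hj))]
    have h2 : ((s i).head?.isSome : Bool) = !(s i).isEmpty := by cases s i <;> rfl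
    have h3 : (fun j => if j ∈ l then (Function.update s i (s i).tail j).tail else
        Function.update s i (s i).tail j) = fun j => if j ∈ i :: l then (s j).tail else s j := by
      funext j
      by_cases hj : j = i
      · subst hj; simp [hi]
      · simp [hj]
    rw [clearStmt, stepAux.eq_3, update_contents_work]
    change stepAux (clearStmt l) _ (contents x o (Function.update s i (s i).tail)) = _
    rw [ih (List.nodup_cons.1 hl).2, h1, h3]
    simp only [contents, h2, List.any_cons, Bool.or_assoc]
    rfl

/-- At most `n` passes find a symbol, one more finds none, and `finish` is the last step. -/
theorem steps_clear (n : ℕ) (s : Fin N → Str) (hs : ∀ i, (s i).length ≤ n) (q : Q) (b d : Bool)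
    (cur) : ∃ m ≤ n + 2, Steps M r₀ m ⟨some .clear, ⟨q, b, cur, d⟩, contents [] [] s⟩
      ⟨none, ⟨M.start, true, none, false⟩,
        contents [] [b && @decide (q ∈ M.accept) (Classical.propDecidable _)] (fun _ => [])⟩ := by
  have hstep : ∀ d, step (program M r₀) ⟨some .clear, ⟨q, b, cur, d⟩, contents [] [] s⟩ =
      some ⟨some (if (List.finRange N).any (fun i => !(s i).isEmpty) then .clear else .finish),
        ⟨q, b, cur, (List.finRange N).any (fun i => !(s i).isEmpty)⟩,
        contents [] [] (fun i => (s i).tail)⟩ := by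
    intro d
    rw [step.eq_2, program, stepAux.eq_4, stepAux_clearStmt _ (List.nodup_finRange N)]
    simp
  by_cases hany : (List.finRange N).any (fun i => !(s i).isEmpty) = true
  · cases n with
    | zero =>
      simp only [List.any_eq_true] at hany
      obtain ⟨i, -, hi⟩ := hany
      have := hs i
      simp only [nonpos_iff_eq_zero, List.length_eq_zero_iff] at this
      simp [this] at hi
    | succ n =>
      obtain ⟨m, hm, h⟩ := steps_clear n (fun i => (s i).tail)
        (fun i => by have := hs i; simp only [List.length_tail]; lia) q b true cur
      refine ⟨m + 1, by lia, Steps.cons (hstep d) ?_⟩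
      rw [hany]
      exact h
  · refine ⟨2, by lia, Steps.cons (hstep d) (Steps.cons ?_ rfl)⟩
    have h0 : ∀ i, s i = [] := by
      intro i
      simp only [List.any_eq_true, not_exists, not_and] at hany
      simpa using hany i (List.mem_finRange i)
    have h1 : (fun i => (s i).tail) = fun _ : Fin N => ([] : Str) := by
      funext i; rw [h0]; rfl
    rw [if_neg hany, h1, step.eq_2, program, stepAux.eq_1, update_contents_out, stepAux.eq_4,
      stepAux.eq_7]
    rfl

/-- The factor 3: an action takes two steps, to be read and to be executed, and it may lengthen a
register, which costs one more clearing pass. At the end, the attempt to read from the empty stack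
takes one step before the `n + 2` steps of clearing. -/
theorem steps_exec (w : List (Act (Fin N))) (n : ℕ) (s : Fin N → Str)
    (hs : ∀ i, (s i).length ≤ n) (q : Q) (b : Bool) (cur) :
    ∃ m ≤ 3 * w.length + n + 3,
      Steps M r₀ m ⟨some .read, ⟨q, b, cur, false⟩, contents (w.map .inr) [] s⟩
        ⟨none, ⟨M.start, true, none, false⟩,
          contents [] [(flagRun w (s, b)).2 &&
            @decide (M.evalFrom q w ∈ M.accept) (Classical.propDecidable _)] (fun _ => [])⟩ := by
  induction w generalizing n s q b cur with
  | nil =>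
    obtain ⟨m, hm, h⟩ := steps_clear (M := M) (r₀ := r₀) n s hs q b false none
    refine ⟨m + 1, by simp only [List.length_nil]; lia, Steps.cons ?_ h⟩
    rw [List.map_nil, step.eq_2, program, stepAux.eq_3, update_contents_inp, stepAux.eq_6]
    rfl
  | cons a w ih =>
    obtain ⟨m, hm, h⟩ := ih (n + 1) (flagStep a (s, b)).1 (flagStep_length_le a s b hs)
      (M.step q a) (flagStep a (s, b)).2 (some (.inr a))
    refine ⟨m + 2, by simp only [List.length_cons]; lia, Steps.cons
      (c' := ⟨some (.exec a), ⟨q, b, some (.inr a), false⟩, contents (w.map .inr) [] s⟩)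
      ?_ (Steps.cons ?_ h)⟩
    · rw [List.map_cons, step.eq_2, program, stepAux.eq_3, update_contents_inp, stepAux.eq_6]
      rfl
    · rw [step.eq_2, program, stepAux_execStmt]

/-- The input is read from its first symbol and pushed symbol by symbol, so it arrives on register
`r₀` reversed. The count per symbol is as for actions. -/
theorem steps_load (x : Str) (w : List (Act (Fin N))) (n : ℕ) (s : Fin N → Str)
    (hs : ∀ i, (s i).length ≤ n) (cur) :
    ∃ m ≤ 3 * x.length + 3 * w.length + n + 3,
      Steps M r₀ m ⟨some .read, ⟨M.start, true, cur, false⟩,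
        contents (x.map .inl ++ w.map .inr) [] s⟩
        ⟨none, ⟨M.start, true, none, false⟩,
          contents [] [(flagRun w (Function.update s r₀ (x.reverse ++ s r₀), true)).2 &&
            @decide (M.eval w ∈ M.accept) (Classical.propDecidable _)] (fun _ => [])⟩ := by
  induction x generalizing n s cur with
  | nil =>
    obtain ⟨m, hm, h⟩ := steps_exec (M := M) (r₀ := r₀) w n s hs M.start true cur
    refine ⟨m, by simp only [List.length_nil]; lia, ?_⟩
    have hu : Function.update s r₀ (([] : Str).reverse ++ s r₀) = s := by simp
    rw [hu]
    exact h
  | cons a x ih =>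
    obtain ⟨m, hm, h⟩ := ih (n + 1) (flagStep (.push r₀ a) (s, true)).1
      (flagStep_length_le _ s true hs) (some (.inl a))
    have hu : Function.update (flagStep (.push r₀ a) (s, true)).1 r₀
        (x.reverse ++ (flagStep (.push r₀ a) (s, true)).1 r₀) =
        Function.update s r₀ ((a :: x).reverse ++ s r₀) := by
      simp [flagStep]
    rw [hu] at h
    refine ⟨m + 2, by simp only [List.length_cons]; lia, Steps.cons
      (c' := ⟨some (.load a), ⟨M.start, true, some (.inl a), false⟩,
        contents (x.map .inl ++ w.map .inr) [] s⟩) ?_ (Steps.cons ?_ h)⟩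
    · rw [List.map_cons, List.cons_append, step.eq_2, program, stepAux.eq_3, update_contents_inp,
        stepAux.eq_6]
      rfl
    · rw [step.eq_2, program, stepAux.eq_1, update_contents_work, stepAux.eq_6]
      rfl

end Program

section Verifier

open Turing

variable {Q : Type} {N : ℕ} (M : DFA (Act (Fin N)) Q) (r₀ : Fin N)

open Classical in
/-- The machine that executes a word of actions accepted by `M`, on the reversed input. -/
noncomputable def machine [Finite Q] : FinTM2 where
  K := Stack N
  kFin := Fintype.ofFinite _
  k₀ := .inp
  k₁ := .out
  Γ := stackAlphabet N
  Λ := Label N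
  main := .read
  ΛFin := Fintype.ofFinite _
  σ := Control Q N
  initialState := ⟨M.start, true, none, false⟩
  σFin := Fintype.ofFinite _
  Γk₀Fin := Fintype.ofFinite (Sym ⊕ Act (Fin N))
  m := program M r₀

open Classical in
/-- Whether the actions of `w` succeed, in sequence, on the reversed input, and `M` accepts `w`. -/
noncomputable def verifier (p : Str × List (Act (Fin N))) : Bool :=
  (flagRun p.2 (Function.update (fun _ => []) r₀ p.1.reverse, true)).2 &&
    decide (M.eval p.2 ∈ M.accept)

theorem nonempty_computable_verifier [Finite Q] :
    Nonempty (TM2ComputableInPolyTime Complexity.pairEncoding Computability.encodeBool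
      (verifier M r₀)) := by
  have key : ∀ p : Str × List (Act (Fin N)),
      Nonempty (TM2OutputsInTime (machine M r₀)
        (List.map (Equiv.refl (Sym ⊕ Act (Fin N))).invFun (Complexity.pairEncoding p))
        (some (List.map (Equiv.refl Bool).invFun
          (Computability.encodeBool (verifier M r₀ p))))
        ((Polynomial.C 3 * Polynomial.X + Polynomial.C 3 : Polynomial ℕ).eval
          (Complexity.pairEncoding p).length)) := by
    rintro ⟨x, w⟩
    obtain ⟨m, hm, h⟩ := steps_load (M := M) (r₀ := r₀) x w 0 (fun _ => []) (by simp) none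
    refine ⟨⟨⟨m, ?_⟩, ?_⟩⟩
    · have h1 : initList (machine M r₀)
          (List.map (Equiv.refl (Sym ⊕ Act (Fin N))).invFun (Complexity.pairEncoding (x, w))) =
          (⟨some .read, ⟨M.start, true, none, false⟩,
            contents (x.map .inl ++ w.map .inr) [] (fun _ => [])⟩ :
            TM2.Cfg (stackAlphabet N) (Label N) (Control Q N)) := by
        unfold initList
        congr 1
        funext k
        cases k
        · exact List.map_id _
        · rfl
        · rfl
      have h2 : haltList (machine M r₀) (List.map (Equiv.refl Bool).invFun
          (Computability.encodeBool (verifier M r₀ (x, w)))) =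
          (⟨none, ⟨M.start, true, none, false⟩,
            contents [] [verifier M r₀ (x, w)] (fun _ => [])⟩ :
            TM2.Cfg (stackAlphabet N) (Label N) (Control Q N)) := by
        unfold haltList
        congr 1
        funext k
        cases k <;> rfl
      rw [h1, Option.map_some, h2]
      simp only [List.append_nil] at h
      exact h
    · simp only [Polynomial.eval_add, Polynomial.eval_mul, Polynomial.eval_C, Polynomial.eval_X,
        Complexity.pairEncoding, List.length_append, List.length_map]
      lia
  exact ⟨{
    tm := machine M r₀
    inputAlphabet := Equiv.refl _
    outputAlphabet := Equiv.refl _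
    time := Polynomial.C 3 * Polynomial.X + Polynomial.C 3
    outputsFun := fun p => (key p).some }⟩

end Verifier

/-- The registers of the actions in a program are bounded. -/
theorem exists_reg_lt (p : RegularExpression (Act ℕ)) :
    ∃ N, ∀ w ∈ p.matches', ∀ a ∈ w, a.reg < N := by
  induction p with
  | zero => exact ⟨0, fun w hw => hw.elim⟩
  | epsilon =>
    refine ⟨0, fun w hw a ha => ?_⟩
    obtain rfl : w = [] := hw
    simp at ha
  | char b =>
    refine ⟨b.reg + 1, fun w hw a ha => ?_⟩
    obtain rfl : w = [b] := hw
    obtain rfl : a = b := by simpa using ha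
    lia
  | plus P Q hP hQ =>
    obtain ⟨M, hM⟩ := hP
    obtain ⟨N, hN⟩ := hQ
    refine ⟨M + N, fun w hw a ha => ?_⟩
    rcases hw with hw | hw
    · have := hM w hw a ha; lia
    · have := hN w hw a ha; lia
  | comp P Q hP hQ =>
    obtain ⟨M, hM⟩ := hP
    obtain ⟨N, hN⟩ := hQ
    refine ⟨M + N, ?_⟩
    rintro _ ⟨u, hu, v, hv, rfl⟩ a ha
    rcases List.mem_append.1 ha with ha | ha
    · have := hM u hu a ha; lia
    · have := hN v hv a ha; lia
  | star P hP =>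
    obtain ⟨M, hM⟩ := hP
    refine ⟨M, ?_⟩
    rintro _ ⟨S, rfl, hS⟩ a ha
    obtain ⟨u, hu, ha⟩ := List.mem_flatten.1 ha
    exact hM u (hS u hu) a ha

/-- A language is in NP if membership is witnessed by short runs of a program. -/
theorem inNP_of_program (L : Language Sym) (p : RegularExpression (Act ℕ)) (q : Polynomial ℕ)
    (sound : ∀ x w t, w ∈ p.matches' → Run w (Function.update (fun _ => []) 0 x.reverse) t → x ∈ L)
    (complete : ∀ x ∈ L, ∃ w ∈ p.matches', w.length ≤ q.eval x.length ∧
      ∃ t, Run w (Function.update (fun _ => []) 0 x.reverse) t) : Complexity.InNP L := by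
  obtain ⟨N, hN⟩ := exists_reg_lt p
  obtain ⟨Q, _, M, hM⟩ := p.isRegular_matches'
  -- One register more than the bound, so that register `0`, which receives the input, exists.
  have hinj : Function.Injective (Fin.val : Fin (N + 1) → ℕ) := Fin.val_injective
  have hV : ∀ x w, verifier (M.comap (Act.map (Fin.val : Fin (N + 1) → ℕ))) 0 (x, w) = true ↔
      w.map (Act.map Fin.val) ∈ p.matches' ∧
        ∃ t, Run (w.map (Act.map Fin.val)) (Function.update (fun _ => []) 0 x.reverse) t := by
    classical
    intro x w
    have hs : (Function.update (fun _ => []) 0 x.reverse : ℕ → Str) ∘ Fin.val =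
        Function.update (fun _ => []) (0 : Fin (N + 1)) x.reverse :=
      Function.update_comp_eq_of_injective (fun _ => []) hinj 0 x.reverse
    rw [exists_run_map hinj, hs, ← flagRun_eq_true_iff, verifier, Bool.and_eq_true, and_comm,
      decide_eq_true_iff, ← hM, ← DFA.mem_accepts, DFA.accepts_comap]
    rfl
  refine ⟨Act (Fin (N + 1)), Fintype.ofFinite _, q, verifier (M.comap (Act.map Fin.val)) 0,
    nonempty_computable_verifier _ _, fun x => ⟨fun hx => ?_, ?_⟩⟩
  · obtain ⟨w, hw, hlen, ht⟩ := complete x hx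
    -- The registers of `w` are below `N`, so `w` is the image of a word over the finite certificate
    -- alphabet.
    have hlift : ∃ w' : List (Act (Fin (N + 1))), w'.map (Act.map Fin.val) = w := by
      have := hN w hw
      clear hw hlen ht
      induction w with
      | nil => exact ⟨[], rfl⟩
      | cons a w ih =>
        obtain ⟨w', rfl⟩ := ih fun b hb => this b (List.mem_cons_of_mem _ hb)
        have ha := this a List.mem_cons_self
        refine ⟨(match a, ha with
          | .push i b, h => .push ⟨i, Nat.lt_succ_of_lt h⟩ b
          | .pop i b, h => .pop ⟨i, Nat.lt_succ_of_lt h⟩ b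
          | .empty i, h => .empty ⟨i, Nat.lt_succ_of_lt h⟩) :: w', ?_⟩
        cases a <;> rfl
    obtain ⟨w', rfl⟩ := hlift
    exact ⟨w', by simpa using hlen, (hV x w').2 ⟨hw, ht⟩⟩
  · rintro ⟨w, -, hw⟩
    obtain ⟨h1, t, ht⟩ := (hV x w).1 hw
    exact sound x _ t h1 ht

end StackProg

theorem Polynomial.eval_nat_mono (p : Polynomial ℕ) {m n : ℕ} (h : m ≤ n) :
    p.eval m ≤ p.eval n := by
  rw [Polynomial.eval_eq_sum_range, Polynomial.eval_eq_sum_range]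
  gcongr

/-! ### Executions of bounded length and checkable predicates -/

namespace StackProg

open OBDM (Sym)

abbrev Prog := RegularExpression (Act ℕ)

abbrev Regs := ℕ → Str

/-- The program has a run of at most `n` actions from `s` to `t`. -/
def Exec (p : Prog) (n : ℕ) (s t : Regs) : Prop :=
  ∃ w ∈ p.matches', w.length ≤ n ∧ Run w s t

section Exec

variable {p q : Prog} {m n : ℕ} {s t u : Regs}

theorem Exec.mono (h : Exec p m s t) (hmn : m ≤ n) : Exec p n s t := by
  obtain ⟨w, h1, h2, h3⟩ := h
  exact ⟨w, h1, h2.trans hmn, h3⟩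

theorem Exec.mul (h₁ : Exec p m s u) (h₂ : Exec q n u t) : Exec (p * q) (m + n) s t := by
  obtain ⟨v, hv, hv', hv''⟩ := h₁
  obtain ⟨w, hw, hw', hw''⟩ := h₂
  exact ⟨v ++ w, ⟨v, hv, w, hw, rfl⟩, by rw [List.length_append]; lia,
    run_append.2 ⟨u, hv'', hw''⟩⟩

/-- Both halves simply inherit the bound `n`: decomposition serves soundness proofs only, where
lengths are irrelevant. -/
theorem Exec.of_mul (h : Exec (p * q) n s t) : ∃ u, Exec p n s u ∧ Exec q n u t := by
  obtain ⟨_, ⟨v, hv, w, hw, rfl⟩, hn, hr⟩ := h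
  obtain ⟨u, h1, h2⟩ := run_append.1 hr
  simp only [List.length_append] at hn
  exact ⟨u, ⟨v, hv, by lia, h1⟩, ⟨w, hw, by lia, h2⟩⟩

theorem exec_add : Exec (p + q) n s t ↔ Exec p n s t ∨ Exec q n s t := by
  constructor
  · rintro ⟨w, hw | hw, h⟩
    exacts [Or.inl ⟨w, hw, h⟩, Or.inr ⟨w, hw, h⟩]
  · rintro (⟨w, hw, h⟩ | ⟨w, hw, h⟩)
    exacts [⟨w, Or.inl hw, h⟩, ⟨w, Or.inr hw, h⟩]

theorem Exec.act {a : Act ℕ} (h : a.Rel s t) : Exec (.char a) 1 s t :=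
  ⟨[a], rfl, le_rfl, t, h, rfl⟩

theorem Exec.of_act {a : Act ℕ} (h : Exec (.char a) n s t) : a.Rel s t := by
  obtain ⟨w, hw, -, h⟩ := h
  obtain rfl : w = [a] := hw
  obtain ⟨u, h, rfl⟩ := h
  exact h

theorem Exec.star_nil : Exec p.star 0 s s :=
  ⟨[], ⟨[], rfl, by simp⟩, le_rfl, rfl⟩

theorem Exec.star_cons (h₁ : Exec p m s u) (h₂ : Exec p.star n u t) :
    Exec p.star (m + n) s t := by
  obtain ⟨v, hv, hv', hv''⟩ := h₁
  obtain ⟨_, ⟨S, rfl, hS⟩, hw', hw''⟩ := h₂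
  refine ⟨v ++ S.flatten, ⟨v :: S, rfl, fun y hy => ?_⟩, by rw [List.length_append]; lia,
    run_append.2 ⟨u, hv'', hw''⟩⟩
  rcases List.mem_cons.1 hy with rfl | hy
  exacts [hv, hS y hy]

theorem Exec.of_star (h : Exec p.star n s t) :
    Relation.ReflTransGen (fun s t => Exec p n s t) s t := by
  obtain ⟨_, ⟨S, rfl, hS⟩, hn, hr⟩ := h
  induction S generalizing s with
  | nil =>
    obtain rfl : s = t := hr
    exact .refl
  | cons v S ih =>
    rw [List.flatten_cons] at hr hn
    rw [List.length_append] at hn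
    obtain ⟨u, h1, h2⟩ := run_append.1 hr
    exact .head ⟨v, hS v List.mem_cons_self, by lia, h1⟩
      (ih (fun y hy => hS y (List.mem_cons_of_mem _ hy)) (by lia) h2)

/-- Choose a symbol. -/
def anySym (f : Sym → Prog) : Prog :=
  f (.bit false) + (f (.bit true) + (f .item + f .close))

theorem exec_anySym {f : Sym → Prog} : Exec (anySym f) n s t ↔ ∃ a, Exec (f a) n s t := by
  simp only [anySym, exec_add]
  constructor
  · rintro (h | h | h | h) <;> exact ⟨_, h⟩
  · rintro ⟨(_ | _) | _ | _, h⟩ <;> simp [h]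

end Exec

/-! ### Guessing and clearing a register -/

def guess (k : ℕ) : Prog := (anySym fun a => .char (.push k a)).star

/-- The loop may stop early; the final test discards the runs in which it does. -/
def clear (k : ℕ) : Prog := (anySym fun a => .char (.pop k a)).star * .char (.empty k)

theorem Exec.of_guess {k n : ℕ} {s t : Regs} (h : Exec (guess k) n s t) :
    ∃ y, t = Function.update s k (y ++ s k) := by
  have := h.of_star
  clear h
  induction this with
  | refl => exact ⟨[], by simp⟩
  | tail _ h ih =>
    obtain ⟨y, rfl⟩ := ih
    obtain ⟨a, ha⟩ := exec_anySym.1 h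
    refine ⟨a :: y, ?_⟩
    rw [ha.of_act]
    simp

theorem exec_guess (k : ℕ) (s : Regs) (y : Str) :
    Exec (guess k) y.length s (Function.update s k (y ++ s k)) := by
  -- Symbols pushed in order end up reversed, so the induction concerns `y.reverse`.
  have key : ∀ (y : Str) (s : Regs),
      Exec (guess k) y.length s (Function.update s k (y.reverse ++ s k)) := by
    intro y
    induction y with
    | nil =>
      intro s
      simp only [List.reverse_nil, List.nil_append, Function.update_eq_self]
      exact Exec.star_nil
    | cons a y ih =>
      intro s
      have h1 : Exec (anySym fun a => .char (.push k a)) 1 s (Function.update s k (a :: s k)) :=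
        exec_anySym.2 ⟨a, Exec.act rfl⟩
      have h2 := Exec.star_cons h1 (ih _)
      simp only [Function.update_idem, Function.update_self] at h2
      simp only [List.length_cons, List.reverse_cons, List.append_assoc, List.singleton_append]
      exact h2.mono (by lia)
  simpa using key y.reverse s

theorem Exec.of_clear {k n : ℕ} {s t : Regs} (h : Exec (clear k) n s t) :
    t = Function.update s k [] := by
  obtain ⟨u, h1, h2⟩ := h.of_mul
  obtain ⟨h3, rfl⟩ := h2.of_act
  have h1' := h1.of_star
  clear h h1 h2
  have key : ∀ i, i ≠ k → t i = s i := by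
    clear h3
    induction h1' with
    | refl => exact fun _ _ => rfl
    | tail _ h ih =>
      intro i hi
      obtain ⟨a, ha⟩ := exec_anySym.1 h
      rw [ha.of_act.2, Function.update_of_ne hi, ih i hi]
  funext i
  by_cases hi : i = k
  · subst hi; simpa using h3
  · rw [key i hi, Function.update_of_ne hi]

theorem exec_clear (k : ℕ) (s : Regs) :
    Exec (clear k) ((s k).length + 1) s (Function.update s k []) := by
  refine Exec.mul ?_ (Exec.act ⟨by simp, rfl⟩)
  generalize hy : s k = y
  induction y generalizing s with
  | nil =>
    rw [← hy, Function.update_eq_self, hy]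
    exact Exec.star_nil
  | cons a y ih =>
    have h1 : Exec (anySym fun a => .char (.pop k a)) 1 s (Function.update s k y) :=
      exec_anySym.2 ⟨a, Exec.act ⟨by simp [hy], by simp⟩⟩
    have h2 := Exec.star_cons h1 (ih (Function.update s k y) (by simp))
    simp only [Function.update_idem] at h2
    exact h2.mono (by simp only [List.length_cons]; lia)

/-! ### Comparing registers -/

/-- The word `y` is removed from the registers `i` and `j` and pushed on register `k`. -/
def Moved (i j k : ℕ) (y : Str) (s t : Regs) : Prop :=
  s i = y ++ t i ∧ s j = y ++ t j ∧ t k = y.reverse ++ s k ∧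
    ∀ m, m ≠ i → m ≠ j → m ≠ k → t m = s m

/-- Stacks can be compared only by popping them, so the common prefix is saved on register `k`, from
which `restoreLoop` rebuilds both. -/
def matchLoop (i j k : ℕ) : Prog :=
  (anySym fun a => .char (.pop i a) * (.char (.pop j a) * .char (.push k a))).star

def restoreLoop (i j k : ℕ) : Prog :=
  (anySym fun a => .char (.pop k a) * (.char (.push i a) * .char (.push j a))).star

section Compare

variable {i j k : ℕ}

theorem Moved.refl (i j k : ℕ) (s : Regs) : Moved i j k [] s s :=
  ⟨rfl, rfl, rfl, fun _ _ _ _ => rfl⟩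

theorem Moved.trans {y z : Str} {s t u : Regs} (h₁ : Moved i j k y s t) (h₂ : Moved i j k z t u) :
    Moved i j k (y ++ z) s u := by
  obtain ⟨a1, a2, a3, a4⟩ := h₁
  obtain ⟨b1, b2, b3, b4⟩ := h₂
  refine ⟨by rw [a1, b1, List.append_assoc], by rw [a2, b2, List.append_assoc],
    by rw [b3, a3, List.reverse_append, List.append_assoc], fun m h1 h2 h3 => ?_⟩
  rw [b4 m h1 h2 h3, a4 m h1 h2 h3]

theorem Exec.of_matchLoop (hij : i ≠ j) (hik : i ≠ k) (hjk : j ≠ k)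
    {n : ℕ} {s t : Regs} (h : Exec (matchLoop i j k) n s t) :
    ∃ y, Moved i j k y s t := by
  have := h.of_star
  clear h
  induction this with
  | refl => exact ⟨[], Moved.refl _ _ _ _⟩
  | tail _ h ih =>
    obtain ⟨y, hy⟩ := ih
    obtain ⟨a, ha⟩ := exec_anySym.1 h
    obtain ⟨u, h1, h2⟩ := ha.of_mul
    obtain ⟨v, h3, h4⟩ := h2.of_mul
    obtain ⟨e1, e2⟩ := h1.of_act
    obtain ⟨e3, e4⟩ := h3.of_act
    have e5 := h4.of_act
    refine ⟨y ++ [a], hy.trans ⟨?_, ?_, ?_, fun m h1 h2 h3 => ?_⟩⟩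
    · rw [e1, e5, Function.update_of_ne hik, e4, Function.update_of_ne hij]; rfl
    · rw [e5, Function.update_of_ne hjk]
      rw [e2, Function.update_of_ne hij.symm] at e3
      exact e3
    · rw [e5, Function.update_self, e4, Function.update_of_ne hjk.symm, e2,
        Function.update_of_ne hik.symm]
      rfl
    · rw [e5, Function.update_of_ne h3, e4, Function.update_of_ne h2, e2, Function.update_of_ne h1]

theorem Exec.of_restoreLoop (hij : i ≠ j) (hik : i ≠ k) (hjk : j ≠ k)
    {n : ℕ} {s t : Regs} (h : Exec (restoreLoop i j k) n s t) :
    ∃ y, Moved i j k y t s := by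
  have := h.of_star
  clear h
  induction this with
  | refl => exact ⟨[], Moved.refl _ _ _ _⟩
  | tail _ h ih =>
    obtain ⟨y, hy⟩ := ih
    obtain ⟨a, ha⟩ := exec_anySym.1 h
    obtain ⟨u, h1, h2⟩ := ha.of_mul
    obtain ⟨v, h3, h4⟩ := h2.of_mul
    obtain ⟨e1, e2⟩ := h1.of_act
    have e4 := h3.of_act
    have e5 := h4.of_act
    refine ⟨[a] ++ y, Moved.trans ⟨?_, ?_, ?_, fun m h1 h2 h3 => ?_⟩ hy⟩
    · rw [e5, Function.update_of_ne hij, e4, Function.update_self, e2, Function.update_of_ne hik]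
      rfl
    · rw [e5, Function.update_self, e4, Function.update_of_ne hij.symm, e2,
        Function.update_of_ne hjk]
      rfl
    · rw [e1, e5, Function.update_of_ne hjk.symm, e4, Function.update_of_ne hik.symm]; rfl
    · rw [e5, Function.update_of_ne h2, e4, Function.update_of_ne h1, e2, Function.update_of_ne h3]

theorem exec_matchLoop (hij : i ≠ j) (hik : i ≠ k) (hjk : j ≠ k)
    {y : Str} {s t : Regs} (h : Moved i j k y s t) :
    Exec (matchLoop i j k) (3 * y.length) s t := by
  induction y generalizing s with
  | nil =>
    obtain ⟨a1, a2, a3, a4⟩ := h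
    have : s = t := by
      funext m
      by_cases h1 : m = i; · rw [h1]; exact a1
      by_cases h2 : m = j; · rw [h2]; exact a2
      by_cases h3 : m = k; · rw [h3]; exact a3.symm
      exact (a4 m h1 h2 h3).symm
    subst this
    exact Exec.star_nil
  | cons a y ih =>
    obtain ⟨a1, a2, a3, a4⟩ := h
    have hb : Exec (anySym fun a => .char (.pop i a) * (.char (.pop j a) * .char (.push k a)))
        (1 + (1 + 1)) s (Function.update (Function.update (Function.update s i (y ++ t i)) j
          (y ++ t j)) k (a :: s k)) := by
      refine exec_anySym.2 ⟨a, Exec.mul (u := Function.update s i (y ++ t i))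
        (Exec.act ⟨by simp [a1], by simp⟩)
        (Exec.mul (u := Function.update (Function.update s i (y ++ t i)) j (y ++ t j))
          (Exec.act ⟨by simp [a2, hij.symm], by simp⟩) (Exec.act ?_))⟩
      simp [Act.Rel, hjk.symm, hik.symm]
    refine (Exec.star_cons hb (ih ⟨?_, ?_, ?_, fun m h1 h2 h3 => ?_⟩)).mono
      (by simp only [List.length_cons]; lia)
    · simp [hik, hij]
    · simp [hjk]
    · simp [a3]
    · simp [h1, h2, h3, a4]

theorem exec_restoreLoop (hij : i ≠ j) (hik : i ≠ k) (hjk : j ≠ k)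
    {y : Str} {s t : Regs} (h : Moved i j k y t s) :
    Exec (restoreLoop i j k) (3 * y.length) s t := by
  -- Register `k` holds the word reversed, so the last symbol is restored first.
  induction y using List.reverseRecOn generalizing s with
  | nil =>
    obtain ⟨a1, a2, a3, a4⟩ := h
    have : s = t := by
      funext m
      by_cases h1 : m = i; · rw [h1]; exact a1.symm
      by_cases h2 : m = j; · rw [h2]; exact a2.symm
      by_cases h3 : m = k; · rw [h3]; exact a3
      exact a4 m h1 h2 h3
    subst this
    exact Exec.star_nil
  | append_singleton y a ih =>
    obtain ⟨a1, a2, a3, a4⟩ := h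
    have hb : Exec (anySym fun a => .char (.pop k a) * (.char (.push i a) * .char (.push j a)))
        (1 + (1 + 1)) s (Function.update (Function.update (Function.update s k (y.reverse ++ t k)) i
          (a :: s i)) j (a :: s j)) := by
      refine exec_anySym.2 ⟨a, Exec.mul (u := Function.update s k (y.reverse ++ t k))
        (Exec.act ⟨by simp [a3], by simp⟩)
        (Exec.mul (u := Function.update (Function.update s k (y.reverse ++ t k)) i (a :: s i))
          (Exec.act (by simp [Act.Rel, hik])) (Exec.act ?_))⟩
      simp [Act.Rel, hjk, hij.symm]
    refine (Exec.star_cons hb (ih ⟨?_, ?_, ?_, fun m h1 h2 h3 => ?_⟩)).mono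
      (by simp only [List.length_append, List.length_singleton]; lia)
    · simp [hij, a1]
    · simp [a2]
    · simp [hjk.symm, hik.symm]
    · simp [h1, h2, h3, a4]

end Compare

/-! ### Checkable predicates of registers -/

/-- Only the registers below `k` are in use. -/
def Supp (k : ℕ) (s : Regs) : Prop := ∀ i, k ≤ i → s i = []

def size (k : ℕ) (s : Regs) : ℕ := ∑ i ∈ Finset.range k, (s i).length

theorem length_le_size {k i : ℕ} (h : i < k) (s : Regs) : (s i).length ≤ size k s :=
  Finset.single_le_sum (f := fun i => (s i).length) (fun _ _ => Nat.zero_le _)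
    (Finset.mem_range.2 h)

theorem size_update (k : ℕ) (s : Regs) (y : Str) :
    size (k + 1) (Function.update s k y) = size k s + y.length := by
  rw [size, Finset.sum_range_succ, Function.update_self]
  congr 1
  refine Finset.sum_congr rfl fun i hi => ?_
  rw [Function.update_of_ne (Finset.mem_range.1 hi).ne]

theorem Supp.update {k : ℕ} {s : Regs} (h : Supp k s) (y : Str) :
    Supp (k + 1) (Function.update s k y) := by
  intro i hi
  rw [Function.update_of_ne (by lia)]
  exact h i (by lia)

/-- A predicate of the registers below `k` that can be checked by a nondeterministic program, with
runs of polynomial length, that leaves the registers unchanged. -/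
def Checkable (k : ℕ) (P : Regs → Prop) : Prop :=
  ∃ (p : Prog) (q : Polynomial ℕ),
    (∀ s t n, Supp k s → Exec p n s t → t = s ∧ P s) ∧
    ∀ s, Supp k s → P s → Exec p (q.eval (size k s)) s s

namespace Checkable

variable {k : ℕ} {P Q : Regs → Prop}

theorem congr (h : Checkable k P) (hPQ : ∀ s, Supp k s → (P s ↔ Q s)) : Checkable k Q := by
  obtain ⟨p, q, h1, h2⟩ := h
  exact ⟨p, q, fun s t n hs he => ⟨(h1 s t n hs he).1, (hPQ s hs).1 (h1 s t n hs he).2⟩,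
    fun s hs hP => h2 s hs ((hPQ s hs).2 hP)⟩

theorem and (hP : Checkable k P) (hQ : Checkable k Q) : Checkable k fun s => P s ∧ Q s := by
  obtain ⟨p, q, h1, h2⟩ := hP
  obtain ⟨p', q', h1', h2'⟩ := hQ
  refine ⟨p * p', q + q', fun s t n hs he => ?_, fun s hs h => ?_⟩
  · obtain ⟨u, hu, ht⟩ := he.of_mul
    obtain ⟨rfl, hp⟩ := h1 s u n hs hu
    obtain ⟨rfl, hq⟩ := h1' _ t n hs ht
    exact ⟨rfl, hp, hq⟩
  · rw [Polynomial.eval_add]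
    exact (h2 s hs h.1).mul (h2' s hs h.2)

theorem or (hP : Checkable k P) (hQ : Checkable k Q) : Checkable k fun s => P s ∨ Q s := by
  obtain ⟨p, q, h1, h2⟩ := hP
  obtain ⟨p', q', h1', h2'⟩ := hQ
  refine ⟨p + p', q + q', fun s t n hs he => ?_, fun s hs h => ?_⟩
  · rcases exec_add.1 he with he | he
    · exact ⟨(h1 s t n hs he).1, Or.inl (h1 s t n hs he).2⟩
    · exact ⟨(h1' s t n hs he).1, Or.inr (h1' s t n hs he).2⟩
  · rw [Polynomial.eval_add, exec_add]
    rcases h with h | h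
    · exact Or.inl ((h2 s hs h).mono (by lia))
    · exact Or.inr ((h2' s hs h).mono (by lia))

/-- Guess register `k`, check, erase it. Soundness holds for guesses of any length; `hb` is needed
only for a run of polynomial length to exist. -/
theorem ex (hP : Checkable (k + 1) P) (b : Polynomial ℕ)
    (hb : ∀ s, Supp k s → (∃ y, P (Function.update s k y)) →
      ∃ y, y.length ≤ b.eval (size k s) ∧ P (Function.update s k y)) :
    Checkable k fun s => ∃ y, P (Function.update s k y) := by
  obtain ⟨p, q, h1, h2⟩ := hP
  refine ⟨guess k * (p * clear k), b + (q.comp (Polynomial.X + b) + (b + 1)),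
    fun s t n hs he => ?_, fun s hs h => ?_⟩
  · obtain ⟨u, hu, hu'⟩ := he.of_mul
    obtain ⟨v, hv, hv'⟩ := hu'.of_mul
    obtain ⟨y, rfl⟩ := hu.of_guess
    rw [hs k le_rfl, List.append_nil] at hv
    obtain ⟨rfl, hP⟩ := h1 _ _ _ (hs.update y) hv
    refine ⟨?_, y, hP⟩
    rw [hv'.of_clear, Function.update_idem, ← hs k le_rfl, Function.update_eq_self]
  · obtain ⟨y, hy, hP⟩ := hb s hs h
    have e1 := exec_guess k s y
    rw [hs k le_rfl, List.append_nil] at e1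
    have e2 := h2 _ (hs.update y) hP
    have e3 := exec_clear k (Function.update s k y)
    rw [Function.update_idem] at e3
    have hu : Function.update s k [] = s := by rw [← hs k le_rfl, Function.update_eq_self]
    rw [hu, Function.update_self] at e3
    refine (e1.mul (e2.mul e3)).mono ?_
    simp only [Polynomial.eval_add, Polynomial.eval_comp, Polynomial.eval_X, Polynomial.eval_one]
    rw [size_update]
    have := q.eval_nat_mono (Nat.add_le_add_left hy (size k s))
    lia

/-- `s j` is matched with a prefix of `s i`, and `s l` with the rest; that `j`, `i` and `l` are then
empty is the equation. Registers `k` and `k + 1` are scratch space, and testing that they are empty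
at the end forces the loops to restore everything. -/
theorem append {i j l : ℕ} (hij : i ≠ j) (hil : i ≠ l) (hjl : j ≠ l) (hi : i < k) (hj : j < k)
    (hl : l < k) : Checkable k fun s => s i = s j ++ s l := by
  refine ⟨matchLoop i j k * (.char (.empty j) * (matchLoop i l (k + 1) * (.char (.empty i) *
    (.char (.empty l) * (restoreLoop i l (k + 1) * (.char (.empty (k + 1)) *
      (restoreLoop i j k * .char (.empty k)))))))),
    -- Four loops, each of at most three actions per symbol of a register, and five tests for
    -- emptiness.
    Polynomial.C 12 * Polynomial.X + Polynomial.C 5, fun s t n hs he => ?_, fun s hs h => ?_⟩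
  · obtain ⟨u1, e1, he1⟩ := he.of_mul
    obtain ⟨_, e2, he2⟩ := he1.of_mul
    obtain ⟨e2, rfl⟩ := e2.of_act
    obtain ⟨u2, e3, he3⟩ := he2.of_mul
    obtain ⟨_, e4, he4⟩ := he3.of_mul
    obtain ⟨e4, rfl⟩ := e4.of_act
    obtain ⟨_, e5, he5⟩ := he4.of_mul
    obtain ⟨e5, rfl⟩ := e5.of_act
    obtain ⟨u3, e6, he6⟩ := he5.of_mul
    obtain ⟨_, e7, he7⟩ := he6.of_mul
    obtain ⟨e7, rfl⟩ := e7.of_act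
    obtain ⟨u4, e8, he8⟩ := he7.of_mul
    obtain ⟨e9, rfl⟩ := he8.of_act
    obtain ⟨y, a1, a2, a3, a4⟩ := e1.of_matchLoop hij (by lia) (by lia)
    obtain ⟨z, b1, b2, b3, b4⟩ := e3.of_matchLoop hil (by lia) (by lia)
    obtain ⟨z', c1, c2, c3, c4⟩ := e6.of_restoreLoop hil (by lia) (by lia)
    obtain ⟨y', d1, d2, d3, d4⟩ := e8.of_restoreLoop hij (by lia) (by lia)
    have f1 : s k = [] := hs _ le_rfl
    have f2 : s (k + 1) = [] := hs _ (by lia)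
    have g1 := a4 (k + 1) (by lia) (by lia) (by lia)
    have g2 := b4 k (by lia) (by lia) (by lia)
    have g3 := c4 k (by lia) (by lia) (by lia)
    have g4 := b4 j hij.symm hjl (by lia)
    have g5 := c4 j hij.symm hjl (by lia)
    have g6 := a4 l hil.symm hjl.symm (by lia)
    have g7 := d4 l hil.symm hjl.symm (by lia)
    have g8 := d4 (k + 1) (by lia) (by lia) (by lia)
    -- The scratch registers are empty before and after, so the restored words are those that were
    -- moved away.
    have hz : z' = z := by
      rw [b3, e7, g1, f2, List.append_nil, List.append_nil] at c3
      exact (List.reverse_injective c3).symm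
    have hy : y' = y := by
      rw [← g3, g2, a3, f1, e9, List.append_nil, List.append_nil] at d3
      exact (List.reverse_injective d3).symm
    subst hz hy
    have key : t = s := by
      funext m
      by_cases h1 : m = i
      · rw [h1, d1, c1, a1, b1]
      by_cases h2 : m = j
      · rw [h2, d2, a2, ← g5, g4]
      by_cases h3 : m = l
      · rw [h3, ← g7, c2, ← g6, b2]
      by_cases h4 : m = k
      · rw [h4, e9, f1]
      by_cases h5 : m = k + 1
      · rw [h5, ← g8, e7, f2]
      rw [← d4 m h1 h2 h4, ← c4 m h1 h3 h5, b4 m h1 h3 h5, a4 m h1 h2 h4]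
    refine ⟨key, ?_⟩
    change s i = s j ++ s l
    rw [a1, b1, a2, e2, ← g6, b2, e4, e5]
    simp
  · have f1 : s k = [] := hs _ le_rfl
    have f2 : s (k + 1) = [] := hs _ (by lia)
    have hki : k ≠ i := by lia
    have hkj : k ≠ j := by lia
    have hkl : k ≠ l := by lia
    have hki' : k + 1 ≠ i := by lia
    have hkj' : k + 1 ≠ j := by lia
    have hkl' : k + 1 ≠ l := by lia
    set u1 : Regs := Function.update (Function.update (Function.update s i (s l)) j []) k
      (s j).reverse with hu1
    set u2 : Regs := Function.update (Function.update (Function.update u1 i []) l []) (k + 1)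
      (s l).reverse with hu2
    have m1 : Moved i j k (s j) s u1 := by
      refine ⟨?_, ?_, ?_, fun m h1 h2 h3 => ?_⟩
      · simp [hu1, hki.symm, hij, h]
      · simp [hu1, hkj.symm]
      · simp [hu1, f1]
      · simp [hu1, h1, h2, h3]
    have m2 : Moved i l (k + 1) (s l) u1 u2 := by
      refine ⟨?_, ?_, ?_, fun m h1 h2 h3 => ?_⟩
      · simp [hu1, hu2, hki'.symm, hij, hil, hki.symm]
      · simp [hu1, hu2, hkl'.symm, hil.symm, hjl.symm, hkl.symm]
      · simp [hu2, hu1, f2, hki', hkj']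
      · simp [hu2, h1, h2, h3]
    have n1 : u1 j = [] := by simp [hu1, hkj.symm]
    have n2 : u2 i = [] := by simp [hu2, hki'.symm, hil]
    have n3 : u2 l = [] := by simp [hu2, hkl'.symm]
    have n4 : u1 (k + 1) = [] := by simp [hu1, hki', hkj', f2]
    have e := (exec_matchLoop hij hki.symm hkj.symm m1).mul
      ((Exec.act (a := .empty j) ⟨n1, rfl⟩).mul
        ((exec_matchLoop hil hki'.symm hkl'.symm m2).mul ((Exec.act (a := .empty i) ⟨n2, rfl⟩).mul
          ((Exec.act (a := .empty l) ⟨n3, rfl⟩).mul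
          ((exec_restoreLoop hil hki'.symm hkl'.symm m2).mul
            ((Exec.act (a := .empty (k + 1)) ⟨n4, rfl⟩).mul
              ((exec_restoreLoop hij hki.symm hkj.symm m1).mul
                (Exec.act (a := .empty k) ⟨f1, rfl⟩))))))))
    refine e.mono ?_
    have h1 := length_le_size hj s
    have h2 := length_le_size hl s
    simp only [Polynomial.eval_add, Polynomial.eval_mul, Polynomial.eval_C, Polynomial.eval_X]
    lia

theorem const {i : ℕ} (hi : i < k) (w : Str) : Checkable k fun s => s i = w := by
  induction w with
  | nil =>
    refine ⟨.char (.empty i), 1, fun s t n hs he => ?_, fun s hs h => ?_⟩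
    · exact ⟨he.of_act.2, he.of_act.1⟩
    · simpa using Exec.act (a := .empty i) ⟨h, rfl⟩
  | cons a w ih =>
    obtain ⟨p, q, h1, h2⟩ := ih
    have hupd : ∀ (s : Regs) (y : Str), Supp k s → Supp k (Function.update s i y) := by
      intro s y hs m hm
      rw [Function.update_of_ne (by lia)]
      exact hs m hm
    refine ⟨.char (.pop i a) * (p * .char (.push i a)), q + 2, fun s t n hs he => ?_,
      fun s hs h => ?_⟩
    · obtain ⟨u, e1, he⟩ := he.of_mul
      obtain ⟨v, e2, e3⟩ := he.of_mul
      obtain ⟨f1, f2⟩ := e1.of_act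
      obtain ⟨rfl, hw⟩ := h1 u v n (by rw [f2]; exact hupd _ _ hs) e2
      have f3 := e3.of_act
      refine ⟨?_, f1.trans (congrArg (a :: ·) hw)⟩
      have f4 : s i = a :: v i := f1
      rw [f3, ← f4, f2, Function.update_idem, Function.update_eq_self]
    · have e1 : Exec (.char (.pop i a)) 1 s (Function.update s i w) :=
        Exec.act ⟨by simp [h], by simp⟩
      have e2 := h2 (Function.update s i w) (hupd _ _ hs) (by simp)
      have e3 : Exec (.char (.push i a)) 1 (Function.update s i w) s :=
        Exec.act (by simp [Act.Rel, ← h])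
      refine (e1.mul (e2.mul e3)).mono ?_
      have : size k (Function.update s i w) ≤ size k s := by
        refine Finset.sum_le_sum fun m _ => ?_
        by_cases hm : m = i
        · subst hm; simp [h]
        · simp [hm]
      have := q.eval_nat_mono this
      simp only [Polynomial.eval_add, Polynomial.eval_ofNat]
      lia

/-- The case of `append` in which the third string is empty. It sits in a fresh register, whose
guessed contents have length `0`. -/
theorem eq {i j : ℕ} (hij : i ≠ j) (hi : i < k) (hj : j < k) :
    Checkable k fun s => s i = s j := by
  have h := (append (k := k + 1) hij (l := k) (by lia) (by lia) (by lia) (by lia) (by lia)).and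
    (const (k := k + 1) (i := k) (by lia) [])
  refine (h.ex 0 fun s _ => ?_).congr fun s _ => ?_
  · rintro ⟨y, h1, h2⟩
    have : y = [] := by simpa using h2
    exact ⟨y, by simp [this], h1, h2⟩
  · simp only [Function.update_self, Function.update_of_ne (show i ≠ k by lia),
      Function.update_of_ne (show j ≠ k by lia)]
    constructor
    · rintro ⟨y, h1, rfl⟩
      simpa using h1
    · intro h
      exact ⟨[], by simpa using h, rfl⟩

/-- Registers below `m` lie outside the range of the renaming, so the shifted program neither reads
nor alters them. -/
theorem shift (hP : Checkable k P) (m : ℕ) :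
    Checkable (m + k) fun s => P fun i => s (m + i) := by
  obtain ⟨p, q, h1, h2⟩ := hP
  have hinj : Function.Injective (fun i : ℕ => m + i) := fun a b h => by simpa using h
  have hsupp : ∀ s : Regs, Supp (m + k) s → Supp k (s ∘ fun i => m + i) :=
    fun s hs i hi => hs (m + i) (by lia)
  refine ⟨p.map (Act.map fun i => m + i), q, ?_, ?_⟩
  · rintro s t n hs ⟨w, hw, hn, hr⟩
    rw [RegularExpression.matches'_map] at hw
    obtain ⟨w, hw, rfl⟩ := hw
    obtain ⟨hr, hoff⟩ := (run_map hinj w s t).1 hr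
    obtain ⟨he, hP⟩ := h1 _ _ n (hsupp s hs) ⟨w, hw, by simpa using hn, hr⟩
    refine ⟨?_, hP⟩
    funext i
    by_cases hi : i ∈ Set.range (fun i : ℕ => m + i)
    · obtain ⟨j, rfl⟩ := hi
      exact congrFun he j
    · exact hoff i hi
  · intro s hs hP
    obtain ⟨w, hw, hn, hr⟩ := h2 _ (hsupp s hs) hP
    refine ⟨w.map (Act.map fun i => m + i), ?_, ?_, ?_⟩
    · rw [RegularExpression.matches'_map]
      exact ⟨w, hw, rfl⟩
    · rw [List.length_map]
      refine hn.trans (q.eval_nat_mono ?_)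
      rw [size, size, Finset.sum_range_add]
      exact Nat.le_add_left _ _
    · exact (run_map hinj w s s).2 ⟨hr, fun _ _ => rfl⟩

end Checkable

/-- A language checkable by a nondeterministic program in polynomial time. -/
def CheckableLang (L : Str → Prop) : Prop := Checkable 1 fun s => L (s 0)

/-- A checker for `L` reads register `0` and may use all the others as scratch space. It is
therefore run on the fresh register `k`, which receives a guessed copy of register `i`. -/
theorem CheckableLang.call {L : Str → Prop} (hL : CheckableLang L) {k i : ℕ} (hi : i < k) :
    Checkable k fun s => L (s i) := by
  have h := (Checkable.shift hL k).and
    (Checkable.eq (k := k + 1) (i := k) (j := i) (by lia) (by lia) (by lia))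
  refine (h.ex Polynomial.X fun s _ => ?_).congr fun s _ => ?_
  · rintro ⟨y, h1, h2⟩
    refine ⟨y, ?_, h1, h2⟩
    simp only [Function.update_self, Function.update_of_ne (show i ≠ k by lia)] at h2
    rw [Polynomial.eval_X, h2]
    exact length_le_size hi s
  · simp only [Nat.add_zero, Function.update_self, Function.update_of_ne (show i ≠ k by lia)]
    constructor
    · rintro ⟨y, h1, rfl⟩
      exact h1
    · intro h
      exact ⟨_, h, rfl⟩

end StackProg

/-! ### Iteration of checkable relations, and the passage to NP -/

namespace StackProg

open OBDM (Sym)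

section Iter

variable {S : Str → Str → Prop} {T : Str → Prop}

/-- Replace the contents `y` of register `1` by some `z` such that `pS` accepts the pair. -/
def replaceProg (pS pE : Prog) : Prog :=
  -- A move is imitated by guessing: register `1` is erased, guessed anew and compared with register
  -- `2` by `pE`.
  guess 2 * (pS * (clear 1 * (guess 1 * (pE * clear 2))))

theorem replaceProg_sound {pS pE : Prog}
    (hS : ∀ s t n, Supp 3 s → Exec pS n s t → t = s ∧ S (s 1) (s 2))
    (hE : ∀ s t n, Supp 3 s → Exec pE n s t → t = s ∧ s 1 = s 2) {s t : Regs} (hs : Supp 1 s)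
    {y : Str} {n : ℕ} (h : Exec (replaceProg pS pE) n (Function.update s 1 y) t) :
    ∃ z, S y z ∧ t = Function.update s 1 z := by
  have hs' := (hs.update y : Supp 2 _)
  obtain ⟨u1, e1, h1⟩ := h.of_mul
  obtain ⟨z, rfl⟩ := e1.of_guess
  obtain ⟨u2, e2, h2⟩ := h1.of_mul
  rw [hs' 2 le_rfl, List.append_nil] at e2
  obtain ⟨rfl, hyz⟩ := hS _ _ _ (hs'.update z) e2
  obtain ⟨u3, e3, h3⟩ := h2.of_mul
  obtain ⟨u4, e4, h4⟩ := h3.of_mul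
  obtain ⟨u5, e5, h5⟩ := h4.of_mul
  have f3 := e3.of_clear
  obtain ⟨z', f4⟩ := e4.of_guess
  have hu4 : u4 = Function.update (Function.update s 1 z') 2 z := by
    rw [f4, f3]
    funext m
    by_cases h1 : m = 1
    · subst h1; simp
    · by_cases h2 : m = 2
      · subst h2; simp
      · simp [h1, h2]
  have hs4 : Supp 3 u4 := by
    rw [hu4]
    exact Supp.update (k := 2) (hs.update z') z
  obtain ⟨rfl, hz⟩ := hE _ _ _ hs4 e5
  have hz' : z' = z := by
    rw [hu4] at hz
    simpa using hz
  subst hz'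
  refine ⟨z', by simpa using hyz, ?_⟩
  rw [h5.of_clear, hu4, Function.update_idem, Function.update_eq_self_iff]
  simp [hs 2 (by lia)]

theorem size_three_update {s : Regs} (y z : Str) :
    size 3 (Function.update (Function.update s 1 y) 2 z) = (s 0).length + y.length + z.length := by
  rw [size_update 2, size_update 1]
  simp [size]

theorem exec_replaceProg {pS pE : Prog} {qS qE : Polynomial ℕ}
    (hS : ∀ s, Supp 3 s → S (s 1) (s 2) → Exec pS (qS.eval (size 3 s)) s s)
    (hE : ∀ s, Supp 3 s → s 1 = s 2 → Exec pE (qE.eval (size 3 s)) s s) {s : Regs} (hs : Supp 1 s)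
    {y z : Str} (hyz : S y z) {N : ℕ} (hN : (s 0).length ≤ N) (hy : y.length ≤ N)
    (hz : z.length ≤ N) :
    Exec (replaceProg pS pE) (4 * N + 2 + qS.eval (3 * N) + qE.eval (3 * N))
      (Function.update s 1 y) (Function.update s 1 z) := by
  have e1 := exec_guess 2 (Function.update s 1 y) z
  have hs' := (hs.update y : Supp 2 _)
  rw [hs' 2 le_rfl, List.append_nil] at e1
  have e2 := hS _ (hs'.update z) (by simpa using hyz)
  have e3 := exec_clear 1 (Function.update (Function.update s 1 y) 2 z)
  have e4 := exec_guess 1 (Function.update (Function.update (Function.update s 1 y) 2 z) 1 []) z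
  have hu4 : Function.update (Function.update (Function.update (Function.update s 1 y) 2 z) 1 []) 1
      (z ++ Function.update (Function.update (Function.update s 1 y) 2 z) 1 [] 1) =
      Function.update (Function.update s 1 z) 2 z := by
    funext m
    by_cases h1 : m = 1
    · subst h1; simp
    · by_cases h2 : m = 2
      · subst h2; simp
      · simp [h1, h2]
  rw [hu4] at e4
  have e5 := hE _ (Supp.update (k := 2) (hs.update z) z) (by simp)
  have e6 := exec_clear 2 (Function.update (Function.update s 1 z) 2 z)
  have hu6 : Function.update (Function.update (Function.update s 1 z) 2 z) 2 [] =
      Function.update s 1 z := by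
    rw [Function.update_idem, Function.update_eq_self_iff]
    simp [hs 2 (by lia)]
  rw [hu6] at e6
  refine (e1.mul (e2.mul (e3.mul (e4.mul (e5.mul e6))))).mono ?_
  rw [size_three_update, size_three_update]
  have := qS.eval_nat_mono (show (s 0).length + y.length + z.length ≤ 3 * N by lia)
  have := qE.eval_nat_mono (show (s 0).length + z.length + z.length ≤ 3 * N by lia)
  simp only [Function.update_self, Function.update_of_ne (show (1 : ℕ) ≠ 2 by decide)]
  lia

/-- Checkable languages are closed under iterating a checkable length-decreasing relation. -/
theorem CheckableLang.iter (hS : Checkable 2 fun s => S (s 0) (s 1)) (hT : CheckableLang T)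
    (hlt : ∀ x y, S x y → y.length < x.length) :
    CheckableLang fun x => ∃ y, Relation.ReflTransGen S x y ∧ T y := by
  obtain ⟨pS, qS, hS1, hS2⟩ : Checkable 3 fun s => S (s 1) (s 2) := Checkable.shift hS 1
  obtain ⟨pE, qE, hE1, hE2⟩ :=
    Checkable.eq (k := 3) (i := 1) (j := 2) (by lia) (by lia) (by lia)
  obtain ⟨pI, qI, hI1, hI2⟩ :=
    Checkable.eq (k := 2) (i := 0) (j := 1) (by lia) (by lia) (by lia)
  obtain ⟨pT, qT, hT1, hT2⟩ := hT.call (k := 2) (i := 1) (by lia)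
  -- Register `0` keeps the argument; register `1` starts as a copy of it, enforced by `pI`, and
  -- runs through the iterates.
  refine ⟨guess 1 * (pI * ((replaceProg pS pE).star * (pT * clear 1))),
    Polynomial.X + (qI.comp (2 * Polynomial.X) + (Polynomial.X * (4 * Polynomial.X + 2 +
      qS.comp (3 * Polynomial.X) + qE.comp (3 * Polynomial.X)) +
      (qT.comp (2 * Polynomial.X) + (Polynomial.X + 1)))), fun s t n hs h => ?_, fun s hs h => ?_⟩
  · obtain ⟨u1, e1, h1⟩ := h.of_mul
    obtain ⟨x, rfl⟩ := e1.of_guess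
    rw [hs 1 le_rfl, List.append_nil] at h1
    obtain ⟨u2, e2, h2⟩ := h1.of_mul
    obtain ⟨rfl, hx⟩ := hI1 _ _ _ (hs.update x) e2
    obtain ⟨u3, e3, h3⟩ := h2.of_mul
    obtain ⟨u4, e4, h4⟩ := h3.of_mul
    have hstar : ∃ y, Relation.ReflTransGen S x y ∧ u3 = Function.update s 1 y := by
      have e3' := e3.of_star
      clear e3 e4 h3
      induction e3' with
      | refl => exact ⟨x, .refl, rfl⟩
      | tail _ hbc ih =>
        obtain ⟨y, hy, rfl⟩ := ih
        obtain ⟨z, hyz, rfl⟩ := replaceProg_sound hS1 hE1 hs hbc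
        exact ⟨z, hy.tail hyz, rfl⟩
    obtain ⟨y, hxy, rfl⟩ := hstar
    obtain ⟨rfl, hTy⟩ := hT1 _ _ _ (hs.update y) e4
    have hx' : s 0 = x := by simpa using hx
    refine ⟨?_, y, hx' ▸ hxy, by simpa using hTy⟩
    rw [h4.of_clear, Function.update_idem, Function.update_eq_self_iff]
    exact (hs 1 le_rfl).symm
  · obtain ⟨y, hxy, hTy⟩ := h
    set N := (s 0).length with hN
    have hsz : size 1 s = N := by simp [size, hN]
    have e1 := exec_guess 1 s (s 0)
    rw [hs 1 le_rfl, List.append_nil] at e1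
    have e2 := hI2 _ (hs.update (s 0)) (by simp)
    -- Each step shortens the string, so there are at most `x.length` steps and no string exceeds
    -- `N`.
    have hstar : ∀ x, x.length ≤ N → Relation.ReflTransGen S x y →
        y.length ≤ x.length ∧ Exec (replaceProg pS pE).star
          (x.length * (4 * N + 2 + qS.eval (3 * N) + qE.eval (3 * N)))
          (Function.update s 1 x) (Function.update s 1 y) := by
      intro x hx hxy
      induction hxy using Relation.ReflTransGen.head_induction_on with
      | refl => exact ⟨le_rfl, Exec.star_nil.mono (Nat.zero_le _)⟩
      | head hab _ ih =>
        have hlt' := hlt _ _ hab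
        obtain ⟨h1, h2⟩ := ih (by lia)
        refine ⟨by lia, (Exec.star_cons
          (exec_replaceProg hS2 hE2 hs hab (N := N) le_rfl hx (by lia)) h2).mono ?_⟩
        rw [Nat.add_comm, ← Nat.succ_mul]
        exact Nat.mul_le_mul_right _ hlt'
    obtain ⟨hlen, e3⟩ := hstar (s 0) le_rfl hxy
    have e4 := hT2 _ (hs.update y) (by simpa using hTy)
    have e5 := exec_clear 1 (Function.update s 1 y)
    have hu : Function.update (Function.update s 1 y) 1 [] = s := by
      rw [Function.update_idem, Function.update_eq_self_iff]
      exact (hs 1 le_rfl).symm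
    rw [hu] at e5
    refine (e1.mul (e2.mul (e3.mul (e4.mul e5)))).mono ?_
    rw [size_update 1, size_update 1, hsz]
    have := qT.eval_nat_mono (show N + y.length ≤ 2 * N by lia)
    simp only [Polynomial.eval_add, Polynomial.eval_mul, Polynomial.eval_comp, Polynomial.eval_X,
      Polynomial.eval_ofNat, Polynomial.eval_one, Function.update_self]
    rw [← Nat.two_mul]
    lia

end Iter

/-- Checkable languages are in NP. -/
theorem CheckableLang.inNP {L : Language Sym} (hL : CheckableLang fun x => x ∈ L) :
    Complexity.InNP L := by
  obtain ⟨p, q, h1, h2⟩ : Checkable 2 fun s => s 1 ∈ L := Checkable.shift hL 1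
  -- The machine delivers the input reversed on register `0`. The loop `mv` reverses it again onto
  -- register `1`, which is the first register of the shifted checker.
  set mv : Prog := (anySym fun a => .char (.pop 0 a) * .char (.push 1 a)).star with hmv
  have hsupp : ∀ x : Str, Supp 2 (Function.update (fun _ => []) 1 x) := by
    intro x i hi
    rw [Function.update_of_ne (by lia)]
  refine inNP_of_program L (mv * (.char (.empty 0) * p)) (2 * Polynomial.X + 1 + q) ?_ ?_
  · intro x w t hw hr
    have he : Exec (mv * (.char (.empty 0) * p)) w.length
      (Function.update (fun _ => []) 0 x.reverse) t := ⟨w, hw, le_rfl, hr⟩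
    obtain ⟨u1, e1, he1⟩ := he.of_mul
    obtain ⟨u2, e2, he2⟩ := he1.of_mul
    obtain ⟨e2, h12⟩ := e2.of_act
    subst h12
    -- This invariant of the transfer shows that register `1` holds `x` as soon as register `0` is
    -- empty.
    have hinv : ∀ s u : Regs, Relation.ReflTransGen (fun s t => Exec (anySym fun a =>
        .char (.pop 0 a) * .char (.push 1 a)) w.length s t) s u →
        (s 0).reverse ++ s 1 = (u 0).reverse ++ u 1 ∧ ∀ i, 2 ≤ i → u i = s i := by
      intro s u h
      induction h with
      | refl => exact ⟨rfl, fun _ _ => rfl⟩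
      | tail _ h ih =>
        obtain ⟨a, ha⟩ := exec_anySym.1 h
        obtain ⟨v, f1, f2⟩ := ha.of_mul
        obtain ⟨g1, g2⟩ := f1.of_act
        have g3 := f2.of_act
        refine ⟨?_, fun i hi => ?_⟩
        · rw [ih.1, g3, g1, g2]
          simp
        · rw [g3, Function.update_of_ne (by lia), g2, Function.update_of_ne (by lia), ih.2 i hi]
    obtain ⟨k1, k2⟩ := hinv _ _ e1.of_star
    rw [e2] at k1
    have hu : Supp 2 u2 := fun i hi => (k2 i hi).trans (by rw [Function.update_of_ne (by lia)])
    have := (h1 _ _ _ hu he2).2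
    have hx : x = u2 1 := by simpa using k1
    rwa [hx]
  · intro x hx
    have hstar : ∀ (y z : Str), Exec mv (2 * y.length)
        (Function.update (Function.update (fun _ => []) 1 z) 0 y)
        (Function.update (fun _ => []) 1 (y.reverse ++ z)) := by
      intro y
      induction y with
      | nil =>
        intro z
        rw [Function.update_eq_self_iff.2 (by simp)]
        exact Exec.star_nil
      | cons a y ih =>
        intro z
        have e : Exec (anySym fun a => .char (.pop 0 a) * .char (.push 1 a)) (1 + 1)
            (Function.update (Function.update (fun _ => []) 1 z) 0 (a :: y))
            (Function.update (Function.update (fun _ => []) 1 (a :: z)) 0 y) := by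
          refine exec_anySym.2 ⟨a, Exec.mul
            (u := Function.update (Function.update (fun _ => []) 1 z) 0 y)
            (Exec.act ⟨by simp, by simp⟩) (Exec.act ?_)⟩
          funext m
          by_cases h1 : m = 1
          · subst h1; simp
          · by_cases h2 : m = 0
            · subst h2; simp
            · simp [h1, h2]
        have := (Exec.star_cons e (ih (a :: z))).mono (n := 2 * (a :: y).length)
          (by simp only [List.length_cons]; lia)
        simpa using this
    have e1 := hstar x.reverse []
    have hu : Function.update (fun _ => []) 1 [] = (fun _ => [] : Regs) :=
      Function.update_eq_self 1 (fun _ => [] : Regs)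
    rw [List.reverse_reverse, List.append_nil, hu] at e1
    have e2 : Exec (.char (.empty 0)) 1 (Function.update (fun _ => []) 1 x : Regs) _ :=
      Exec.act ⟨by simp, rfl⟩
    have e3 := h2 (Function.update (fun _ => []) 1 x) (hsupp x) (by simpa using hx)
    obtain ⟨w, hw, hn, hr⟩ := e1.mul (e2.mul e3)
    refine ⟨w, hw, hn.trans ?_, _, hr⟩
    have hsz : size 2 (Function.update (fun _ => []) 1 x) = x.length := by
      rw [size_update 1]; simp [size]
    rw [hsz]
    simp only [Polynomial.eval_add, Polynomial.eval_mul, Polynomial.eval_X, Polynomial.eval_ofNat,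
      Polynomial.eval_one, List.length_reverse]
    lia

end StackProg

/-! ### Predicates and functions on types coded by strings -/

namespace StackProg

open OBDM (Sym PrefixCode)

/-! ### Operations on checkable languages -/

section Lang

variable {K L U V : Str → Prop}

theorem Checkable.exLe {k : ℕ} {P : Regs → Prop} (hP : Checkable (k + 1) P)
    (hb : ∀ s, Supp k s → ∀ y, P (Function.update s k y) → y.length ≤ size k s) :
    Checkable k fun s => ∃ y, P (Function.update s k y) :=
  hP.ex Polynomial.X fun s hs ⟨y, hy⟩ => ⟨y, by simpa using hb s hs y hy, hy⟩

theorem CheckableLang.congr (hK : CheckableLang K) (h : ∀ x, K x ↔ L x) : CheckableLang L :=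
  Checkable.congr hK fun _ _ => h _

theorem CheckableLang.and (hK : CheckableLang K) (hL : CheckableLang L) :
    CheckableLang fun x => K x ∧ L x :=
  Checkable.and hK hL

theorem CheckableLang.or (hK : CheckableLang K) (hL : CheckableLang L) :
    CheckableLang fun x => K x ∨ L x :=
  Checkable.or hK hL

theorem CheckableLang.concat (hK : CheckableLang K) (hL : CheckableLang L) :
    CheckableLang fun x => ∃ y z, x = y ++ z ∧ K y ∧ L z := by
  have h := (Checkable.append (k := 3) (i := 0) (j := 1) (l := 2) (by lia) (by lia) (by lia)
    (by lia) (by lia) (by lia)).and ((hK.call (k := 3) (i := 1) (by lia)).and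
      (hL.call (k := 3) (i := 2) (by lia)))
  refine (Checkable.exLe (Checkable.exLe h fun s hs y hy => ?_) fun s hs y hy => ?_).congr
    fun s hs => ?_
  · have h1 := congrArg List.length hy.1
    simp at h1
    simp [size, Finset.sum_range_succ]
    lia
  · obtain ⟨z, h1, -⟩ := hy
    have h1 := congrArg List.length h1
    simp at h1
    simp [size]
    lia
  · simp

/-- The string `x` is an object and `y` its certificate. In the application `K` consists of code
words, which makes the splitting of `x ++ y` unambiguous. -/
theorem CheckableLang.exists_append (hK : CheckableLang K) (hL : CheckableLang L)
    (b : Polynomial ℕ)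
    (hb : ∀ x, K x → (∃ y, L (x ++ y)) → ∃ y, y.length ≤ b.eval x.length ∧ L (x ++ y)) :
    CheckableLang fun x => K x ∧ ∃ y, L (x ++ y) := by
  have h := (Checkable.append (k := 3) (i := 2) (j := 0) (l := 1) (by lia) (by lia) (by lia)
    (by lia) (by lia) (by lia)).and (hL.call (k := 3) (i := 2) (by lia))
  have h' : Checkable 2 fun s => L (s 0 ++ s 1) := by
    refine (Checkable.exLe h fun s hs y hy => ?_).congr fun s hs => by simp
    have h1 := congrArg List.length hy.1
    simp at h1
    simp [size, Finset.sum_range_succ]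
    lia
  refine (Checkable.ex ((hK.call (k := 2) (i := 0) (by lia)).and h') b fun s hs hy => ?_).congr
    fun s hs => by simp
  obtain ⟨y, hy⟩ := hy
  simp only [Function.update_self, Function.update_of_ne (show (0 : ℕ) ≠ 1 by decide)] at hy
  obtain ⟨z, hz, hz'⟩ := hb (s 0) hy.1 ⟨y, hy.2⟩
  exact ⟨z, by simpa [size] using hz, by simpa using ⟨hy.1, hz'⟩⟩

/-- The words `u ++ w ++ u`, for a fixed `w`. -/
theorem CheckableLang.repeat_const (hK : CheckableLang K) (w : Str) :
    CheckableLang fun x => ∃ u, x = u ++ (w ++ u) ∧ K u := by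
  have h := ((Checkable.append (k := 4) (i := 0) (j := 1) (l := 2) (by lia) (by lia) (by lia)
    (by lia) (by lia) (by lia)).and (Checkable.append (k := 4) (i := 2) (j := 3) (l := 1) (by lia)
    (by lia) (by lia) (by lia) (by lia) (by lia))).and ((hK.call (k := 4) (i := 1) (by lia)).and
    (Checkable.const (k := 4) (i := 3) (by lia) w))
  refine (Checkable.exLe (Checkable.exLe (Checkable.exLe h fun s hs y hy => ?_)
    fun s hs y hy => ?_) fun s hs y hy => ?_).congr fun s hs => ?_
  · obtain ⟨⟨h1, h2⟩, -⟩ := hy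
    have h1 := congrArg List.length h1
    have h2 := congrArg List.length h2
    simp at h1 h2
    simp [size, Finset.sum_range_succ]
    lia
  · obtain ⟨t, ⟨h1, h2⟩, -⟩ := hy
    have h1 := congrArg List.length h1
    simp at h1
    simp [size, Finset.sum_range_succ]
    lia
  · obtain ⟨v, t, ⟨h1, h2⟩, -⟩ := hy
    have h1 := congrArg List.length h1
    simp at h1
    simp [size]
    lia
  · simp only [Function.update_self, ne_eq, not_false_eq_true,
      Function.update_of_ne, Nat.reduceEqDiff, zero_ne_one]
    constructor
    · rintro ⟨u, v, t, ⟨h1, h2⟩, h3, rfl⟩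
      exact ⟨u, by rw [h1, h2], h3⟩
    · rintro ⟨u, h1, h2⟩
      exact ⟨u, w ++ u, w, ⟨h1, rfl⟩, h2, rfl⟩

/-- Serves to drop the middle component of a triple, for predicates that do not depend on it. -/
theorem CheckableLang.skip (hU : CheckableLang U) (hV : CheckableLang V) (hL : CheckableLang L) :
    CheckableLang fun x => ∃ u v w, x = u ++ (v ++ w) ∧ U u ∧ V v ∧ L (u ++ w) := by
  have h := ((Checkable.append (k := 6) (i := 0) (j := 1) (l := 4) (by lia) (by lia) (by lia)
    (by lia) (by lia) (by lia)).and (Checkable.append (k := 6) (i := 4) (j := 2) (l := 3) (by lia)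
    (by lia) (by lia) (by lia) (by lia) (by lia))).and ((Checkable.append (k := 6) (i := 5) (j := 1)
    (l := 3) (by lia) (by lia) (by lia) (by lia) (by lia) (by lia)).and
    ((hU.call (k := 6) (i := 1) (by lia)).and ((hV.call (k := 6) (i := 2) (by lia)).and
    (hL.call (k := 6) (i := 5) (by lia)))))
  refine (Checkable.exLe (Checkable.exLe (Checkable.exLe (Checkable.exLe (Checkable.exLe h
    fun s hs y hy => ?_) fun s hs y hy => ?_) fun s hs y hy => ?_) fun s hs y hy => ?_)
    fun s hs y hy => ?_).congr fun s hs => ?_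
  · obtain ⟨⟨h1, h2⟩, h3, -⟩ := hy
    have h3 := congrArg List.length h3
    simp at h3
    simp [size, Finset.sum_range_succ]
    lia
  · obtain ⟨a, ⟨h1, h2⟩, -⟩ := hy
    have h1 := congrArg List.length h1
    simp at h1
    simp [size, Finset.sum_range_succ]
    lia
  · obtain ⟨a, b, ⟨h1, h2⟩, -⟩ := hy
    have h1 := congrArg List.length h1
    have h2 := congrArg List.length h2
    simp at h1 h2
    simp [size, Finset.sum_range_succ]
    lia
  · obtain ⟨a, b, c, ⟨h1, h2⟩, -⟩ := hy
    have h1 := congrArg List.length h1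
    have h2 := congrArg List.length h2
    simp at h1 h2
    simp [size, Finset.sum_range_succ]
    lia
  · obtain ⟨a, b, c, d, ⟨h1, h2⟩, -⟩ := hy
    have h1 := congrArg List.length h1
    simp at h1
    simp [size]
    lia
  · simp only [Function.update_self, ne_eq, not_false_eq_true,
      Function.update_of_ne, Nat.reduceEqDiff, zero_ne_one]
    constructor
    · rintro ⟨u, v, w, t, z, ⟨h1, h2⟩, h3, h4, h5, h6⟩
      exact ⟨u, v, w, by rw [h1, h2], h4, h5, h3 ▸ h6⟩
    · rintro ⟨u, v, w, h1, h2, h3, h4⟩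
      exact ⟨u, v, w, v ++ w, u ++ w, ⟨h1, rfl⟩, rfl, h2, h3, h4⟩

end Lang

/-! ### Types of objects coded by strings -/

/-- A type whose elements are coded by strings in such a way that a code word can be recognized,
and its end found. -/
class Code (α : Type) where
  enc : α → Str
  prefixCode : PrefixCode enc
  valid : CheckableLang fun x => ∃ a, enc a = x

open Code (enc)

variable {α β γ δ : Type} [Code α] [Code β] [Code γ] [Code δ]

/-- The length of the code word. -/
def len (a : α) : ℕ := (enc a).length

theorem enc_injective : Function.Injective (enc : α → Str) := fun a b h =>
  (Code.prefixCode a b [] [] (by rw [h])).1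

/-- A predicate whose truth is witnessed by certificates of polynomial length. -/
def NPPred (P : α → Prop) : Prop := CheckableLang fun x => ∃ a, enc a = x ∧ P a

instance : Code (α × β) where
  enc p := enc p.1 ++ enc p.2
  prefixCode := Code.prefixCode.pair Code.prefixCode
  valid := (Code.valid.concat Code.valid).congr fun x => by
    constructor
    · rintro ⟨_, _, rfl, ⟨a, rfl⟩, ⟨b, rfl⟩⟩
      exact ⟨(a, b), rfl⟩
    · rintro ⟨⟨a, b⟩, rfl⟩
      exact ⟨_, _, rfl, ⟨a, rfl⟩, ⟨b, rfl⟩⟩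

theorem enc_pair (p : α × β) : enc p = enc p.1 ++ enc p.2 := rfl

theorem len_pair (p : α × β) : len p = len p.1 + len p.2 := List.length_append

namespace NPPred

variable {P Q : α → Prop}

theorem congr (hP : NPPred P) (h : ∀ a, P a ↔ Q a) : NPPred Q :=
  CheckableLang.congr hP fun x => by simp only [h]

theorem and (hP : NPPred P) (hQ : NPPred Q) : NPPred fun a => P a ∧ Q a :=
  CheckableLang.congr (CheckableLang.and hP hQ) fun x => by
    constructor
    · rintro ⟨⟨a, rfl, hP⟩, ⟨b, hb, hQ⟩⟩
      obtain rfl := enc_injective hb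
      exact ⟨_, rfl, hP, hQ⟩
    · rintro ⟨a, rfl, hP, hQ⟩
      exact ⟨⟨a, rfl, hP⟩, ⟨a, rfl, hQ⟩⟩

theorem or (hP : NPPred P) (hQ : NPPred Q) : NPPred fun a => P a ∨ Q a :=
  CheckableLang.congr (CheckableLang.or hP hQ) fun x => by
    constructor
    · rintro (⟨a, rfl, hP⟩ | ⟨a, rfl, hQ⟩)
      exacts [⟨_, rfl, Or.inl hP⟩, ⟨_, rfl, Or.inr hQ⟩]
    · rintro ⟨a, rfl, hP | hQ⟩
      exacts [Or.inl ⟨a, rfl, hP⟩, Or.inr ⟨a, rfl, hQ⟩]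

theorem fst (hP : NPPred P) : NPPred fun x : α × β => P x.1 :=
  CheckableLang.congr (CheckableLang.concat hP (Code.valid (α := β))) fun x => by
    constructor
    · rintro ⟨_, _, rfl, ⟨a, rfl, h⟩, ⟨b, rfl⟩⟩
      exact ⟨(a, b), rfl, h⟩
    · rintro ⟨⟨a, b⟩, rfl, h⟩
      exact ⟨_, _, rfl, ⟨a, rfl, h⟩, ⟨b, rfl⟩⟩

theorem snd {P : β → Prop} (hP : NPPred P) : NPPred fun x : α × β => P x.2 :=
  CheckableLang.congr (CheckableLang.concat (Code.valid (α := α)) hP) fun x => by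
    constructor
    · rintro ⟨_, _, rfl, ⟨a, rfl⟩, ⟨b, rfl, h⟩⟩
      exact ⟨(a, b), rfl, h⟩
    · rintro ⟨⟨a, b⟩, rfl, h⟩
      exact ⟨_, _, rfl, ⟨a, rfl⟩, ⟨b, rfl, h⟩⟩

/-- Since the code is prefix-free, the strings that extend `enc a` to the code of a pair with first
component `a` are exactly the codes of second components. In `hb` the short witness may differ from
the given one; this freedom is what pruning exploits. -/
theorem ex {R : α → β → Prop} (hR : NPPred fun x : α × β => R x.1 x.2) (b : Polynomial ℕ)
    (hb : ∀ a, (∃ y, R a y) → ∃ y, len y ≤ b.eval (len a) ∧ R a y) :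
    NPPred fun a => ∃ y, R a y := by
  have key : ∀ (a : α) (y : Str), (∃ z : α × β, enc z = enc a ++ y ∧ R z.1 z.2) ↔
      ∃ z, enc z = y ∧ R a z := by
    intro a y
    constructor
    · rintro ⟨⟨a', z⟩, h1, h2⟩
      obtain ⟨rfl, rfl⟩ := Code.prefixCode _ _ _ _ h1
      exact ⟨z, rfl, h2⟩
    · rintro ⟨z, rfl, h⟩
      exact ⟨(a, z), rfl, h⟩
  refine (CheckableLang.exists_append (Code.valid (α := α)) hR b ?_).congr fun x => ?_
  · rintro _ ⟨a, rfl⟩ ⟨y, hy⟩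
    obtain ⟨z, -, hz⟩ := (key a y).1 hy
    obtain ⟨z, hz1, hz2⟩ := hb a ⟨z, hz⟩
    exact ⟨enc z, hz1, (key a _).2 ⟨z, rfl, hz2⟩⟩
  · constructor
    · rintro ⟨⟨a, rfl⟩, y, hy⟩
      obtain ⟨z, -, hz⟩ := (key a y).1 hy
      exact ⟨a, rfl, z, hz⟩
    · rintro ⟨a, rfl, z, hz⟩
      exact ⟨⟨a, rfl⟩, enc z, (key a _).2 ⟨z, rfl, hz⟩⟩

theorem exLe {R : α → β → Prop} (hR : NPPred fun x : α × β => R x.1 x.2)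
    (hb : ∀ a y, R a y → len y ≤ len a) : NPPred fun a => ∃ y, R a y :=
  hR.ex Polynomial.X fun a ⟨y, hy⟩ => ⟨y, by simpa using hb a y hy, hy⟩

theorem eq_const (c : α) : NPPred fun a => a = c :=
  CheckableLang.congr (K := fun x => x = enc c)
    (Checkable.const (k := 1) (i := 0) (by lia) (enc c)) fun x => by
      constructor
      · rintro rfl
        exact ⟨c, rfl, rfl⟩
      · rintro ⟨_, rfl, rfl⟩
        rfl

end NPPred

/-- A function with output of polynomial length whose graph is in NP. -/
@[fun_prop]
def NPFun (f : α → β) : Prop :=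
  (∃ b : Polynomial ℕ, ∀ a, len (f a) ≤ b.eval (len a)) ∧ NPPred fun x : α × β => x.2 = f x.1

namespace NPFun

/-- A function that prefixes a fixed word to the code. -/
theorem of_enc {f : α → β} (w : Str) (hf : ∀ a, enc (f a) = w ++ enc a) : NPFun f := by
  refine ⟨⟨Polynomial.C w.length + Polynomial.X, fun a => ?_⟩, ?_⟩
  · simp [len, hf]
  · refine (CheckableLang.repeat_const (Code.valid (α := α)) w).congr fun x => ?_
    constructor
    · rintro ⟨_, rfl, a, rfl⟩
      exact ⟨(a, f a), by rw [enc_pair, hf], rfl⟩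
    · rintro ⟨⟨a, b⟩, rfl, h⟩
      obtain rfl : b = f a := h
      exact ⟨enc a, by rw [enc_pair, hf], a, rfl⟩

theorem of_graph_skip {f : α → γ} (hf : NPFun f) : NPFun fun x : α × β => f x.1 := by
  obtain ⟨⟨b, hb⟩, hg⟩ := hf
  refine ⟨⟨b, fun x => (hb x.1).trans (b.eval_nat_mono ?_)⟩, ?_⟩
  · rw [len_pair]; lia
  · refine (CheckableLang.skip (Code.valid (α := α)) (Code.valid (α := β)) hg).congr fun x => ?_
    constructor
    · rintro ⟨_, _, w, rfl, ⟨a, rfl⟩, ⟨b, rfl⟩, ⟨a', c⟩, h1, h2⟩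
      obtain ⟨rfl, rfl⟩ := Code.prefixCode _ _ _ _ h1
      exact ⟨((a', b), c), by simp [enc_pair], h2⟩
    · rintro ⟨⟨⟨a, b⟩, c⟩, rfl, h⟩
      exact ⟨enc a, enc b, enc c, by simp [enc_pair], ⟨a, rfl⟩, ⟨b, rfl⟩, (a, c), rfl, h⟩

@[fun_prop]
theorem id : NPFun fun a : α => a := of_enc [] fun _ => rfl

@[fun_prop]
theorem const (c : β) : NPFun fun _ : α => c :=
  ⟨⟨Polynomial.C (len c), fun a => by simp⟩, (NPPred.eq_const c).snd⟩

theorem fst : NPFun fun x : α × β => x.1 := of_graph_skip id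

theorem snd : NPFun fun x : α × β => x.2 := by
  refine ⟨⟨Polynomial.X, fun x => by rw [len_pair, Polynomial.eval_X]; lia⟩, ?_⟩
  refine CheckableLang.congr (NPPred.snd (α := α) (id (α := β)).2) fun x => ?_
  constructor
  · rintro ⟨⟨a, b, c⟩, rfl, h⟩
    exact ⟨((a, b), c), by simp [enc_pair], h⟩
  · rintro ⟨⟨⟨a, b⟩, c⟩, rfl, h⟩
    exact ⟨(a, b, c), by simp [enc_pair], h⟩

@[fun_prop]
theorem prodMk {f : α → β} {g : α → γ} (hf : NPFun f) (hg : NPFun g) :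
    NPFun fun a => (f a, g a) := by
  obtain ⟨⟨b, hb⟩, hf⟩ := hf
  obtain ⟨⟨c, hc⟩, hg⟩ := hg
  refine ⟨⟨b + c, fun a => ?_⟩, ?_⟩
  · rw [len_pair, Polynomial.eval_add]
    exact Nat.add_le_add (hb a) (hc a)
  · have h1 : NPPred fun x : α × β × γ => x.2.1 = f x.1 := by
      refine CheckableLang.congr (NPPred.fst (β := γ) hf) fun x => ?_
      constructor
      · rintro ⟨⟨⟨a, b⟩, c⟩, rfl, h⟩
        exact ⟨(a, b, c), by simp [enc_pair], h⟩
      · rintro ⟨⟨a, b, c⟩, rfl, h⟩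
        exact ⟨((a, b), c), by simp [enc_pair], h⟩
    have h2 : NPPred fun x : α × β × γ => x.2.2 = g x.1 := by
      refine (CheckableLang.skip (Code.valid (α := α)) (Code.valid (α := β)) hg).congr fun x => ?_
      constructor
      · rintro ⟨_, _, w, rfl, ⟨a, rfl⟩, ⟨b, rfl⟩, ⟨a', c⟩, h1, h2⟩
        obtain ⟨rfl, rfl⟩ := Code.prefixCode _ _ _ _ h1
        exact ⟨(a', b, c), rfl, h2⟩
      · rintro ⟨⟨a, b, c⟩, rfl, h⟩
        exact ⟨enc a, enc b, enc c, rfl, ⟨a, rfl⟩, ⟨b, rfl⟩, (a, c), rfl, h⟩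
    exact (h1.and h2).congr fun x => (Prod.ext_iff (x := x.2) (y := (f x.1, g x.1))).symm

end NPFun

/-- The value `f a` is not computed but guessed, and verified by means of the graph of `f`. -/
theorem NPPred.comp {P : β → Prop} (hP : NPPred P) {f : α → β} (hf : NPFun f) :
    NPPred fun a => P (f a) := by
  obtain ⟨⟨b, hb⟩, hf⟩ := hf
  refine ((hf.and hP.snd).ex (R := fun a y => y = f a ∧ P y) b ?_).congr fun a => ?_
  · rintro a ⟨y, rfl, h⟩
    exact ⟨f a, hb a, rfl, h⟩
  · simp

namespace NPFun

@[fun_prop]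
theorem comp {g : β → γ} {f : α → β} (hg : NPFun g) (hf : NPFun f) :
    NPFun fun a => g (f a) := by
  refine ⟨?_, hg.2.comp (hf.of_graph_skip.prodMk snd)⟩
  obtain ⟨⟨b, hb⟩, -⟩ := hf
  obtain ⟨⟨c, hc⟩, -⟩ := hg
  refine ⟨c.comp b, fun a => ?_⟩
  rw [Polynomial.eval_comp]
  exact (hc _).trans (c.eval_nat_mono (hb a))

@[fun_prop]
theorem fst' {f : α → β × γ} (hf : NPFun f) : NPFun fun a => (f a).1 := fst.comp hf

@[fun_prop]
theorem snd' {f : α → β × γ} (hf : NPFun f) : NPFun fun a => (f a).2 := snd.comp hf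

end NPFun

theorem NPPred.eq {f g : α → β} (hf : NPFun f := by fun_prop) (hg : NPFun g := by fun_prop) :
    NPPred fun a => f a = g a :=
  (NPFun.id (α := β)).2.comp (hg.prodMk hf)

/-- Iteration of a relation that decreases the length of the code. -/
theorem NPPred.iter {S : α → α → Prop} {T : α → Prop}
    (hS : NPPred fun x : α × α => S x.1 x.2) (hT : NPPred T)
    (hlt : ∀ a b, S a b → len b < len a) :
    NPPred fun a => ∃ b, Relation.ReflTransGen S a b ∧ T b := by
  -- `hS` concerns the joint code of a pair, which is assembled in register `2`; that register `0`
  -- is a code word fixes the place where the joint code splits.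
  have h2 : Checkable 2 fun s => ∃ a b : α, enc a = s 0 ∧ enc b = s 1 ∧ S a b := by
    have h := (Checkable.append (k := 3) (i := 2) (j := 0) (l := 1) (by lia) (by lia) (by lia)
      (by lia) (by lia) (by lia)).and ((CheckableLang.call hS (k := 3) (i := 2) (by lia)).and
      ((Code.valid (α := α)).call (k := 3) (i := 0) (by lia)))
    refine (Checkable.exLe h fun s hs y hy => ?_).congr fun s hs => ?_
    · have h1 := congrArg List.length hy.1
      simp at h1
      simp [size, Finset.sum_range_succ]
      lia
    · simp only [Function.update_self, ne_eq, OfNat.zero_ne_ofNat, not_false_eq_true,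
        Function.update_of_ne, OfNat.one_ne_ofNat]
      constructor
      · rintro ⟨_, h1, ⟨⟨a, b⟩, rfl, h2⟩, a', h3⟩
        rw [← h3] at h1
        obtain ⟨rfl, h4⟩ := Code.prefixCode _ _ _ _ h1
        exact ⟨a, b, h3, h4, h2⟩
      · rintro ⟨a, b, h1, h2, h3⟩
        exact ⟨enc a ++ enc b, by rw [h1, h2], ⟨(a, b), rfl, h3⟩, a, h1⟩
  refine ((Code.valid (α := α)).and (CheckableLang.iter
    (S := fun x y => ∃ a b : α, enc a = x ∧ enc b = y ∧ S a b) h2 hT ?_)).congr fun x => ?_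
  · rintro _ _ ⟨a, b, rfl, rfl, h⟩
    exact hlt a b h
  · constructor
    · rintro ⟨⟨a, rfl⟩, y, h1, b, rfl, h2⟩
      refine ⟨a, rfl, b, ?_, h2⟩
      clear h2
      generalize hz : enc b = z at h1
      induction h1 generalizing b with
      | refl => rw [enc_injective hz]
      | tail _ h ih =>
        obtain ⟨c, d, rfl, h', h''⟩ := h
        rw [← hz] at h'
        obtain rfl := enc_injective h'
        exact (ih c rfl).tail h''
    · rintro ⟨a, rfl, b, h1, h2⟩
      refine ⟨⟨a, rfl⟩, enc b, ?_, b, rfl, h2⟩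
      clear h2
      induction h1 with
      | refl => exact .refl
      | tail _ h ih => exact ih.tail ⟨_, _, rfl, rfl, h⟩

/-! ### Lists, bit strings and numbers -/

theorem CheckableLang.const (w : Str) : CheckableLang fun x => x = w :=
  Checkable.const (k := 1) (i := 0) (by lia) w

/-- A single parsing step. Iterating it recognizes the codes of lists, bit strings and unary
numbers. -/
theorem Checkable.prefix_step (w : Str) {K : Str → Prop} (hK : CheckableLang K) :
    Checkable 2 fun s => ∃ y, s 0 = w ++ (y ++ s 1) ∧ K y := by
  have h := ((Checkable.append (k := 5) (i := 0) (j := 2) (l := 3) (by lia) (by lia) (by lia)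
    (by lia) (by lia) (by lia)).and (Checkable.append (k := 5) (i := 3) (j := 4) (l := 1) (by lia)
    (by lia) (by lia) (by lia) (by lia) (by lia))).and ((Checkable.const (k := 5) (i := 2)
    (by lia) w).and (hK.call (k := 5) (i := 4) (by lia)))
  refine (Checkable.exLe (Checkable.exLe (Checkable.exLe h
    fun s hs y hy => ?_) fun s hs y hy => ?_) fun s hs y hy => ?_).congr fun s hs => ?_
  · obtain ⟨⟨h1, h2⟩, -⟩ := hy
    have h2 := congrArg List.length h2
    simp at h2
    simp [size, Finset.sum_range_succ]
    lia
  · obtain ⟨a, ⟨h1, h2⟩, -⟩ := hy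
    have h1 := congrArg List.length h1
    simp at h1
    simp [size, Finset.sum_range_succ]
    lia
  · obtain ⟨a, b, ⟨h1, h2⟩, -⟩ := hy
    have h1 := congrArg List.length h1
    simp at h1
    simp [size, Finset.sum_range_succ]
    lia
  · simp only [Function.update_self, ne_eq, OfNat.zero_ne_ofNat, not_false_eq_true,
      Function.update_of_ne, Nat.reduceEqDiff, OfNat.one_ne_ofNat]
    constructor
    · rintro ⟨a, b, c, ⟨h1, h2⟩, rfl, h4⟩
      exact ⟨c, by rw [h1, h2], h4⟩
    · rintro ⟨c, h1, h2⟩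
      exact ⟨w, c ++ s 1, c, ⟨h1, rfl⟩, rfl, h2⟩

/-- The words of `K`, each preceded by `w`, the last followed by `close`. -/
theorem CheckableLang.sequence (w : Str) {K : Str → Prop} (hK : CheckableLang K)
    (hlt : ∀ y, K y → 0 < (w ++ y).length) :
    CheckableLang fun x => ∃ z,
      Relation.ReflTransGen (fun x z => ∃ y, x = w ++ (y ++ z) ∧ K y) x z ∧ z = [Sym.close] := by
  refine CheckableLang.iter (Checkable.prefix_step w hK) (CheckableLang.const [.close]) ?_
  rintro x z ⟨y, rfl, hy⟩
  have := hlt y hy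
  simp only [List.length_append] at this ⊢
  lia

instance : Code (List α) where
  enc := OBDM.encList enc
  prefixCode := Code.prefixCode.list
  valid := by
    refine (CheckableLang.sequence [.item] (Code.valid (α := α)) ?_).congr fun x => ?_
    · simp
    · constructor
      · rintro ⟨y, h, rfl⟩
        induction h using Relation.ReflTransGen.head_induction_on with
        | refl => exact ⟨[], rfl⟩
        | head h _ ih =>
          obtain ⟨_, rfl, a, rfl⟩ := h
          obtain ⟨l, rfl⟩ := ih
          exact ⟨a :: l, by simp [OBDM.encList]⟩
      · rintro ⟨l, rfl⟩
        refine ⟨_, ?_, rfl⟩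
        induction l with
        | nil => exact .refl
        | cons a l ih => exact .head ⟨enc a, by simp [OBDM.encList], a, rfl⟩ ih

instance : Code (List Bool) where
  enc := OBDM.encBits
  prefixCode := OBDM.prefixCode_bits
  valid := by
    refine (CheckableLang.sequence [] ((CheckableLang.const [.bit false]).or
      (CheckableLang.const [.bit true])) ?_).congr fun x => ?_
    · rintro _ (rfl | rfl) <;> simp
    · constructor
      · rintro ⟨y, h, rfl⟩
        induction h using Relation.ReflTransGen.head_induction_on with
        | refl => exact ⟨[], rfl⟩
        | head h _ ih =>
          obtain ⟨l, rfl⟩ := ih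
          obtain ⟨_, rfl, rfl | rfl⟩ := h
          exacts [⟨.false :: l, rfl⟩, ⟨.true :: l, rfl⟩]
      · rintro ⟨l, rfl⟩
        refine ⟨_, ?_, rfl⟩
        induction l with
        | nil => exact .refl
        | cons b l ih =>
          refine .head ⟨[.bit b], rfl, ?_⟩ ih
          cases b
          exacts [Or.inl rfl, Or.inr rfl]

instance : Code ℕ where
  enc := OBDM.encNat
  prefixCode := OBDM.prefixCode_nat
  valid := by
    refine (CheckableLang.sequence [] (CheckableLang.const [.item]) ?_).congr fun x => ?_
    · rintro _ rfl
      simp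
    · constructor
      · rintro ⟨y, h, rfl⟩
        induction h using Relation.ReflTransGen.head_induction_on with
        | refl => exact ⟨0, rfl⟩
        | head h _ ih =>
          obtain ⟨n, rfl⟩ := ih
          obtain ⟨_, rfl, rfl⟩ := h
          exact ⟨n + 1, rfl⟩
      · rintro ⟨n, rfl⟩
        refine ⟨_, ?_, rfl⟩
        induction n with
        | zero => exact .refl
        | succ n ih => exact .head ⟨[.item], rfl, rfl⟩ ih

end StackProg

/-! ### Quantification over lists, lengths, and inequality of strings -/

namespace StackProg

open OBDM (Sym PrefixCode)
open Code (enc)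

variable {α β γ δ : Type} [Code α] [Code β] [Code γ] [Code δ]

/-! ### Rules for lists -/

theorem len_nil : len ([] : List α) = 1 := rfl

theorem len_cons (a : α) (l : List α) : len (a :: l) = len a + len l + 1 := by
  simp [len, enc, OBDM.encList]

theorem len_le_of_mem {a : α} {l : List α} (h : a ∈ l) : len a ≤ len l := by
  induction l with
  | nil => simp at h
  | cons b l ih =>
    rw [len_cons]
    rcases List.mem_cons.1 h with rfl | h
    · lia
    · have := ih h
      lia

theorem length_lt_len (l : List α) : l.length < len l := by
  induction l with
  | nil => simp [len_nil]
  | cons a l ih => rw [len_cons, List.length_cons]; lia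

@[fun_prop]
theorem NPFun.cons {f : α → β} {g : α → List β} (hf : NPFun f) (hg : NPFun g) :
    NPFun fun a => f a :: g a :=
  (NPFun.of_enc (f := fun x : β × List β => x.1 :: x.2) [.item] fun _ => rfl).comp (hf.prodMk hg)

/-- The list is consumed from the front, with the parameter `a` carried along; each element is
certified in its turn. A universal quantifier over a list thus costs only as many certificates as
the list has elements. -/
theorem NPPred.allMem {l : α → List β} (hl : NPFun l) {R : α → β → Prop}
    (hR : NPPred fun x : α × β => R x.1 x.2) : NPPred fun a => ∀ b ∈ l a, R a b := by
  have hS : NPPred fun x : (α × List β) × (α × List β) =>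
      ∃ b, x.1.1 = x.2.1 ∧ x.1.2 = b :: x.2.2 ∧ R x.1.1 b := by
    refine NPPred.exLe ((NPPred.eq (by fun_prop) (by fun_prop)).and
      ((NPPred.eq (by fun_prop) (by fun_prop)).and
      (hR.comp (f := fun y : ((α × List β) × (α × List β)) × β => (y.1.1.1, y.2))
        (by fun_prop)))) ?_
    rintro ⟨⟨a, l⟩, a', l'⟩ b ⟨-, h, -⟩
    obtain rfl : l = b :: l' := h
    simp only [len_pair, len_cons]
    lia
  have hT : NPPred fun x : α × List β => x.2 = [] := NPPred.eq (by fun_prop) (by fun_prop)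
  have h := NPPred.iter (S := fun x y : α × List β => ∃ b, x.1 = y.1 ∧ x.2 = b :: y.2 ∧ R x.1 b)
    hS hT ?_
  · refine (h.comp (f := fun a => (a, l a)) (by fun_prop)).congr fun a => ?_
    generalize l a = l
    constructor
    · rintro ⟨b, h1, h2⟩
      have key : ∀ x : α × List β, Relation.ReflTransGen (fun x y : α × List β =>
          ∃ b, x.1 = y.1 ∧ x.2 = b :: y.2 ∧ R x.1 b) x b → ∀ c ∈ x.2, R x.1 c := by
        intro x h
        induction h using Relation.ReflTransGen.head_induction_on with
        | refl => simp [h2]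
        | head h _ ih =>
          obtain ⟨d, e1, e2, e3⟩ := h
          rw [e2]
          intro c hc
          rcases List.mem_cons.1 hc with rfl | hc
          · exact e3
          · rw [e1]; exact ih c hc
      exact key _ h1
    · intro h
      refine ⟨(a, []), ?_, rfl⟩
      induction l with
      | nil => exact .refl
      | cons b l ih =>
        exact .head (b := (a, l)) ⟨b, rfl, rfl, h b List.mem_cons_self⟩
          (ih fun c hc => h c (List.mem_cons_of_mem _ hc))
  · rintro ⟨a, l⟩ ⟨a', l'⟩ ⟨b, h1, h2, -⟩
    obtain rfl : a = a' := h1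
    obtain rfl : l = b :: l' := h2
    simp only [len_pair, len_cons]
    lia

theorem NPPred.mem {l : α → List β} {f : α → β} (hf : NPFun f := by fun_prop)
    (hl : NPFun l := by fun_prop) :
    NPPred fun a => f a ∈ l a := by
  have hS : NPPred fun x : (β × List β) × (β × List β) =>
      ∃ b, x.1.1 = x.2.1 ∧ x.1.2 = b :: x.2.2 := by
    refine NPPred.exLe ((NPPred.eq (by fun_prop) (by fun_prop)).and
      (NPPred.eq (by fun_prop) (by fun_prop))) ?_
    rintro ⟨⟨a, l⟩, a', l'⟩ b ⟨-, h⟩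
    obtain rfl : l = b :: l' := h
    simp only [len_pair, len_cons]
    lia
  have hT : NPPred fun x : β × List β => ∃ l', x.2 = x.1 :: l' := by
    refine NPPred.exLe (NPPred.eq (by fun_prop) (by fun_prop)) ?_
    rintro ⟨a, l⟩ l' h
    obtain rfl : l = a :: l' := h
    simp only [len_pair, len_cons]
    lia
  have h := NPPred.iter (S := fun x y : β × List β => ∃ b, x.1 = y.1 ∧ x.2 = b :: y.2)
    hS hT ?_
  · refine (h.comp (f := fun a => (f a, l a)) (by fun_prop)).congr fun a => ?_
    generalize l a = l
    generalize f a = c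
    constructor
    · rintro ⟨b, h1, l', h2⟩
      have key : ∀ x : β × List β, Relation.ReflTransGen (fun x y : β × List β =>
          ∃ b, x.1 = y.1 ∧ x.2 = b :: y.2) x b → x.1 ∈ x.2 := by
        intro x h
        induction h using Relation.ReflTransGen.head_induction_on with
        | refl => simp [h2]
        | head h _ ih =>
          obtain ⟨d, e1, e2⟩ := h
          rw [e1, e2]
          exact List.mem_cons_of_mem _ ih
      exact key _ h1
    · intro h
      induction l with
      | nil => simp at h
      | cons b l ih =>
        rcases List.mem_cons.1 h with rfl | h
        · exact ⟨_, .refl, l, rfl⟩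
        · obtain ⟨d, h1, h2⟩ := ih h
          exact ⟨d, .head (b := (c, l)) ⟨b, rfl, rfl⟩ h1, h2⟩
  · rintro ⟨a, l⟩ ⟨a', l'⟩ ⟨b, h1, h2⟩
    obtain rfl : a = a' := h1
    obtain rfl : l = b :: l' := h2
    simp only [len_pair, len_cons]
    lia

theorem NPFun.len_le {f : α → β} (hf : NPFun f) :
    ∃ b : Polynomial ℕ, ∀ a, len (f a) ≤ b.eval (len a) := hf.1

theorem NPPred.exMem {l : α → List β} (hl : NPFun l) {R : α → β → Prop}
    (hR : NPPred fun x : α × β => R x.1 x.2) : NPPred fun a => ∃ b ∈ l a, R a b := by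
  obtain ⟨p, hp⟩ := hl.len_le
  refine NPPred.ex (R := fun a b => b ∈ l a ∧ R a b)
    ((NPPred.mem (by fun_prop) (by fun_prop)).and hR) p ?_
  rintro a ⟨b, h1, h2⟩
  exact ⟨b, (len_le_of_mem h1).trans (hp a), h1, h2⟩

/-- The relation `R`, with parameters, holds between the corresponding elements of two lists. -/
theorem NPPred.forall₂ {l : α → List β} {l' : α → List γ} (hl : NPFun l) (hl' : NPFun l')
    {R : α → β → γ → Prop} (hR : NPPred fun x : α × β × γ => R x.1 x.2.1 x.2.2) :
    NPPred fun a => List.Forall₂ (R a) (l a) (l' a) := by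
  have hS : NPPred fun x : (α × List β × List γ) × (α × List β × List γ) =>
      ∃ b : β × γ, x.1.1 = x.2.1 ∧ x.1.2.1 = b.1 :: x.2.2.1 ∧ x.1.2.2 = b.2 :: x.2.2.2 ∧
        R x.1.1 b.1 b.2 := by
    refine NPPred.exLe ((NPPred.eq (by fun_prop) (by fun_prop)).and
      ((NPPred.eq (by fun_prop) (by fun_prop)).and ((NPPred.eq (by fun_prop) (by fun_prop)).and
      (hR.comp (f := fun y : ((α × List β × List γ) × (α × List β × List γ)) × β × γ =>
        (y.1.1.1, y.2)) (by fun_prop))))) ?_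
    rintro ⟨⟨a, l, m⟩, a', l', m'⟩ ⟨b, c⟩ ⟨-, h1, h2, -⟩
    obtain rfl : l = b :: l' := h1
    obtain rfl : m = c :: m' := h2
    simp only [len_pair, len_cons]
    lia
  have hT : NPPred fun x : α × List β × List γ => x.2.1 = [] ∧ x.2.2 = [] :=
    (NPPred.eq (by fun_prop) (by fun_prop)).and (NPPred.eq (by fun_prop) (by fun_prop))
  have h := NPPred.iter (S := fun x y : α × List β × List γ => ∃ b : β × γ, x.1 = y.1 ∧
    x.2.1 = b.1 :: y.2.1 ∧ x.2.2 = b.2 :: y.2.2 ∧ R x.1 b.1 b.2) hS hT ?_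
  · refine (h.comp (f := fun a => (a, l a, l' a)) (by fun_prop)).congr fun a => ?_
    generalize l a = l
    generalize l' a = l'
    constructor
    · rintro ⟨b, h1, h2, h3⟩
      have key : ∀ x : α × List β × List γ, Relation.ReflTransGen (fun x y : α × List β × List γ =>
          ∃ b : β × γ, x.1 = y.1 ∧ x.2.1 = b.1 :: y.2.1 ∧ x.2.2 = b.2 :: y.2.2 ∧ R x.1 b.1 b.2)
          x b → List.Forall₂ (R x.1) x.2.1 x.2.2 := by
        intro x h
        induction h using Relation.ReflTransGen.head_induction_on with
        | refl => rw [h2, h3]; exact .nil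
        | head h _ ih =>
          obtain ⟨d, e1, e2, e3, e4⟩ := h
          rw [e2, e3]
          exact .cons e4 (e1 ▸ ih)
      exact key _ h1
    · intro h
      refine ⟨(a, [], []), ?_, rfl, rfl⟩
      induction h with
      | nil => exact .refl
      | @cons b c l l' h _ ih => exact .head (b := (a, l, l')) ⟨(b, c), rfl, rfl, rfl, h⟩ ih
  · rintro ⟨a, l, m⟩ ⟨a', l', m'⟩ ⟨⟨b, c⟩, h1, h2, h3, -⟩
    obtain rfl : a = a' := h1
    obtain rfl : l = b :: l' := h2
    obtain rfl : m = c :: m' := h3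
    simp only [len_pair, len_cons]
    lia

@[fun_prop]
theorem NPFun.succ {f : α → ℕ} (hf : NPFun f) : NPFun fun a => f a + 1 :=
  (NPFun.of_enc (f := fun n : ℕ => n + 1) [.item] fun _ => rfl).comp hf

theorem len_nat (n : ℕ) : len n = n + 1 := by simp [len, enc, OBDM.encNat]

theorem NPPred.length_eq {l : α → List β} {n : α → ℕ} (hl : NPFun l := by fun_prop)
    (hn : NPFun n := by fun_prop) :
    NPPred fun a => (l a).length = n a := by
  have hS : NPPred fun x : (List β × ℕ) × (List β × ℕ) =>
      ∃ b, x.1.1 = b :: x.2.1 ∧ x.1.2 = x.2.2 + 1 := by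
    refine NPPred.exLe ((NPPred.eq (by fun_prop) (by fun_prop)).and
      (NPPred.eq (by fun_prop) (by fun_prop))) ?_
    rintro ⟨⟨l, n⟩, l', n'⟩ b ⟨h, -⟩
    obtain rfl : l = b :: l' := h
    simp only [len_pair, len_cons]
    lia
  have hT : NPPred fun x : List β × ℕ => x.1 = [] ∧ x.2 = 0 :=
    (NPPred.eq (by fun_prop) (by fun_prop)).and (NPPred.eq (by fun_prop) (by fun_prop))
  have h := NPPred.iter (S := fun x y : List β × ℕ => ∃ b, x.1 = b :: y.1 ∧ x.2 = y.2 + 1)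
    hS hT ?_
  · refine (h.comp (f := fun a => (l a, n a)) (by fun_prop)).congr fun a => ?_
    generalize l a = l
    generalize n a = n
    constructor
    · rintro ⟨b, h1, h2, h3⟩
      have key : ∀ x : List β × ℕ, Relation.ReflTransGen (fun x y : List β × ℕ =>
          ∃ b, x.1 = b :: y.1 ∧ x.2 = y.2 + 1) x b → x.1.length = x.2 := by
        intro x h
        induction h using Relation.ReflTransGen.head_induction_on with
        | refl => simp [h2, h3]
        | head h _ ih =>
          obtain ⟨d, e1, e2⟩ := h
          rw [e1, e2, List.length_cons, ih]
      exact key _ h1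
    · rintro rfl
      refine ⟨([], 0), ?_, rfl, rfl⟩
      induction l with
      | nil => exact .refl
      | cons b l ih => exact .head ⟨b, rfl, rfl⟩ ih
  · rintro ⟨l, n⟩ ⟨l', n'⟩ ⟨b, h1, h2⟩
    obtain rfl : l = b :: l' := h1
    obtain rfl : n = n' + 1 := h2
    simp only [len_pair, len_cons]
    have : len (n' + 1) = len n' + 1 := by simp [len_nat]
    lia

theorem NPPred.exBool {R : α → Bool → Prop} (hR : ∀ b, NPPred fun a => R a b) :
    NPPred fun a => ∃ b, R a b :=
  ((hR .false).or (hR .true)).congr fun a => by simp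

theorem NPFun.bits_cons (b : Bool) {f : α → List Bool} (hf : NPFun f) : NPFun fun a => b :: f a :=
  (NPFun.of_enc (f := fun l : List Bool => b :: l) [.bit b] fun _ => rfl).comp hf

theorem len_bits_cons (b : Bool) (l : List Bool) : len (b :: l) = len l + 1 := by
  simp [len, enc, OBDM.encBits]

/-- Being in NP is not inherited by a negation, so inequality is certified directly: after a common
prefix, exactly one string has ended or the next bits differ. -/
theorem NPPred.bits_ne {f g : α → List Bool} (hf : NPFun f := by fun_prop)
    (hg : NPFun g := by fun_prop) :
    NPPred fun a => f a ≠ g a := by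
  have hS : NPPred fun x : (List Bool × List Bool) × (List Bool × List Bool) =>
      ∃ b : Bool, x.1.1 = b :: x.2.1 ∧ x.1.2 = b :: x.2.2 :=
    NPPred.exBool fun b => (NPPred.eq (by fun_prop) (NPFun.bits_cons b (by fun_prop))).and
      (NPPred.eq (by fun_prop) (NPFun.bits_cons b (by fun_prop)))
  have hhd : ∀ b : Bool, NPPred fun x : List Bool => ∃ l, x = b :: l := by
    intro b
    refine NPPred.exLe (NPPred.eq (by fun_prop) (NPFun.bits_cons b (by fun_prop))) ?_
    rintro _ l rfl
    rw [len_bits_cons]; lia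
  have hT : NPPred fun x : List Bool × List Bool =>
      (x.1 = [] ∧ ∃ b : Bool, ∃ l, x.2 = b :: l) ∨ (x.2 = [] ∧ ∃ b : Bool, ∃ l, x.1 = b :: l) ∨
        ∃ b : Bool, (∃ l, x.1 = b :: l) ∧ ∃ l, x.2 = (!b) :: l :=
    ((NPPred.eq (by fun_prop) (by fun_prop)).and (NPPred.exBool fun b => (hhd b).snd)).or
      (((NPPred.eq (by fun_prop) (by fun_prop)).and (NPPred.exBool fun b => (hhd b).fst)).or
        (NPPred.exBool fun b => (hhd b).fst.and (hhd !b).snd))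
  have h := NPPred.iter (S := fun x y : List Bool × List Bool =>
    ∃ b : Bool, x.1 = b :: y.1 ∧ x.2 = b :: y.2) hS hT ?_
  · refine (h.comp (f := fun a => (f a, g a)) (by fun_prop)).congr fun a => ?_
    generalize f a = l
    generalize g a = m
    constructor
    · rintro ⟨z, h1, h2⟩
      have key : ∀ x : List Bool × List Bool, Relation.ReflTransGen
          (fun x y : List Bool × List Bool => ∃ b : Bool, x.1 = b :: y.1 ∧ x.2 = b :: y.2) x z →
          x.1 ≠ x.2 := by
        intro x h
        induction h using Relation.ReflTransGen.head_induction_on with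
        | refl =>
          obtain ⟨x, y⟩ := z
          rcases h2 with ⟨e1, b, l, e2⟩ | ⟨e1, b, l, e2⟩ | ⟨b, ⟨l, e1⟩, l', e2⟩ <;>
            simp only at e1 e2 <;> simp [e1, e2]
        | head h _ ih =>
          obtain ⟨d, e1, e2⟩ := h
          rw [e1, e2]
          exact fun h => ih (List.cons.inj h).2
      exact key _ h1
    · intro h
      induction l generalizing m with
      | nil =>
        cases m with
        | nil => exact absurd rfl h
        | cons b m => exact ⟨_, .refl, Or.inl ⟨rfl, b, m, rfl⟩⟩
      | cons a l ih =>
        cases m with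
        | nil => exact ⟨_, .refl, Or.inr (Or.inl ⟨rfl, a, l, rfl⟩)⟩
        | cons b m =>
          by_cases hab : b = a
          · subst hab
            obtain ⟨z, h1, h2⟩ := ih m (fun e => h (by rw [e]))
            exact ⟨z, .head ⟨b, rfl, rfl⟩ h1, h2⟩
          · refine ⟨_, .refl, Or.inr (Or.inr ⟨a, ⟨l, rfl⟩, m, ?_⟩)⟩
            cases a <;> cases b <;> simp_all
  · rintro ⟨l, m⟩ ⟨l', m'⟩ ⟨b, h1, h2⟩
    obtain rfl : l = b :: l' := h1
    obtain rfl : m = b :: m' := h2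
    simp only [len_pair, len_bits_cons]
    lia

end StackProg

/-! ### Reachability in polynomial graphs, and codes for the inputs -/

namespace StackProg

open OBDM (Sym PrefixCode)
open Code (enc)

variable {α β γ δ : Type} [Code α] [Code β] [Code γ] [Code δ]

/-! ### Reachability -/

/-- The list `l` leads from `b` to `c` in steps of `r`. -/
def ChainTo {β : Type} (r : β → β → Prop) : β → List β → β → Prop
  | b, [], c => b = c
  | b, d :: l, c => r b d ∧ ChainTo r d l c

theorem ChainTo.reflTransGen {β : Type} {r : β → β → Prop} {b c : β} {l : List β}
    (h : ChainTo r b l c) : Relation.ReflTransGen r b c := by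
  induction l generalizing b with
  | nil => obtain rfl : b = c := h; exact .refl
  | cons d l ih => exact .head h.1 (ih h.2)

theorem ChainTo.exists_suffix {β : Type} {r : β → β → Prop} {b c d : β} {l : List β}
    (h : ChainTo r d l c) (hb : b ∈ d :: l) :
    ∃ l', ChainTo r b l' c ∧ (b :: l').Sublist (d :: l) := by
  induction l generalizing d with
  | nil =>
    obtain rfl : b = d := by simpa using hb
    exact ⟨[], h, .refl _⟩
  | cons e l ih =>
    rcases List.mem_cons.1 hb with rfl | hb
    · exact ⟨_, h, .refl _⟩
    · obtain ⟨l', h1, h2⟩ := ih h.2 hb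
      exact ⟨l', h1, h2.cons _⟩

/-- When a new first node already occurs in the path, the path is replaced by its part from that
occurrence on. -/
theorem exists_chainTo_nodup {β : Type} {r : β → β → Prop} {b c : β}
    (h : Relation.ReflTransGen r b c) : ∃ l, ChainTo r b l c ∧ (b :: l).Nodup := by
  classical
  induction h using Relation.ReflTransGen.head_induction_on with
  | refl => exact ⟨[], rfl, by simp⟩
  | @head b d h _ ih =>
    obtain ⟨l, h1, h2⟩ := ih
    by_cases hb : b ∈ d :: l
    · obtain ⟨l', h3, h4⟩ := h1.exists_suffix hb
      exact ⟨l', h3, h2.sublist h4⟩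
    · exact ⟨d :: l, ⟨h, h1⟩, List.nodup_cons.2 ⟨hb, h2⟩⟩

theorem ChainTo.subset {β : Type} {r : β → β → Prop} {b c : β} {l nodes : List β}
    (h : ChainTo r b l c) (hr : ∀ b c, r b c → c ∈ nodes) : l ⊆ nodes := by
  induction l generalizing b with
  | nil => simp
  | cons d l ih => exact List.cons_subset.2 ⟨hr _ _ h.1, ih h.2⟩

theorem len_eq_sum (l : List α) : len l = (l.map fun a => len a + 1).sum + 1 := by
  induction l with
  | nil => rfl
  | cons a l ih => rw [len_cons, ih, List.map_cons, List.sum_cons]; lia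

/-- The code length is a sum over the elements, and up to order a list without repetition is a
sublist of any list that contains its elements. -/
theorem len_le_of_nodup_subset {l m : List α} (hl : l.Nodup) (h : l ⊆ m) : len l ≤ len m := by
  obtain ⟨l', h1, h2⟩ := hl.subperm h
  rw [len_eq_sum, len_eq_sum, ← (h1.map _).sum_eq]
  exact Nat.add_le_add_right ((h2.map _).sum_le_sum fun _ _ => Nat.zero_le _) 1

theorem NPPred.chainTo {r : α → β → β → Prop}
    (hr : NPPred fun x : α × β × β => r x.1 x.2.1 x.2.2) :
    NPPred fun x : (α × β × β) × List β => ChainTo (r x.1.1) x.1.2.1 x.2 x.1.2.2 := by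
  have hS : NPPred fun x : ((α × β) × β × List β) × ((α × β) × β × List β) =>
      x.1.1 = x.2.1 ∧ x.1.2.2 = x.2.2.1 :: x.2.2.2 ∧ r x.1.1.1 x.1.2.1 x.2.2.1 :=
    (NPPred.eq (by fun_prop) (by fun_prop)).and ((NPPred.eq (by fun_prop) (by fun_prop)).and
      (hr.comp (f := fun x : ((α × β) × β × List β) × ((α × β) × β × List β) =>
        (x.1.1.1, x.1.2.1, x.2.2.1)) (by fun_prop)))
  have hT : NPPred fun x : (α × β) × β × List β => x.2.1 = x.1.2 ∧ x.2.2 = [] :=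
    (NPPred.eq (by fun_prop) (by fun_prop)).and (NPPred.eq (by fun_prop) (by fun_prop))
  have h := NPPred.iter (S := fun x y : (α × β) × β × List β =>
    x.1 = y.1 ∧ x.2.2 = y.2.1 :: y.2.2 ∧ r x.1.1 x.2.1 y.2.1) hS hT ?_
  · refine (h.comp (f := fun x : (α × β × β) × List β => ((x.1.1, x.1.2.2), x.1.2.1, x.2))
      (by fun_prop)).congr ?_
    rintro ⟨⟨a, b, c⟩, l⟩
    constructor
    · rintro ⟨z, h1, h2, h3⟩
      have key : ∀ x : (α × β) × β × List β, Relation.ReflTransGen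
          (fun x y : (α × β) × β × List β =>
            x.1 = y.1 ∧ x.2.2 = y.2.1 :: y.2.2 ∧ r x.1.1 x.2.1 y.2.1) x z →
          ChainTo (r x.1.1) x.2.1 x.2.2 x.1.2 := by
        intro x h
        induction h using Relation.ReflTransGen.head_induction_on with
        | refl => rw [h3]; exact h2
        | head h _ ih =>
          obtain ⟨e1, e2, e3⟩ := h
          rw [e2]
          refine ⟨e3, ?_⟩
          rw [e1]
          exact ih
      exact key _ h1
    · intro h
      change ChainTo (r a) b l c at h
      refine ⟨((a, c), c, []), ?_, rfl, rfl⟩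
      change Relation.ReflTransGen _ ((a, c), b, l) _
      induction l generalizing b with
      | nil => obtain rfl : b = c := h; exact .refl
      | cons d l ih => exact .head (b := ((a, c), d, l)) ⟨rfl, rfl, h.1⟩ (ih d h.2)
  · rintro ⟨⟨a, b⟩, c, l⟩ ⟨⟨a', b'⟩, c', l'⟩ ⟨h1, h2, -⟩
    obtain ⟨rfl, rfl⟩ : a = a' ∧ b = b' := by simpa using h1
    obtain rfl : l = c' :: l' := h2
    simp only [len_pair, len_cons]
    have : 0 ≤ len c := Nat.zero_le _
    lia

/-- Reachability in a graph whose edges end in nodes from a list of polynomial length. -/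
theorem NPPred.reflTransGen {r : α → β → β → Prop}
    (hr : NPPred fun x : α × β × β => r x.1 x.2.1 x.2.2) (nodes : α → List β) (p : Polynomial ℕ)
    (hp : ∀ a, len (nodes a) ≤ p.eval (len a)) (hnodes : ∀ a b c, r a b c → c ∈ nodes a) :
    NPPred fun x : α × β × β => Relation.ReflTransGen (r x.1) x.2.1 x.2.2 := by
  refine ((NPPred.chainTo hr).ex (R := fun (x : α × β × β) l => ChainTo (r x.1) x.2.1 l x.2.2) p
    ?_).congr fun x => ?_
  · rintro ⟨a, b, c⟩ ⟨l, hl⟩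
    -- A repetition-free path is short because all its nodes after the first belong to `nodes a`.
    obtain ⟨l', h1, h2⟩ := exists_chainTo_nodup hl.reflTransGen
    refine ⟨l', ?_, h1⟩
    refine (len_le_of_nodup_subset (List.nodup_cons.1 h2).2 (h1.subset (hnodes a))).trans
      ((hp a).trans (p.eval_nat_mono ?_))
    rw [len_pair]
    exact Nat.le_add_right _ _
  · constructor
    · rintro ⟨l, hl⟩
      exact hl.reflTransGen
    · intro h
      obtain ⟨l, hl, -⟩ := exists_chainTo_nodup h
      exact ⟨l, hl⟩

/-! ### Codes of the objects of an OBDM system -/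

open OBDM

theorem CheckableLang.prefixed (w : Str) (β : Type) [Code β] :
    CheckableLang fun x => ∃ b : β, w ++ enc b = x := by
  refine ((CheckableLang.const w).concat (Code.valid (α := β))).congr fun x => ?_
  constructor
  · rintro ⟨_, _, rfl, rfl, b, rfl⟩
    exact ⟨b, rfl⟩
  · rintro ⟨b, rfl⟩
    exact ⟨_, _, rfl, rfl, b, rfl⟩

/-- A coded type transported along a bijection. -/
abbrev Code.ofEquiv {α : Type} (f : α ≃ β) (e : α → Str) (he : ∀ a, e a = enc (f a)) : Code α where
  enc := e
  prefixCode := by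
    have : e = fun a => enc (f a) := funext he
    rw [this]
    exact Code.prefixCode.comp f f.injective
  valid := (Code.valid (α := β)).congr fun x => by
    constructor
    · rintro ⟨b, rfl⟩
      exact ⟨f.symm b, by rw [he, f.apply_symm_apply]⟩
    · rintro ⟨a, rfl⟩
      exact ⟨f a, (he a).symm⟩

instance : Code AtomicConcept where
  enc := encAtomicConcept
  prefixCode := prefixCode_atomicConcept
  valid := ((CheckableLang.const (encAtomicConcept .top)).or
    ((CheckableLang.const (encAtomicConcept .bot)).or
      (CheckableLang.prefixed [.bit true] PredSym))).congr fun x => by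
    constructor
    · rintro (rfl | rfl | ⟨A, rfl⟩)
      exacts [⟨_, rfl⟩, ⟨_, rfl⟩, ⟨.named A, rfl⟩]
    · rintro ⟨_ | _ | A, rfl⟩
      exacts [Or.inl rfl, Or.inr (Or.inl rfl), Or.inr (Or.inr ⟨A, rfl⟩)]

instance : Code Role where
  enc := encRole
  prefixCode := prefixCode_role
  valid := ((CheckableLang.prefixed [.bit false] PredSym).or
      (CheckableLang.prefixed [.bit true] PredSym)).congr fun x => by
    constructor
    · rintro (⟨A, rfl⟩ | ⟨A, rfl⟩)
      exacts [⟨.atomic A, rfl⟩, ⟨.inv A, rfl⟩]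
    · rintro ⟨A | A, rfl⟩
      exacts [Or.inl ⟨A, rfl⟩, Or.inr ⟨A, rfl⟩]

instance : Code Concept where
  enc := encConcept
  prefixCode := prefixCode_concept
  valid := ((CheckableLang.prefixed [.bit false] AtomicConcept).or
      (CheckableLang.prefixed [.bit true] Role)).congr fun x => by
    constructor
    · rintro (⟨A, rfl⟩ | ⟨A, rfl⟩)
      exacts [⟨.atomic A, rfl⟩, ⟨.ex A, rfl⟩]
    · rintro ⟨A | A, rfl⟩
      exacts [Or.inl ⟨A, rfl⟩, Or.inr ⟨A, rfl⟩]

instance : Code Assertion where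
  enc := encAssertion
  prefixCode := prefixCode_assertion
  valid := (((CheckableLang.prefixed [.bit false, .bit false] (Concept × Concept)).or
      (CheckableLang.prefixed [.bit false, .bit true] (Role × Role))).or
      ((CheckableLang.prefixed [.bit true, .bit false] (Concept × Concept)).or
      (CheckableLang.prefixed [.bit true, .bit true] (Role × Role)))).congr fun x => by
    constructor
    · rintro ((⟨A, rfl⟩ | ⟨A, rfl⟩) | (⟨A, rfl⟩ | ⟨A, rfl⟩))
      exacts [⟨.conceptIncl A.1 A.2, rfl⟩, ⟨.roleIncl A.1 A.2, rfl⟩, ⟨.conceptDisj A.1 A.2, rfl⟩,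
        ⟨.roleDisj A.1 A.2, rfl⟩]
    · rintro ⟨⟨A, B⟩ | ⟨A, B⟩ | ⟨A, B⟩ | ⟨A, B⟩, rfl⟩
      exacts [Or.inl (Or.inl ⟨(A, B), rfl⟩), Or.inl (Or.inr ⟨(A, B), rfl⟩),
        Or.inr (Or.inl ⟨(A, B), rfl⟩), Or.inr (Or.inr ⟨(A, B), rfl⟩)]

instance : Code OntAtom where
  enc := encOntAtom
  prefixCode := prefixCode_ontAtom
  valid := ((CheckableLang.prefixed [.bit false] (AtomicConcept × Var)).or
      (CheckableLang.prefixed [.bit true] (PredSym × Var × Var))).congr fun x => by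
    constructor
    · rintro (⟨A, rfl⟩ | ⟨A, rfl⟩)
      exacts [⟨.concept A.1 A.2, rfl⟩, ⟨.role A.1 A.2.1 A.2.2, rfl⟩]
    · rintro ⟨⟨A, x⟩ | ⟨P, x, y⟩, rfl⟩
      exacts [Or.inl ⟨(A, x), rfl⟩, Or.inr ⟨(P, x, y), rfl⟩]

def relAtomEquiv : RelAtom (List Bool) ≃ PredSym × List (List Bool) where
  toFun a := (a.pred, a.args)
  invFun p := ⟨p.1, p.2⟩
  left_inv _ := rfl
  right_inv _ := rfl

def ontologyEquiv : Ontology ≃ List PredSym × List PredSym × List Assertion where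
  toFun O := (O.concepts, O.roles, O.assertions)
  invFun p := ⟨p.1, p.2.1, p.2.2⟩
  left_inv _ := rfl
  right_inv _ := rfl

def cqEquiv : CQ OntAtom ≃ List Var × List OntAtom where
  toFun q := (q.target, q.body)
  invFun p := ⟨p.1, p.2⟩
  left_inv _ := rfl
  right_inv _ := rfl

instance : Code (RelAtom (List Bool)) := .ofEquiv relAtomEquiv encRelAtom fun _ => rfl

instance : Code Ontology := .ofEquiv ontologyEquiv encOntology fun _ => rfl

instance : Code (CQ OntAtom) := .ofEquiv cqEquiv encCQ fun _ => rfl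

def ucqEquiv : UCQ ≃ ℕ × List (CQ OntAtom) where
  toFun q := (q.arity, q.disjuncts)
  invFun p := ⟨p.1, p.2⟩
  left_inv _ := rfl
  right_inv _ := rfl

def glavEquiv : GLAV ≃ List Var × List (RelAtom Var) × List OntAtom where
  toFun m := (m.target, m.srcBody, m.ontBody)
  invFun p := ⟨p.1, p.2.1, p.2.2⟩
  left_inv _ := rfl
  right_inv _ := rfl

def datasetEquiv : Dataset ≃ ℕ × List (List Const) where
  toFun l := (l.arity, l.tuples)
  invFun p := ⟨p.1, p.2⟩
  left_inv _ := rfl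
  right_inv _ := rfl

instance : Code UCQ := .ofEquiv ucqEquiv encUCQ fun _ => rfl

instance : Code GLAV := .ofEquiv glavEquiv encGLAV fun _ => rfl

instance : Code Dataset := .ofEquiv datasetEquiv encDataset fun _ => rfl

def systemEquiv : System ≃ Ontology × Schema × List GLAV × Database where
  toFun s := (s.ontology, s.schema, s.mapping, s.database)
  invFun p := ⟨p.1, p.2.1, p.2.2.1, p.2.2.2⟩
  left_inv _ := rfl
  right_inv _ := rfl

instance : Code System := .ofEquiv systemEquiv encSystem fun _ => rfl

def instanceEquiv : Instance ≃ System × Dataset × UCQ where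
  toFun J := (J.system, J.dataset, J.query)
  invFun p := ⟨p.1, p.2.1, p.2.2⟩
  left_inv _ := rfl
  right_inv _ := rfl

instance : Code Instance := .ofEquiv instanceEquiv encInstance fun _ => rfl

/-- Each of these bijections preserves the code literally, so the prefixed word is empty. The
projections of the structures are obtained through them. -/
theorem NPFun.relAtomEquiv : NPFun relAtomEquiv := .of_enc [] fun _ => rfl
theorem NPFun.ontologyEquiv : NPFun ontologyEquiv := .of_enc [] fun _ => rfl
theorem NPFun.cqEquiv : NPFun cqEquiv := .of_enc [] fun _ => rfl
theorem NPFun.ucqEquiv : NPFun ucqEquiv := .of_enc [] fun _ => rfl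
theorem NPFun.glavEquiv : NPFun glavEquiv := .of_enc [] fun _ => rfl
theorem NPFun.datasetEquiv : NPFun datasetEquiv := .of_enc [] fun _ => rfl
theorem NPFun.systemEquiv : NPFun systemEquiv := .of_enc [] fun _ => rfl
theorem NPFun.instanceEquiv : NPFun instanceEquiv := .of_enc [] fun _ => rfl

namespace NPFun

section Projections

@[fun_prop]
theorem relAtom_pred {f : α → RelAtom (List Bool)} (hf : NPFun f) : NPFun fun a => (f a).pred :=
  (relAtomEquiv.comp hf).fst'

@[fun_prop]
theorem relAtom_args {f : α → RelAtom (List Bool)} (hf : NPFun f) : NPFun fun a => (f a).args :=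
  (relAtomEquiv.comp hf).snd'

@[fun_prop]
theorem ontology_concepts {f : α → Ontology} (hf : NPFun f) : NPFun fun a => (f a).concepts :=
  (ontologyEquiv.comp hf).fst'

@[fun_prop]
theorem ontology_roles {f : α → Ontology} (hf : NPFun f) : NPFun fun a => (f a).roles :=
  (ontologyEquiv.comp hf).snd'.fst'

@[fun_prop]
theorem ontology_assertions {f : α → Ontology} (hf : NPFun f) : NPFun fun a => (f a).assertions :=
  (ontologyEquiv.comp hf).snd'.snd'

@[fun_prop]
theorem cq_target {f : α → CQ OntAtom} (hf : NPFun f) : NPFun fun a => (f a).target :=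
  (cqEquiv.comp hf).fst'

@[fun_prop]
theorem cq_body {f : α → CQ OntAtom} (hf : NPFun f) : NPFun fun a => (f a).body :=
  (cqEquiv.comp hf).snd'

@[fun_prop]
theorem ucq_arity {f : α → UCQ} (hf : NPFun f) : NPFun fun a => (f a).arity :=
  (ucqEquiv.comp hf).fst'

@[fun_prop]
theorem ucq_disjuncts {f : α → UCQ} (hf : NPFun f) : NPFun fun a => (f a).disjuncts :=
  (ucqEquiv.comp hf).snd'

@[fun_prop]
theorem glav_target {f : α → GLAV} (hf : NPFun f) : NPFun fun a => (f a).target :=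
  (glavEquiv.comp hf).fst'

@[fun_prop]
theorem glav_srcBody {f : α → GLAV} (hf : NPFun f) : NPFun fun a => (f a).srcBody :=
  (glavEquiv.comp hf).snd'.fst'

@[fun_prop]
theorem glav_ontBody {f : α → GLAV} (hf : NPFun f) : NPFun fun a => (f a).ontBody :=
  (glavEquiv.comp hf).snd'.snd'

@[fun_prop]
theorem dataset_arity {f : α → Dataset} (hf : NPFun f) : NPFun fun a => (f a).arity :=
  (datasetEquiv.comp hf).fst'

@[fun_prop]
theorem dataset_tuples {f : α → Dataset} (hf : NPFun f) : NPFun fun a => (f a).tuples :=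
  (datasetEquiv.comp hf).snd'

@[fun_prop]
theorem system_ontology {f : α → System} (hf : NPFun f) : NPFun fun a => (f a).ontology :=
  (systemEquiv.comp hf).fst'

@[fun_prop]
theorem system_schema {f : α → System} (hf : NPFun f) : NPFun fun a => (f a).schema :=
  (systemEquiv.comp hf).snd'.fst'

@[fun_prop]
theorem system_mapping {f : α → System} (hf : NPFun f) : NPFun fun a => (f a).mapping :=
  (systemEquiv.comp hf).snd'.snd'.fst'

@[fun_prop]
theorem system_database {f : α → System} (hf : NPFun f) : NPFun fun a => (f a).database :=
  (systemEquiv.comp hf).snd'.snd'.snd'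

@[fun_prop]
theorem instance_system {f : α → Instance} (hf : NPFun f) : NPFun fun a => (f a).system :=
  (instanceEquiv.comp hf).fst'

@[fun_prop]
theorem instance_dataset {f : α → Instance} (hf : NPFun f) : NPFun fun a => (f a).dataset :=
  (instanceEquiv.comp hf).snd'.fst'

@[fun_prop]
theorem instance_query {f : α → Instance} (hf : NPFun f) : NPFun fun a => (f a).query :=
  (instanceEquiv.comp hf).snd'.snd'

end Projections

section Constructors

@[fun_prop]
theorem named {f : α → PredSym} (hf : NPFun f) : NPFun fun a => AtomicConcept.named (f a) :=
  (of_enc (f := AtomicConcept.named) [.bit true] fun _ => rfl).comp hf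

@[fun_prop]
theorem role_atomic {f : α → PredSym} (hf : NPFun f) : NPFun fun a => Role.atomic (f a) :=
  (of_enc (f := Role.atomic) [.bit false] fun _ => rfl).comp hf

@[fun_prop]
theorem role_inv {f : α → PredSym} (hf : NPFun f) : NPFun fun a => Role.inv (f a) :=
  (of_enc (f := Role.inv) [.bit true] fun _ => rfl).comp hf

@[fun_prop]
theorem concept_atomic {f : α → AtomicConcept} (hf : NPFun f) :
    NPFun fun a => Concept.atomic (f a) :=
  (of_enc (f := Concept.atomic) [.bit false] fun _ => rfl).comp hf

@[fun_prop]
theorem concept_ex {f : α → Role} (hf : NPFun f) : NPFun fun a => Concept.ex (f a) :=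
  (of_enc (f := Concept.ex) [.bit true] fun _ => rfl).comp hf

@[fun_prop]
theorem conceptIncl {f g : α → Concept} (hf : NPFun f) (hg : NPFun g) :
    NPFun fun a => Assertion.conceptIncl (f a) (g a) :=
  (of_enc (f := fun p : Concept × Concept => Assertion.conceptIncl p.1 p.2)
    [.bit false, .bit false] fun _ => rfl).comp (hf.prodMk hg)

@[fun_prop]
theorem roleIncl {f g : α → Role} (hf : NPFun f) (hg : NPFun g) :
    NPFun fun a => Assertion.roleIncl (f a) (g a) :=
  (of_enc (f := fun p : Role × Role => Assertion.roleIncl p.1 p.2)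
    [.bit false, .bit true] fun _ => rfl).comp (hf.prodMk hg)

@[fun_prop]
theorem conceptDisj {f g : α → Concept} (hf : NPFun f) (hg : NPFun g) :
    NPFun fun a => Assertion.conceptDisj (f a) (g a) :=
  (of_enc (f := fun p : Concept × Concept => Assertion.conceptDisj p.1 p.2)
    [.bit true, .bit false] fun _ => rfl).comp (hf.prodMk hg)

@[fun_prop]
theorem roleDisj {f g : α → Role} (hf : NPFun f) (hg : NPFun g) :
    NPFun fun a => Assertion.roleDisj (f a) (g a) :=
  (of_enc (f := fun p : Role × Role => Assertion.roleDisj p.1 p.2)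
    [.bit true, .bit true] fun _ => rfl).comp (hf.prodMk hg)

@[fun_prop]
theorem ontAtom_concept {f : α → AtomicConcept} {g : α → Var} (hf : NPFun f) (hg : NPFun g) :
    NPFun fun a => OntAtom.concept (f a) (g a) :=
  (of_enc (f := fun p : AtomicConcept × Var => OntAtom.concept p.1 p.2)
    [.bit false] fun _ => rfl).comp (hf.prodMk hg)

@[fun_prop]
theorem ontAtom_role {f : α → PredSym} {g h : α → Var} (hf : NPFun f) (hg : NPFun g)
    (hh : NPFun h) : NPFun fun a => OntAtom.role (f a) (g a) (h a) :=
  (of_enc (f := fun p : PredSym × Var × Var => OntAtom.role p.1 p.2.1 p.2.2)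
    [.bit true] fun _ => rfl).comp (hf.prodMk (hg.prodMk hh))

end Constructors

end NPFun

end StackProg

/-! ### The canonical model and its universality -/

namespace OBDM

open Relation

/-! ### Derived inclusions -/

/-- The inverse of a basic role. -/
def Role.swap : Role → Role
  | .atomic P => .inv P
  | .inv P => .atomic P

@[simp] theorem Role.swap_swap (R : Role) : R.swap.swap = R := by cases R <;> rfl

theorem Role.swap_over {O : Ontology} {R : Role} : R.swap.Over O ↔ R.Over O := by
  cases R <;> exact Iff.rfl

theorem Interp.mem_basicRole_swap (I : Interp) (R : Role) (o o' : I.Dom) :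
    (o, o') ∈ I.basicRole R.swap ↔ (o', o) ∈ I.basicRole R := by
  cases R <;> exact Iff.rfl

namespace Ontology

variable (O : Ontology)

/-- The second disjunct is present because an inclusion of roles entails the inclusion of their
inverses. -/
def RoleStep (R R' : Role) : Prop :=
  Assertion.roleIncl R R' ∈ O.assertions ∨ Assertion.roleIncl R.swap R'.swap ∈ O.assertions

/-- Inclusions of ⊥ in other concepts are not added: an element of ⊥ already counts as a violation.
-/
def ConceptStep (B B' : Concept) : Prop :=
  Assertion.conceptIncl B B' ∈ O.assertions ∨
    (∃ R R', B = .ex R ∧ B' = .ex R' ∧ O.RoleStep R R') ∨ B' = .atomic .top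

/-- If the first concept is nonempty then so is the second. -/
def NonemptyStep (B B' : Concept) : Prop :=
  O.ConceptStep B B' ∨ ∃ R : Role, R.Over O ∧ B = .ex R ∧ B' = .ex R.swap

def SubRole : Role → Role → Prop := ReflTransGen O.RoleStep

def SubConcept : Concept → Concept → Prop := ReflTransGen O.ConceptStep

variable {O}

theorem RoleStep.swap {R R' : Role} (h : O.RoleStep R R') : O.RoleStep R.swap R'.swap := by
  rcases h with h | h
  · exact Or.inr (by simpa using h)
  · exact Or.inl h

theorem SubRole.swap {R R' : Role} (h : O.SubRole R R') : O.SubRole R.swap R'.swap :=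
  ReflTransGen.lift Role.swap (fun _ _ h => RoleStep.swap h) _ _ h

theorem SubRole.ex {R R' : Role} (h : O.SubRole R R') : O.SubConcept (.ex R) (.ex R') :=
  ReflTransGen.lift Concept.ex (fun _ _ h => Or.inr (Or.inl ⟨_, _, rfl, rfl, h⟩)) _ _ h

theorem SubConcept.top (B : Concept) : O.SubConcept B (.atomic .top) :=
  .single (Or.inr (Or.inr rfl))

theorem RoleStep.over (hO : O.WF) {R R' : Role} (h : O.RoleStep R R') : R'.Over O := by
  rcases h with h | h
  · exact (hO _ h).2
  · exact Role.swap_over.1 (hO _ h).2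

theorem ConceptStep.over (hO : O.WF) {B B' : Concept} (h : O.ConceptStep B B') : B'.Over O := by
  rcases h with h | ⟨R, R', -, rfl, h⟩ | rfl
  · exact (hO _ h).2
  · exact h.over hO
  · trivial

/-- The condition `R.Over O` in `NonemptyStep` is what keeps the reachable concepts inside the
alphabet. -/
theorem nonemptyStep_over (hO : O.WF) {B B' : Concept} (h : ReflTransGen O.NonemptyStep B B')
    (hB : B.Over O) : B'.Over O := by
  cases h with
  | refl => exact hB
  | tail _ h =>
    rcases h with h | ⟨R, hR, -, rfl⟩
    · exact h.over hO
    · exact Role.swap_over.2 hR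

end Ontology

/-! ### The elements of the canonical model -/

/-- Roots of the trees of the canonical model: the constants, the objects introduced by the
mapping for the existential variables, and one object without known properties. -/
inductive Root where
  | const (c : Const)
  | null (m : GLAV) (c : List Const) (y : Var)
  | point

/-- Elements of the canonical model: a root and a sequence of roles, the last one first. -/
abbrev Elem := Root × List Role

/-- The root that represents the variable `x` when the assertion `m` is applied to `c`. -/
def IndOf (m : GLAV) (c : List Const) (x : Var) (a : Root) : Prop :=
  (∃ k, (x, k) ∈ m.target.zip c ∧ a = .const k) ∨ (x ∉ m.target ∧ a = .null m c x)

namespace System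

variable (Sys : System)

/-- The mapping assertion `m` applies to the answer `c`. -/
def Trigger (m : GLAV) (c : List Const) : Prop :=
  m ∈ Sys.mapping ∧ c ∈ answers m.src Sys.database

def BaseRole (R : Role) (a b : Root) : Prop :=
  ∃ m c, Sys.Trigger m c ∧ ∃ P x y, OntAtom.role P x y ∈ m.ontBody ∧
    ((R = .atomic P ∧ IndOf m c x a ∧ IndOf m c y b) ∨
      (R = .inv P ∧ IndOf m c y a ∧ IndOf m c x b))

def BaseConcept (B : Concept) (a : Root) : Prop :=
  ∃ m c, Sys.Trigger m c ∧
    ((∃ A x, OntAtom.concept A x ∈ m.ontBody ∧ B = .atomic A ∧ IndOf m c x a) ∨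
      ∃ P x y, OntAtom.role P x y ∈ m.ontBody ∧
        ((B = .ex (.atomic P) ∧ IndOf m c x a) ∨ (B = .ex (.inv P) ∧ IndOf m c y a)))

/-- The element belongs to the concept. -/
def HoldsC (B : Concept) (e : Elem) : Prop :=
  match e.2 with
  | [] => ∃ B₀, (B₀ = .atomic .top ∨ Sys.BaseConcept B₀ e.1) ∧ Sys.ontology.SubConcept B₀ B
  | R :: _ => Sys.ontology.SubConcept (.ex R.swap) B

/-- The pair of elements belongs to the role. -/
def HoldsR (R : Role) (e e' : Elem) : Prop :=
  (∃ R₀, e.2 = [] ∧ e'.2 = [] ∧ Sys.BaseRole R₀ e.1 e'.1 ∧ Sys.ontology.SubRole R₀ R) ∨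
  (∃ S, e' = (e.1, S :: e.2) ∧ Sys.HoldsC (.ex S) e ∧ Sys.ontology.SubRole S R) ∨
  ∃ S, e = (e'.1, S :: e'.2) ∧ Sys.HoldsC (.ex S) e' ∧ Sys.ontology.SubRole S R.swap

/-- The concept has an instance in every model. -/
def NonemptyC (B : Concept) : Prop :=
  ∃ B₀, (B₀ = .atomic .top ∨ ∃ a, Sys.BaseConcept B₀ a) ∧
    ReflTransGen Sys.ontology.NonemptyStep B₀ B

/-- The roles of the path exist; a path may also start with any nonempty role. -/
def ValidPath (a : Root) : List Role → Prop
  | [] => True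
  | R :: p => (ValidPath a p ∧ Sys.HoldsC (.ex R) (a, p)) ∨
      (a = .point ∧ p = [] ∧ Sys.NonemptyC (.ex R))

def Valid (e : Elem) : Prop := Sys.ValidPath e.1 e.2

/-- A negative assertion is violated in the canonical model. -/
def Violation : Prop :=
  (∃ e, Sys.Valid e ∧ Sys.HoldsC (.atomic .bot) e) ∨
  (∃ e, Sys.Valid e ∧ ∃ B₁ B₂, Assertion.conceptDisj B₁ B₂ ∈ Sys.ontology.assertions ∧
    Sys.HoldsC B₁ e ∧ Sys.HoldsC B₂ e) ∨
  ∃ e e', Sys.Valid e ∧ Sys.Valid e' ∧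
    ∃ R₁ R₂, Assertion.roleDisj R₁ R₂ ∈ Sys.ontology.assertions ∧
      Sys.HoldsR R₁ e e' ∧ Sys.HoldsR R₂ e e'

/-- Truth of an atom in the canonical model under a finite assignment. -/
def AtomHolds (τ : List (Var × Elem)) : OntAtom → Prop
  | .concept A x => ∃ e, (x, e) ∈ τ ∧ Sys.HoldsC (.atomic A) e
  | .role P x y => ∃ e e', (x, e) ∈ τ ∧ (y, e') ∈ τ ∧ Sys.HoldsR (.atomic P) e e'

/-- The assignment witnesses that `c` is an answer to `d` over the canonical model. -/
def Match (d : CQ OntAtom) (c : List Const) (τ : List (Var × Elem)) : Prop :=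
  (∀ p ∈ τ, ∀ p' ∈ τ, p.1 = p'.1 → p.2 = p'.2) ∧ (∀ p ∈ τ, Sys.Valid p.2) ∧
    List.Forall₂ (fun x k => (x, ((.const k, []) : Elem)) ∈ τ) d.target c ∧
    ∀ a ∈ d.body, Sys.AtomHolds τ a

variable {Sys}

theorem BaseRole.swap {R : Role} {a b : Root} (h : Sys.BaseRole R a b) :
    Sys.BaseRole R.swap b a := by
  obtain ⟨m, c, ht, P, x, y, hm, ⟨rfl, h1, h2⟩ | ⟨rfl, h1, h2⟩⟩ := h
  · exact ⟨m, c, ht, P, x, y, hm, Or.inr ⟨rfl, h2, h1⟩⟩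
  · exact ⟨m, c, ht, P, x, y, hm, Or.inl ⟨rfl, h2, h1⟩⟩

theorem BaseRole.baseConcept {R : Role} {a b : Root} (h : Sys.BaseRole R a b) :
    Sys.BaseConcept (.ex R) a := by
  obtain ⟨m, c, ht, P, x, y, hm, ⟨rfl, h1, h2⟩ | ⟨rfl, h1, h2⟩⟩ := h
  · exact ⟨m, c, ht, Or.inr ⟨P, x, y, hm, Or.inl ⟨rfl, h1⟩⟩⟩
  · exact ⟨m, c, ht, Or.inr ⟨P, x, y, hm, Or.inr ⟨rfl, h1⟩⟩⟩

theorem HoldsC.mono {B B' : Concept} {e : Elem} (h : Sys.HoldsC B e)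
    (hB : Sys.ontology.SubConcept B B') : Sys.HoldsC B' e := by
  obtain ⟨a, _ | ⟨R, p⟩⟩ := e
  · obtain ⟨B₀, h0, h1⟩ := h
    exact ⟨B₀, h0, ReflTransGen.trans h1 hB⟩
  · exact ReflTransGen.trans h hB

theorem HoldsC.top (e : Elem) : Sys.HoldsC (.atomic .top) e := by
  obtain ⟨a, _ | ⟨R, p⟩⟩ := e
  · exact ⟨_, Or.inl rfl, .refl⟩
  · exact Ontology.SubConcept.top _

theorem HoldsR.mono {R R' : Role} {e e' : Elem} (h : Sys.HoldsR R e e')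
    (hR : Sys.ontology.SubRole R R') : Sys.HoldsR R' e e' := by
  rcases h with ⟨R₀, h1, h2, h3, h4⟩ | ⟨S, h1, h2, h3⟩ | ⟨S, h1, h2, h3⟩
  · exact Or.inl ⟨R₀, h1, h2, h3, ReflTransGen.trans h4 hR⟩
  · exact Or.inr (Or.inl ⟨S, h1, h2, ReflTransGen.trans h3 hR⟩)
  · exact Or.inr (Or.inr ⟨S, h1, h2, ReflTransGen.trans h3 hR.swap⟩)

theorem HoldsR.swap {R : Role} {e e' : Elem} (h : Sys.HoldsR R e e') :
    Sys.HoldsR R.swap e' e := by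
  rcases h with ⟨R₀, h1, h2, h3, h4⟩ | ⟨S, h1, h2, h3⟩ | ⟨S, h1, h2, h3⟩
  · exact Or.inl ⟨R₀.swap, h2, h1, h3.swap, h4.swap⟩
  · exact Or.inr (Or.inr ⟨S, h1, h2, by simpa using h3⟩)
  · exact Or.inr (Or.inl ⟨S, h1, h2, h3⟩)

theorem HoldsR.holdsC {R : Role} {e e' : Elem} (h : Sys.HoldsR R e e') :
    Sys.HoldsC (.ex R) e := by
  rcases h with ⟨R₀, h1, h2, h3, h4⟩ | ⟨S, h1, h2, h3⟩ | ⟨S, h1, h2, h3⟩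
  · obtain ⟨a, p⟩ := e
    obtain rfl : p = [] := h1
    exact ⟨_, Or.inr h3.baseConcept, h4.ex⟩
  · exact h2.mono h3.ex
  -- Here `e` is the child, and its concepts are those implied by `∃S⁻`.
  · subst h1
    have := h3.swap
    rw [Role.swap_swap] at this
    exact this.ex

/-! ### Soundness: the canonical model maps to every model -/

section Sound

variable {I : Interp}

open Classical in
/-- The value of a root in a model. -/
noncomputable def rootVal (I : Interp) : Root → I.Dom
  | .const c => I.const c
  | .null m c y =>
    -- The choice depends on `m` and `c` but not on `y`, so the values of all nulls of one
    -- application come from a single assignment.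
    if h : ∃ h : Var → I.Dom, (∀ a ∈ m.ontBody, I.Holds h a) ∧ m.target.map h = c.map I.const then
      h.choose y
    else I.nonempty.some
  | .point => I.nonempty.some

open Classical in
/-- The value of an element in a model. -/
noncomputable def pathVal (I : Interp) (a : Root) : List Role → I.Dom
  | [] => rootVal I a
  | R :: p =>
    if h : ∃ o, (pathVal I a p, o) ∈ I.basicRole R then h.choose
    -- Needed for paths that start at `point`: the value of `point` may lack an `R`-successor, and
    -- then any object with an `R`-predecessor will do.
    else if h : ∃ o o', (o', o) ∈ I.basicRole R then h.choose
    else I.nonempty.some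

noncomputable def elemVal (I : Interp) (e : Elem) : I.Dom := pathVal I e.1 e.2

theorem pathVal_cons {a : Root} {p : List Role} {R : Role}
    (h : pathVal I a p ∈ I.basicConcept (.ex R)) :
    (pathVal I a p, pathVal I a (R :: p)) ∈ I.basicRole R := by
  have h' : ∃ o, (pathVal I a p, o) ∈ I.basicRole R := h
  rw [pathVal, dif_pos h']
  exact h'.choose_spec

theorem pathVal_cons_of_nonempty {a : Root} {p : List Role} {R : Role}
    (h : ∃ o, o ∈ I.basicConcept (.ex R)) : ∃ o, (o, pathVal I a (R :: p)) ∈ I.basicRole R := by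
  by_cases h' : ∃ o, (pathVal I a p, o) ∈ I.basicRole R
  · exact ⟨_, pathVal_cons h'⟩
  · obtain ⟨o, o', ho⟩ := h
    have h'' : ∃ o o', (o', o) ∈ I.basicRole R := ⟨o', o, ho⟩
    rw [pathVal, dif_neg h', dif_pos h'']
    exact h''.choose_spec

theorem roleStep_sound (hI : Sys.IsModel I) {R R' : Role} (h : Sys.ontology.RoleStep R R') :
    I.basicRole R ⊆ I.basicRole R' := by
  rcases h with h | h
  · exact hI.1 _ h
  · rintro ⟨o, o'⟩ ho
    exact (I.mem_basicRole_swap R' o' o).1 (hI.1 _ h ((I.mem_basicRole_swap R o' o).2 ho))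

theorem subRole_sound (hI : Sys.IsModel I) {R R' : Role} (h : Sys.ontology.SubRole R R') :
    I.basicRole R ⊆ I.basicRole R' := by
  induction h with
  | refl => exact subset_rfl
  | tail _ h ih => exact ih.trans (roleStep_sound hI h)

theorem conceptStep_sound (hI : Sys.IsModel I) {B B' : Concept}
    (h : Sys.ontology.ConceptStep B B') : I.basicConcept B ⊆ I.basicConcept B' := by
  rcases h with h | ⟨R, R', rfl, rfl, h⟩ | rfl
  · exact hI.1 _ h
  · rintro o ⟨o', ho⟩
    exact ⟨o', roleStep_sound hI h ho⟩
  · exact fun o _ => Set.mem_univ o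

theorem subConcept_sound (hI : Sys.IsModel I) {B B' : Concept}
    (h : Sys.ontology.SubConcept B B') : I.basicConcept B ⊆ I.basicConcept B' := by
  induction h with
  | refl => exact subset_rfl
  | tail _ h ih => exact ih.trans (conceptStep_sound hI h)

theorem exists_indOf_sound (hI : Sys.IsModel I) {m : GLAV} {c : List Const}
    (ht : Sys.Trigger m c) : ∃ h : Var → I.Dom, (∀ a ∈ m.ontBody, I.Holds h a) ∧
      ∀ x a, IndOf m c x a → rootVal I a = h x := by
  have hex : ∃ h : Var → I.Dom, (∀ a ∈ m.ontBody, I.Holds h a) ∧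
      m.target.map h = c.map I.const := hI.2 m ht.1 c ht.2
  refine ⟨hex.choose, hex.choose_spec.1, ?_⟩
  rintro x a (⟨k, hk, rfl⟩ | ⟨-, rfl⟩)
  · have h2 := hex.choose_spec.2
    generalize hex.choose = h at h2
    change I.const k = h x
    clear ht hex
    generalize m.target = l at hk h2
    induction l generalizing c with
    | nil => simp at hk
    | cons z l ih =>
      cases c with
      | nil => simp at hk
      | cons k' c =>
        simp only [List.map_cons, List.cons.injEq] at h2
        rcases List.mem_cons.1 hk with hk | hk
        · obtain ⟨rfl, rfl⟩ : x = z ∧ k = k' := by simpa using hk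
          exact h2.1.symm
        · exact ih hk h2.2
  · rw [rootVal, dif_pos hex]

theorem baseRole_sound (hI : Sys.IsModel I) {R : Role} {a b : Root} (h : Sys.BaseRole R a b) :
    (rootVal I a, rootVal I b) ∈ I.basicRole R := by
  obtain ⟨m, c, ht, P, x, y, hm, h⟩ := h
  obtain ⟨h0, h1, h2⟩ := exists_indOf_sound hI ht
  have h3 : (h0 x, h0 y) ∈ I.role P := h1 _ hm
  rcases h with ⟨rfl, e1, e2⟩ | ⟨rfl, e1, e2⟩
  · rw [h2 _ _ e1, h2 _ _ e2]; exact h3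
  · rw [h2 _ _ e1, h2 _ _ e2]; exact h3

theorem baseConcept_sound (hI : Sys.IsModel I) {B : Concept} {a : Root}
    (h : Sys.BaseConcept B a) : rootVal I a ∈ I.basicConcept B := by
  obtain ⟨m, c, ht, h⟩ := h
  obtain ⟨h0, h1, h2⟩ := exists_indOf_sound hI ht
  rcases h with ⟨A, x, hm, rfl, e⟩ | ⟨P, x, y, hm, ⟨rfl, e⟩ | ⟨rfl, e⟩⟩
  · rw [h2 _ _ e]
    exact h1 _ hm
  · rw [h2 _ _ e]
    exact ⟨h0 y, h1 _ hm⟩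
  · rw [h2 _ _ e]
    exact ⟨h0 x, h1 _ hm⟩

theorem nonemptyC_sound (hI : Sys.IsModel I) {B : Concept} (h : Sys.NonemptyC B) :
    ∃ o, o ∈ I.basicConcept B := by
  obtain ⟨B₀, h0, h⟩ := h
  induction h with
  | refl =>
    rcases h0 with rfl | ⟨a, h0⟩
    · exact ⟨I.nonempty.some, Set.mem_univ _⟩
    · exact ⟨_, baseConcept_sound hI h0⟩
  | tail _ h ih =>
    obtain ⟨o, ho⟩ := ih
    rcases h with h | ⟨R, -, rfl, rfl⟩
    · exact ⟨o, conceptStep_sound hI h ho⟩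
    · obtain ⟨o', ho⟩ := ho
      exact ⟨o', o, (I.mem_basicRole_swap R o' o).2 ho⟩

/-- All concepts of an element with last role `R` follow from `∃R⁻`, so its value only needs an
`R`-predecessor. The value of the parent is one, by induction along the path; for a path started
freely at `point`, non-emptiness of `R` provides one. -/
theorem holdsC_sound (hI : Sys.IsModel I) {B : Concept} {e : Elem} (he : Sys.Valid e)
    (h : Sys.HoldsC B e) : elemVal I e ∈ I.basicConcept B := by
  obtain ⟨a, p⟩ := e
  induction p generalizing B with
  | nil =>
    obtain ⟨B₀, h0, h⟩ := h
    refine subConcept_sound hI h ?_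
    rcases h0 with rfl | h0
    · exact Set.mem_univ _
    · exact baseConcept_sound hI h0
  | cons R p ih =>
    refine subConcept_sound hI h ?_
    have key : ∃ o, (o, elemVal I (a, R :: p)) ∈ I.basicRole R := by
      rcases he with ⟨he, hR⟩ | ⟨-, -, hR⟩
      · exact ⟨_, pathVal_cons (ih he hR)⟩
      · exact pathVal_cons_of_nonempty (nonemptyC_sound hI hR)
    obtain ⟨o, ho⟩ := key
    exact ⟨o, (I.mem_basicRole_swap R _ _).2 ho⟩

theorem holdsR_sound (hI : Sys.IsModel I) {R : Role} {e e' : Elem} (he : Sys.Valid e)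
    (he' : Sys.Valid e') (h : Sys.HoldsR R e e') :
    (elemVal I e, elemVal I e') ∈ I.basicRole R := by
  rcases h with ⟨R₀, h1, h2, h3, h4⟩ | ⟨S, rfl, h2, h3⟩ | ⟨S, rfl, h2, h3⟩
  · obtain ⟨a, p⟩ := e
    obtain ⟨a', p'⟩ := e'
    obtain rfl : p = [] := h1
    obtain rfl : p' = [] := h2
    exact subRole_sound hI h4 (baseRole_sound hI h3)
  · exact subRole_sound hI h3 (pathVal_cons (holdsC_sound hI he h2))
  · exact (I.mem_basicRole_swap R _ _).1
      (subRole_sound hI h3 (pathVal_cons (holdsC_sound hI he' h2)))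

theorem not_isModel_of_violation (h : Sys.Violation) : ¬ Sys.IsModel I := by
  intro hI
  rcases h with ⟨e, he, h⟩ | ⟨e, he, B₁, B₂, hm, h1, h2⟩ | ⟨e, e', he, he', R₁, R₂, hm, h1, h2⟩
  · exact holdsC_sound hI he h
  · have := hI.1 _ hm
    exact (Set.ext_iff.1 this _).1 ⟨holdsC_sound hI he h1, holdsC_sound hI he h2⟩
  · have := hI.1 _ hm
    exact (Set.ext_iff.1 this _).1 ⟨holdsR_sound hI he he' h1, holdsR_sound hI he he' h2⟩

theorem match_sound (hI : Sys.IsModel I) {d : CQ OntAtom} {c : List Const}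
    {τ : List (Var × Elem)} (h : Sys.Match d c τ) : c.map I.const ∈ I.answers d := by
  classical
  obtain ⟨h1, h2, h3, h4⟩ := h
  -- A match assigns an element to every variable of `d`, so the default value outside `τ` plays no
  -- role.
  let h : Var → I.Dom := fun x => if hx : ∃ e, (x, e) ∈ τ then elemVal I hx.choose else
    I.nonempty.some
  have hval : ∀ x e, (x, e) ∈ τ → h x = elemVal I e := by
    intro x e he
    have hx : ∃ e, (x, e) ∈ τ := ⟨e, he⟩
    have : hx.choose = e := h1 _ hx.choose_spec _ he rfl
    simp only [h, dif_pos hx, this]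
  refine ⟨h, fun a ha => ?_, ?_⟩
  · have := h4 a ha
    cases a with
    | concept A x =>
      obtain ⟨e, he, hA⟩ := this
      change h x ∈ I.atomicConcept A
      rw [hval x e he]
      exact holdsC_sound hI (h2 _ he) hA
    | role P x y =>
      obtain ⟨e, e', he, he', hP⟩ := this
      change (h x, h y) ∈ I.role P
      rw [hval x e he, hval y e' he']
      exact holdsR_sound hI (h2 _ he) (h2 _ he') hP
  · clear h1 h2 h4
    generalize d.target = l at h3 ⊢
    induction h3 with
    | nil => rfl
    | cons hxk _ ih =>
      rw [List.map_cons, List.map_cons, ih]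
      congr 1
      exact hval _ _ hxk

end Sound

/-! ### The canonical model -/

/-- The canonical model, whose elements are the valid ones. -/
def canonical (Sys : System) : Interp where
  Dom := {e // Sys.Valid e}
  nonempty := ⟨⟨(.point, []), trivial⟩⟩
  concept A := {e | Sys.HoldsC (.atomic (.named A)) e}
  role P := {p | Sys.HoldsR (.atomic P) p.1 p.2}
  const c := ⟨(.const c, []), trivial⟩

theorem mem_canonical_basicRole {R : Role} {e e' : (canonical Sys).Dom} :
    (e, e') ∈ (canonical Sys).basicRole R ↔ Sys.HoldsR R e.1 e'.1 := by
  cases R with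
  | atomic P => exact Iff.rfl
  | inv P => exact ⟨HoldsR.swap, HoldsR.swap⟩

/-- Every element of `∃R` has a child along `R` of its own, so no search for a witness is needed.
The absence of violations enters only for ⊥. -/
theorem mem_canonical_basicConcept (hV : ¬ Sys.Violation) {B : Concept}
    {e : (canonical Sys).Dom} :
    e ∈ (canonical Sys).basicConcept B ↔ Sys.HoldsC B e.1 := by
  rcases B with (_ | _ | A) | R
  · exact ⟨fun _ => HoldsC.top _, fun _ => Set.mem_univ e⟩
  · exact ⟨fun h => h.elim, fun h => hV (Or.inl ⟨e.1, e.2, h⟩)⟩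
  · exact Iff.rfl
  · constructor
    · rintro ⟨e', h⟩
      exact (mem_canonical_basicRole.1 h).holdsC
    · intro h
      exact ⟨⟨(e.1.1, R :: e.1.2), Or.inl ⟨e.2, h⟩⟩,
        mem_canonical_basicRole.2 (Or.inr (Or.inl ⟨R, rfl, h, .refl⟩))⟩

/-- Positive inclusions hold since membership is closed under derived inclusions; a counterexample
to a negative one would be a violation; the roots were made to satisfy the mapping. -/
theorem canonical_isModel (hV : ¬ Sys.Violation) : Sys.IsModel (canonical Sys) := by
  classical
  refine ⟨fun α hα => ?_, fun m hm c hc => ?_⟩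
  · cases α with
    | conceptIncl B₁ B₂ =>
      intro e he
      rw [mem_canonical_basicConcept hV] at he ⊢
      exact he.mono (.single (Or.inl hα))
    | roleIncl R₁ R₂ =>
      rintro ⟨e, e'⟩ he
      rw [mem_canonical_basicRole] at he ⊢
      exact he.mono (.single (Or.inl hα))
    | conceptDisj B₁ B₂ =>
      refine Set.eq_empty_iff_forall_notMem.2 fun e he => ?_
      rw [Set.mem_inter_iff, mem_canonical_basicConcept hV, mem_canonical_basicConcept hV] at he
      exact hV (Or.inr (Or.inl ⟨e.1, e.2, B₁, B₂, hα, he⟩))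
    | roleDisj R₁ R₂ =>
      refine Set.eq_empty_iff_forall_notMem.2 fun ⟨e, e'⟩ he => ?_
      rw [Set.mem_inter_iff, mem_canonical_basicRole, mem_canonical_basicRole] at he
      exact hV (Or.inr (Or.inr ⟨e.1, e'.1, e.2, e'.2, R₁, R₂, hα, he⟩))
  · obtain ⟨-, h₀, -, h0⟩ := id hc
    have ht : Sys.Trigger m c := ⟨hm, hc⟩
    -- Target variables go to the constants of the answer, the others to the nulls labelled by this
    -- assertion and this answer.
    let ind : Var → Root := fun x => if x ∈ m.target then .const (h₀ x) else .null m c x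
    have hind : ∀ x, IndOf m c x (ind x) := by
      intro x
      by_cases hx : x ∈ m.target
      · refine Or.inl ⟨h₀ x, ?_, by simp [ind, hx]⟩
        have h0' : m.target.map h₀ = c := h0
        rw [← h0', List.mem_iff_getElem]
        obtain ⟨n, hn, rfl⟩ := List.mem_iff_getElem.1 hx
        exact ⟨n, by simpa using hn, by simp⟩
      · exact Or.inr ⟨hx, by simp [ind, hx]⟩
    refine ⟨fun x => ⟨(ind x, []), trivial⟩, fun a ha => ?_, ?_⟩
    · cases a with
      | concept A x =>
        refine (mem_canonical_basicConcept hV (B := .atomic A)).2 ⟨.atomic A, Or.inr ?_, .refl⟩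
        exact ⟨m, c, ht, Or.inl ⟨A, x, ha, rfl, hind x⟩⟩
      | role P x y =>
        exact Or.inl ⟨.atomic P, rfl, rfl,
          ⟨m, c, ht, P, x, y, ha, Or.inl ⟨rfl, hind x, hind y⟩⟩, .refl⟩
    · have h0' : m.target.map h₀ = c := h0
      change m.target.map _ = c.map _
      rw [← h0', List.map_map]
      refine List.map_congr_left fun x hx => ?_
      simp only [ind, hx, if_true]
      rfl

/-- The variables of a query. -/
def _root_.OBDM.OntAtom.vars : OntAtom → List Var
  | .concept _ x => [x]
  | .role _ x y => [x, y]

def _root_.OBDM.CQ.vars (d : CQ OntAtom) : List Var := d.target ++ d.body.flatMap OntAtom.vars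

/-- Turns an assignment of all variables into a finite one. It is applied to answers over the
canonical model and, later, to pruned assignments. -/
theorem match_map {d : CQ OntAtom} {c : List Const} {h : Var → Elem}
    (hv : ∀ x ∈ d.vars, Sys.Valid (h x))
    (ht : d.target.map h = c.map fun k => ((.const k, []) : Elem))
    (hC : ∀ A x, OntAtom.concept A x ∈ d.body → Sys.HoldsC (.atomic A) (h x))
    (hR : ∀ P x y, OntAtom.role P x y ∈ d.body → Sys.HoldsR (.atomic P) (h x) (h y)) :
    Sys.Match d c (d.vars.map fun x => (x, h x)) := by
  have hmem : ∀ x ∈ d.vars, (x, h x) ∈ d.vars.map fun x => (x, h x) :=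
    fun x hx => List.mem_map.2 ⟨x, hx, rfl⟩
  refine ⟨?_, ?_, ?_, fun a ha => ?_⟩
  · intro p hp p' hp' he
    obtain ⟨x, -, rfl⟩ := List.mem_map.1 hp
    obtain ⟨y, -, rfl⟩ := List.mem_map.1 hp'
    obtain rfl : x = y := he
    rfl
  · intro p hp
    obtain ⟨x, hx, rfl⟩ := List.mem_map.1 hp
    exact hv x hx
  · have hsub : ∀ x ∈ d.target, x ∈ d.vars := fun x hx => List.mem_append_left _ hx
    generalize d.target = l at ht hsub
    induction l generalizing c with
    | nil =>
      have : c = [] := by simpa using ht.symm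
      subst this
      exact .nil
    | cons x l ih =>
      cases c with
      | nil => simp at ht
      | cons k c =>
        simp only [List.map_cons, List.cons.injEq] at ht
        refine .cons ?_ (ih ht.2 fun y hy => hsub y (List.mem_cons_of_mem _ hy))
        have := hmem x (hsub x List.mem_cons_self)
        rw [ht.1] at this
        exact this
  · have hv : ∀ x ∈ a.vars, x ∈ d.vars := fun x hx =>
      List.mem_append_right _ (List.mem_flatMap.2 ⟨a, ha, hx⟩)
    cases a with
    | concept A x => exact ⟨_, hmem x (hv x (by simp [OntAtom.vars])), hC A x ha⟩
    | role P x y =>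
      exact ⟨_, _, hmem x (hv x (by simp [OntAtom.vars])), hmem y (hv y (by simp [OntAtom.vars])),
        hR P x y ha⟩

theorem exists_match_of_mem_answers (hV : ¬ Sys.Violation) {d : CQ OntAtom} {c : List Const}
    (h : c.map (canonical Sys).const ∈ (canonical Sys).answers d) :
    ∃ τ, Sys.Match d c τ := by
  obtain ⟨h, h1, h2⟩ := h
  refine ⟨_, match_map (h := fun x => (h x).1) (fun x _ => (h x).2) ?_ (fun A x ha => ?_)
    fun P x y ha => h1 _ ha⟩
  · have : (d.target.map h).map (fun e : (canonical Sys).Dom => e.1) =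
        (c.map (canonical Sys).const).map fun e => e.1 := by rw [h2]
    rwa [List.map_map, List.map_map] at this
  · exact (mem_canonical_basicConcept hV (B := .atomic A)).1 (h1 _ ha)

/-- A tuple is a certain answer iff this is witnessed in the canonical model. -/
theorem mem_cert_iff (Sys : System) (q : UCQ) (c : List Const) :
    c ∈ Sys.cert q ↔ c ∈ Sys.database.tuples q.arity ∧
      (Sys.Violation ∨ ∃ d ∈ q.disjuncts, ∃ τ, Sys.Match d c τ) := by
  refine and_congr_right fun _ => ⟨fun h => ?_, ?_⟩
  · by_cases hV : Sys.Violation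
    · exact Or.inl hV
    · obtain ⟨d, hd, h⟩ := h _ (canonical_isModel hV)
      exact Or.inr ⟨d, hd, exists_match_of_mem_answers hV h⟩
  · rintro (hV | ⟨d, hd, τ, h⟩) I hI
    · exact (not_isModel_of_violation hV hI).elim
    · exact ⟨d, hd, match_sound hI h⟩

end System

end OBDM

/-! ### Pruning: witnesses of polynomial size in the canonical model -/

namespace OBDM

open Relation StackProg

/-! ### Codes of the elements of the canonical model -/

def encRoot : Root → List Sym
  | .const c => Sym.bit false :: Sym.bit false :: encBits c
  | .point => [Sym.bit false, Sym.bit true]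
  | .null m c y => Sym.bit true :: (encGLAV m ++ (encList encBits c ++ encBits y))

theorem prefixCode_root : PrefixCode encRoot := by
  have h : PrefixCode (Code.enc : GLAV × List Const × Var → List Sym) := Code.prefixCode
  rintro (k | ⟨m, c, y⟩ | _) (k' | ⟨m', c', y'⟩ | _) s t hst <;>
    simp only [encRoot, List.cons_append, List.cons.injEq, Sym.bit.injEq, reduceCtorEq,
      true_and, false_and, List.nil_append] at hst
  · obtain ⟨rfl, rfl⟩ := prefixCode_bits _ _ _ _ hst
    exact ⟨rfl, rfl⟩
  · simpa using h (m, c, y) (m', c', y') s t hst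
  · exact ⟨rfl, hst⟩

instance : Code Root where
  enc := encRoot
  prefixCode := prefixCode_root
  valid := ((CheckableLang.const (encRoot .point)).or
    ((CheckableLang.prefixed [.bit false, .bit false] Const).or
      (CheckableLang.prefixed [.bit true] (GLAV × List Const × Var)))).congr fun x => by
    constructor
    · rintro (rfl | ⟨c, rfl⟩ | ⟨p, rfl⟩)
      exacts [⟨_, rfl⟩, ⟨.const c, rfl⟩, ⟨.null p.1 p.2.1 p.2.2, rfl⟩]
    · rintro ⟨c | ⟨m, c, y⟩ | _, rfl⟩
      exacts [Or.inr (Or.inl ⟨c, rfl⟩), Or.inr (Or.inr ⟨(m, c, y), rfl⟩), Or.inl rfl]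

theorem len_const (c : Const) : len (Root.const c) = len c + 2 := rfl

theorem len_null (m : GLAV) (c : List Const) (y : Var) :
    len (Root.null m c y) = len m + len c + len y + 1 := by
  change (Sym.bit true :: Code.enc (m, c, y)).length = _
  rw [List.length_cons]
  change len (m, c, y) + 1 = _
  rw [len_pair, len_pair]
  lia

theorem len_point : len Root.point = 2 := rfl

/-- The two added units count the symbol `item` before each element and the final `close`. -/
theorem len_le_mul {α : Type} [Code α] {l : List α} {n b : ℕ} (hl : l.length ≤ n)
    (hb : ∀ a ∈ l, len a ≤ b) : len l ≤ n * (b + 1) + 1 := by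
  have : len l ≤ l.length * (b + 1) + 1 := by
    clear hl
    induction l with
    | nil => simp [len_nil]
    | cons a l ih =>
      have h1 := ih fun x hx => hb x (List.mem_cons_of_mem _ hx)
      have h2 := hb a List.mem_cons_self
      rw [len_cons, List.length_cons, Nat.add_mul]
      lia
  refine this.trans ?_
  gcongr

theorem len_glav (m : GLAV) : len m = len m.target + len m.srcBody + len m.ontBody := by
  change len (m.target, m.srcBody, m.ontBody) = _
  rw [len_pair, len_pair, Nat.add_assoc]

theorem len_system (Sys : System) : len Sys =
    len Sys.ontology + len Sys.schema + len Sys.mapping + len Sys.database := by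
  change len (Sys.ontology, Sys.schema, Sys.mapping, Sys.database) = _
  rw [len_pair, len_pair, len_pair]
  lia

theorem len_ontology (O : Ontology) : len O =
    len O.concepts + len O.roles + len O.assertions := by
  change len (O.concepts, O.roles, O.assertions) = _
  rw [len_pair, len_pair, Nat.add_assoc]

theorem len_cq (d : CQ OntAtom) : len d = len d.target + len d.body := len_pair (d.target, d.body)

theorem len_relAtom (a : RelAtom (List Bool)) : len a = len a.pred + len a.args :=
  len_pair (a.pred, a.args)

theorem len_role_eq (R : Role) : ∃ P : PredSym, len R = len P + 1 ∧ ∀ O, R.Over O ↔ P ∈ O.roles := by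
  cases R with
  | atomic P => exact ⟨P, rfl, fun _ => Iff.rfl⟩
  | inv P => exact ⟨P, rfl, fun _ => Iff.rfl⟩

theorem len_ontAtom_role (P : PredSym) (x y : Var) :
    len (OntAtom.role P x y) = len P + len x + len y + 1 := by
  change len (P, x, y) + 1 = _
  rw [len_pair, len_pair]
  lia

theorem len_ontAtom_concept (A : AtomicConcept) (x : Var) :
    len (OntAtom.concept A x) = len A + len x + 1 := by
  change len (A, x) + 1 = _
  rw [len_pair]

theorem OntAtom.len_le_of_mem_vars {a : OntAtom} {x : Var} (h : x ∈ a.vars) : len x < len a := by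
  cases a with
  | concept A y =>
    obtain rfl : x = y := by simpa [OntAtom.vars] using h
    rw [len_ontAtom_concept]; lia
  | role P y z =>
    rw [len_ontAtom_role]
    obtain rfl | rfl : x = y ∨ x = z := by simpa [OntAtom.vars] using h
    · lia
    · lia

theorem Role.Over.len_le {O : Ontology} {R : Role} (h : R.Over O) : len R ≤ len O + 1 := by
  obtain ⟨P, h1, h2⟩ := len_role_eq R
  have := len_le_of_mem ((h2 O).1 h)
  rw [len_ontology]
  lia

theorem Database.len_le_of_mem_dom {D : Database} {c : Const} (h : c ∈ D.dom) : len c ≤ len D := by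
  obtain ⟨a, ha, hc⟩ := h
  have h1 := StackProg.len_le_of_mem ha
  have h2 := StackProg.len_le_of_mem hc
  rw [len_relAtom] at h1
  lia

theorem CQ.len_le_of_mem_vars {d : CQ OntAtom} {x : Var} (h : x ∈ d.vars) : len x ≤ len d := by
  rw [len_cq]
  rcases List.mem_append.1 h with h | h
  · have := StackProg.len_le_of_mem h
    lia
  · obtain ⟨a, ha, hx⟩ := List.mem_flatMap.1 h
    have h1 := StackProg.len_le_of_mem ha
    have h2 := OntAtom.len_le_of_mem_vars hx
    lia

theorem len_pos_bits (x : List Bool) : 0 < len x := by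
  change 0 < (encBits x).length
  simp [encBits]

theorem CQ.length_vars_le (d : CQ OntAtom) : d.vars.length ≤ len d := by
  have h2 : ∀ l : List OntAtom, (l.flatMap OntAtom.vars).length ≤ len l := by
    intro l
    induction l with
    | nil => simp
    | cons a l ih =>
      have : a.vars.length ≤ len a := by
        cases a with
        | concept A x => rw [len_ontAtom_concept]; simp [OntAtom.vars]
        | role P x y =>
          have := len_pos_bits P
          rw [len_ontAtom_role]
          simp only [OntAtom.vars, List.length_cons, List.length_nil]
          lia
      rw [List.flatMap_cons, List.length_append, len_cons]
      lia
  have h1 := length_lt_len d.target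
  have := h2 d.body
  rw [len_cq, CQ.vars, List.length_append]
  lia

namespace System

variable {Sys : System}

/-! ### Objects with properties are of bounded size -/

/-- A bound for the code length of the roots that have a property. -/
def rootBound (s : ℕ) : ℕ := s * (s + 1) + 2 * s + 2

theorem Trigger.len_le {m : GLAV} {c : List Const} (h : Sys.Trigger m c) :
    len c ≤ len Sys * (len Sys + 1) + 1 := by
  have hm := len_le_of_mem h.1
  have hc := h.2.1
  have ht := length_lt_len m.target
  have hg := len_glav m
  have hs := len_system Sys
  refine len_le_mul ?_ fun k hk => ?_
  · have : c.length = m.target.length := hc.1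
    lia
  · have := Database.len_le_of_mem_dom (hc.2 k hk)
    lia

/-- The label of a null consists of an assertion and a variable, each of length at most that of the
system, and of an answer, bounded by `Trigger.len_le`; these parts make up `rootBound`. -/
theorem Trigger.len_root_le {m : GLAV} {c : List Const} (h : Sys.Trigger m c) {x : Var} {a : Root}
    (hx : ∃ α ∈ m.ontBody, x ∈ α.vars) (ha : IndOf m c x a) : len a ≤ rootBound (len Sys) := by
  have hm := len_le_of_mem h.1
  have hg := len_glav m
  have hs := len_system Sys
  have hl := h.len_le
  obtain ⟨α, hα, hx⟩ := hx
  have h1 := len_le_of_mem hα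
  have h2 := OntAtom.len_le_of_mem_vars hx
  unfold rootBound
  rcases ha with ⟨k, hk, rfl⟩ | ⟨-, rfl⟩
  · rw [len_const]
    have := Database.len_le_of_mem_dom (h.2.1.2 k (List.of_mem_zip hk).2)
    lia
  · rw [len_null]
    lia

theorem BaseConcept.len_le {B : Concept} {a : Root} (h : Sys.BaseConcept B a) :
    len a ≤ rootBound (len Sys) := by
  obtain ⟨m, c, ht, ⟨A, x, hm, -, h⟩ | ⟨P, x, y, hm, ⟨-, h⟩ | ⟨-, h⟩⟩⟩ := h
  · exact ht.len_root_le ⟨_, hm, by simp [OntAtom.vars]⟩ h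
  · exact ht.len_root_le ⟨_, hm, by simp [OntAtom.vars]⟩ h
  · exact ht.len_root_le ⟨_, hm, by simp [OntAtom.vars]⟩ h

theorem BaseConcept.over (hW : Sys.WF) {B : Concept} {a : Root} (h : Sys.BaseConcept B a) :
    B.Over Sys.ontology := by
  obtain ⟨m, c, ht, ⟨A, x, hm, rfl, -⟩ | ⟨P, x, y, hm, ⟨rfl, -⟩ | ⟨rfl, -⟩⟩⟩ := h
  all_goals exact (hW.2.2.1 m ht.1).2 _ hm

theorem NonemptyC.over (hW : Sys.WF) {B : Concept} (h : Sys.NonemptyC B) :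
    B.Over Sys.ontology := by
  obtain ⟨B₀, rfl | ⟨a, h0⟩, h⟩ := h
  · exact Ontology.nonemptyStep_over hW.1 h trivial
  · exact Ontology.nonemptyStep_over hW.1 h (h0.over hW)

theorem NonemptyC.mono {B B' : Concept} (h : Sys.NonemptyC B)
    (hB : Sys.ontology.SubConcept B B') : Sys.NonemptyC B' := by
  obtain ⟨B₀, h0, h⟩ := h
  exact ⟨B₀, h0, h.trans (ReflTransGen.mono (fun _ _ h => Or.inl h) _ _ hB)⟩

/-- Along a valid path, non-emptiness passes from each role to its inverse and from there, by a
derived inclusion, to the next role. This makes it legitimate to restart a path at `point` with any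
of its roles. -/
theorem nonemptyC_of_validPath (hW : Sys.WF) {a : Root} {p : List Role} {R : Role}
    (h : Sys.ValidPath a (R :: p)) : Sys.NonemptyC (.ex R) := by
  induction p generalizing R with
  | nil =>
    rcases h with ⟨-, B₀, h0, h⟩ | ⟨-, -, h⟩
    · exact NonemptyC.mono ⟨B₀, h0.imp_right fun h => ⟨a, h⟩, .refl⟩ h
    · exact h
  | cons S p ih =>
    rcases h with ⟨h1, h2⟩ | ⟨-, h, -⟩
    · have h3 := ih h1
      refine NonemptyC.mono ?_ h2
      obtain ⟨B₀, h0, h⟩ := h3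
      exact ⟨B₀, h0, h.tail (Or.inr ⟨S, NonemptyC.over hW ⟨B₀, h0, h⟩, rfl, rfl⟩)⟩
    · cases h

theorem over_of_validPath (hW : Sys.WF) {a : Root} {p : List Role} (h : Sys.ValidPath a p) :
    ∀ R ∈ p, R.Over Sys.ontology := by
  induction p with
  | nil => simp
  | cons S p ih =>
    have hS := (nonemptyC_of_validPath hW h).over hW
    intro R hR
    rcases List.mem_cons.1 hR with rfl | hR
    · exact hS
    · rcases h with ⟨h, -⟩ | ⟨-, rfl, -⟩
      · exact ih h R hR
      · simp at hR

/-! ### Pruning -/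

open Classical in
/-- Paths are shortened at the first element that does not belong to `V`, and roots without
properties are replaced. -/
noncomputable def cutPath (Sys : System) (V : Finset Elem) (a : Root) : List Role → Elem
  | [] => if len a ≤ rootBound (len Sys) then (a, []) else (.point, [])
  | R :: p => if (a, p) ∈ V then ((cutPath Sys V a p).1, R :: (cutPath Sys V a p).2)
      else (.point, [R])

noncomputable def cut (Sys : System) (V : Finset Elem) (e : Elem) : Elem := cutPath Sys V e.1 e.2

variable {V : Finset Elem}

theorem len_point_le (s : ℕ) : len Root.point ≤ rootBound s := by
  rw [len_point, rootBound]; lia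

theorem cut_nil {a : Root} (h : len a ≤ rootBound (len Sys)) : cut Sys V (a, []) = (a, []) :=
  if_pos h

theorem cut_cons {a : Root} {p : List Role} {R : Role} (h : (a, p) ∈ V) :
    cut Sys V (a, R :: p) = ((cut Sys V (a, p)).1, R :: (cut Sys V (a, p)).2) :=
  if_pos h

theorem cut_cons_of_notMem {a : Root} {p : List Role} {R : Role} (h : (a, p) ∉ V) :
    cut Sys V (a, R :: p) = (.point, [R]) :=
  if_neg h

/-- Pruning keeps the last role, on which alone the concepts of a non-root depend. A root too long
for `rootBound` has no base concept, hence only the consequences of ⊤, which `point` has as well. -/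
theorem HoldsC.cut {B : Concept} {e : Elem} (h : Sys.HoldsC B e) :
    Sys.HoldsC B (cut Sys V e) := by
  obtain ⟨a, _ | ⟨R, p⟩⟩ := e
  · by_cases ha : len a ≤ rootBound (len Sys)
    · rwa [cut_nil ha]
    · obtain ⟨B₀, h0, h⟩ := h
      have : System.cut Sys V (a, []) = (.point, []) := if_neg ha
      rw [this]
      exact ⟨B₀, Or.inl (h0.resolve_right fun h => ha h.len_le), h⟩
  · by_cases hV : (a, p) ∈ V
    · rw [cut_cons hV]; exact h
    · rw [cut_cons_of_notMem hV]; exact h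

theorem Valid.cut (hW : Sys.WF) {e : Elem} (h : Sys.Valid e) : Sys.Valid (cut Sys V e) := by
  obtain ⟨a, p⟩ := e
  induction p with
  | nil =>
    by_cases ha : len a ≤ rootBound (len Sys)
    · rwa [cut_nil ha]
    · have : System.cut Sys V (a, []) = (.point, []) := if_neg ha
      rw [this]
      trivial
  | cons R p ih =>
    by_cases hV : (a, p) ∈ V
    · rw [cut_cons hV]
      rcases h with ⟨h1, h2⟩ | ⟨rfl, rfl, h⟩
      · exact Or.inl ⟨ih h1, h2.cut⟩
      · rw [cut_nil (len_point_le _)]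
        exact Or.inr ⟨rfl, rfl, h⟩
    · rw [cut_cons_of_notMem hV]
      exact Or.inr ⟨rfl, rfl, nonemptyC_of_validPath hW h⟩

/-- The parent in an edge of a tree belongs to `V`, so the pruned child is still a child of the
pruned parent. Edges between roots come from the mapping, and such roots are short enough to remain
fixed. -/
theorem HoldsR.cut {R : Role} {e e' : Elem} (he : e ∈ V) (he' : e' ∈ V) (h : Sys.HoldsR R e e') :
    Sys.HoldsR R (cut Sys V e) (cut Sys V e') := by
  rcases h with ⟨R₀, h1, h2, h3, h4⟩ | ⟨S, rfl, h2, h3⟩ | ⟨S, rfl, h2, h3⟩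
  · obtain ⟨a, p⟩ := e
    obtain ⟨a', p'⟩ := e'
    obtain rfl : p = [] := h1
    obtain rfl : p' = [] := h2
    rw [cut_nil h3.baseConcept.len_le, cut_nil h3.swap.baseConcept.len_le]
    exact Or.inl ⟨R₀, rfl, rfl, h3, h4⟩
  · refine Or.inr (Or.inl ⟨S, ?_, h2.cut, h3⟩)
    exact cut_cons he
  · refine Or.inr (Or.inr ⟨S, ?_, h2.cut, h3⟩)
    exact cut_cons he'

theorem cut_const {c : Const} (h : c ∈ Sys.database.dom) :
    cut Sys V (.const c, []) = (.const c, []) := by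
  refine cut_nil ?_
  have := Database.len_le_of_mem_dom h
  rw [len_const, rootBound]
  have := len_system Sys
  lia

theorem len_root_cut_le (e : Elem) : len (cut Sys V e).1 ≤ rootBound (len Sys) := by
  obtain ⟨a, p⟩ := e
  induction p with
  | nil =>
    by_cases ha : len a ≤ rootBound (len Sys)
    · rwa [cut_nil ha]
    · have : System.cut Sys V (a, []) = (.point, []) := if_neg ha
      rw [this]
      exact len_point_le _
  | cons R p ih =>
    by_cases hV : (a, p) ∈ V
    · rwa [cut_cons hV]
    · rw [cut_cons_of_notMem hV]
      exact len_point_le _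

theorem length_path_cut_le (e : Elem) : (cut Sys V e).2.length ≤ V.card + 1 := by
  -- Only elements of `V` with shorter paths are counted. A parent `(a, p)` that is kept is counted
  -- for `R :: p` but not for `p`; the extra unit is the role kept when the path is restarted.
  have key : (cut Sys V e).2.length ≤ (V.filter fun v => v.2.length < e.2.length).card + 1 := by
    obtain ⟨a, p⟩ := e
    induction p with
    | nil =>
      by_cases ha : len a ≤ rootBound (len Sys)
      · rw [cut_nil ha]; simp
      · have : System.cut Sys V (a, []) = (.point, []) := if_neg ha
        rw [this]
        simp
    | cons R p ih =>
      by_cases hV : (a, p) ∈ V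
      · rw [cut_cons hV]
        have : (V.filter fun v => v.2.length < p.length).card <
            (V.filter fun v => v.2.length < (R :: p).length).card := by
          refine Finset.card_lt_card (Finset.ssubset_iff_of_subset ?_ |>.2 ⟨(a, p), ?_, ?_⟩)
          · intro v hv
            rw [Finset.mem_filter] at hv ⊢
            exact ⟨hv.1, hv.2.trans (Nat.lt_succ_self _)⟩
          · simp [hV]
          · simp
        simp only [List.length_cons] at ih this ⊢
        lia
      · rw [cut_cons_of_notMem hV]
        simp
  exact key.trans (Nat.succ_le_succ (Finset.card_filter_le _ _))

/-- A bound for the code length of pruned elements. -/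
def elemBound (n s : ℕ) : ℕ := rootBound s + ((n + 1) * (s + 2) + 1)

/-- Roles in valid paths belong to the alphabet, by well-formedness, so each has a code of length at
most `len Sys + 1`, with one more symbol for its place in the list. -/
theorem len_cut_le (hW : Sys.WF) {e : Elem} (h : Sys.Valid e) {n : ℕ} (hn : V.card ≤ n) :
    len (cut Sys V e) ≤ elemBound n (len Sys) := by
  rw [len_pair, elemBound]
  refine Nat.add_le_add (len_root_cut_le e) ?_
  refine len_le_mul ((length_path_cut_le e).trans (Nat.succ_le_succ hn)) fun R hR => ?_
  have := (over_of_validPath hW (h.cut hW) R hR).len_le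
  have := len_system Sys
  lia

theorem exists_short_match (hW : Sys.WF) {d : CQ OntAtom} {c : List Const}
    (hc : ∀ k ∈ c, k ∈ Sys.database.dom) {τ : List (Var × Elem)} (h : Sys.Match d c τ) :
    ∃ τ', Sys.Match d c τ' ∧
      len τ' ≤ len d * (len d + elemBound (len d) (len Sys) + 1) + 1 := by
  classical
  obtain ⟨h1, h2, h3, h4⟩ := h
  let g : Var → Elem := fun x => if hx : ∃ e, (x, e) ∈ τ then hx.choose else (.point, [])
  have hval : ∀ x e, (x, e) ∈ τ → g x = e := by
    intro x e he
    have hx : ∃ e, (x, e) ∈ τ := ⟨e, he⟩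
    have : hx.choose = e := h1 _ hx.choose_spec _ he rfl
    simp only [g, dif_pos hx, this]
  have hg : ∀ x, Sys.Valid (g x) := by
    intro x
    by_cases hx : ∃ e, (x, e) ∈ τ
    · obtain ⟨e, he⟩ := hx
      rw [hval x e he]
      exact h2 _ he
    · simp only [g, dif_neg hx]
      trivial
  -- The elements in use are the values of the variables; both arguments of any role atom of the
  -- body are then in `V`.
  let V : Finset Elem := (d.vars.map g).toFinset
  have hmem : ∀ a ∈ d.body, ∀ x ∈ a.vars, g x ∈ V := fun a ha x hx =>
    List.mem_toFinset.2 (List.mem_map.2 ⟨x,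
      List.mem_append_right _ (List.mem_flatMap.2 ⟨a, ha, hx⟩), rfl⟩)
  have hV : V.card ≤ len d :=
    (List.toFinset_card_le _).trans (by rw [List.length_map]; exact d.length_vars_le)
  refine ⟨_, match_map (h := fun x => cut Sys V (g x)) (fun x _ => (hg x).cut hW) ?_ ?_ ?_, ?_⟩
  · clear h4 hmem hV
    generalize V = V
    generalize d.target = l at h3
    induction h3 with
    | nil => rfl
    | cons hxk _ ih =>
      rw [List.map_cons, List.map_cons, ih fun k hk => hc k (List.mem_cons_of_mem _ hk),
        hval _ _ hxk, cut_const (hc _ List.mem_cons_self)]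
  · intro A x ha
    obtain ⟨e, he, h⟩ := h4 _ ha
    rw [hval x e he]
    exact h.cut
  · intro P x y ha
    obtain ⟨e, e', he, he', h⟩ := h4 _ ha
    have hx := hmem _ ha x (by simp [OntAtom.vars])
    have hy := hmem _ ha y (by simp [OntAtom.vars])
    rw [hval x e he] at hx ⊢
    rw [hval y e' he'] at hy ⊢
    exact h.cut hx hy
  · refine len_le_mul (by rw [List.length_map]; exact d.length_vars_le) ?_
    intro p hp
    obtain ⟨x, hx, rfl⟩ := List.mem_map.1 hp
    rw [len_pair]
    exact Nat.add_le_add (CQ.len_le_of_mem_vars hx) (len_cut_le hW (hg x) hV)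

end System

end OBDM

/-! ### Ontologies in NP: well-formedness and derived inclusions -/

namespace StackProg

open OBDM
open Code (enc)

variable {α β γ δ : Type} [Code α] [Code β] [Code γ] [Code δ]

/-- The context `a` grows with every quantifier, so the bound refers to the component `f a` on which
it really depends. -/
theorem NPPred.exPoly {R : α → β → Prop} {f : α → γ} (p : Polynomial ℕ)
    (hR : NPPred fun x : α × β => R x.1 x.2) (hb : ∀ a y, R a y → len y ≤ p.eval (len (f a)))
    (hf : NPFun f := by fun_prop) : NPPred fun a => ∃ y, R a y := by
  obtain ⟨q, hq⟩ := hf.len_le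
  refine hR.ex (p.comp q) fun a ⟨y, hy⟩ => ⟨y, ?_, hy⟩
  rw [Polynomial.eval_comp]
  exact (hb a y hy).trans (p.eval_nat_mono (hq a))

theorem NPPred.exBdd {R : α → β → Prop} {f : α → γ}
    (hR : NPPred fun x : α × β => R x.1 x.2) (hb : ∀ a y, R a y → len y ≤ len (f a))
    (hf : NPFun f := by fun_prop) : NPPred fun a => ∃ y, R a y :=
  NPPred.exPoly Polynomial.X hR (fun a y h => by simpa using hb a y h) hf

/-! ### Lengths -/

theorem len_append (l m : List α) : len (l ++ m) + 1 = len l + len m := by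
  induction l with
  | nil => rw [len_nil, List.nil_append, Nat.add_comm]
  | cons a l ih =>
    rw [List.cons_append, len_cons, len_cons]
    lia

/-- The factor `k` must be positive because the code of the empty list has length 1. -/
theorem len_flatMap_le {l : List α} {f : α → List β} {k : ℕ} (hk : 0 < k)
    (h : ∀ a ∈ l, len (f a) ≤ k * (len a + 1) + 1) : len (l.flatMap f) ≤ k * len l := by
  induction l with
  | nil => rw [List.flatMap_nil, len_nil, len_nil]; lia
  | cons a l ih =>
    have h1 := ih fun x hx => h x (List.mem_cons_of_mem _ hx)
    have h2 := h a List.mem_cons_self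
    have h3 := len_append (f a) (l.flatMap f)
    rw [List.flatMap_cons, len_cons]
    have : k * (len a + len l + 1) = k * (len a + 1) + k * len l := by ring
    lia

theorem len_role_atomic (P : PredSym) : len (Role.atomic P) = len P + 1 := rfl

theorem len_role_inv (P : PredSym) : len (Role.inv P) = len P + 1 := rfl

theorem len_concept_atomic (A : AtomicConcept) : len (Concept.atomic A) = len A + 1 := rfl

theorem len_concept_ex (R : Role) : len (Concept.ex R) = len R + 1 := rfl

theorem len_conceptIncl (B B' : Concept) :
    len (Assertion.conceptIncl B B') = len (B, B') + 2 := rfl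

theorem len_roleIncl (R R' : Role) : len (Assertion.roleIncl R R') = len (R, R') + 2 := rfl

theorem len_swap (R : Role) : len R.swap = len R := by cases R <;> rfl

/-! ### Ontologies -/

theorem NPFun.roleSwap : NPFun Role.swap := by
  refine ⟨⟨Polynomial.X, fun R => by rw [len_swap, Polynomial.eval_X]⟩, ?_⟩
  refine (NPPred.or
    (NPPred.exBdd (f := fun x : Role × Role => x.1)
      (R := fun x P => x.1 = .atomic P ∧ x.2 = .inv P) (.and .eq .eq) ?_)
    (NPPred.exBdd (f := fun x : Role × Role => x.1)
      (R := fun x P => x.1 = .inv P ∧ x.2 = .atomic P) (.and .eq .eq) ?_)).congr ?_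
  · rintro ⟨R, R'⟩ P ⟨rfl, -⟩
    exact Nat.le_succ _
  · rintro ⟨R, R'⟩ P ⟨rfl, -⟩
    exact Nat.le_succ _
  · rintro ⟨P | P, R⟩ <;> simp [Role.swap]

@[fun_prop]
theorem NPFun.swap {f : α → Role} (hf : NPFun f) : NPFun fun a => (f a).swap := roleSwap.comp hf

section Ontology

variable {O : α → Ontology} {R R' : α → Role} {B B' : α → Concept}

theorem NPPred.role_over (hR : NPFun R := by fun_prop) (hO : NPFun O := by fun_prop) :
    NPPred fun a => (R a).Over (O a) := by
  refine (NPPred.exBdd (f := R)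
    (R := fun a P => (R a = .atomic P ∨ R a = .inv P) ∧ P ∈ (O a).roles)
    (.and (.or .eq .eq) .mem) ?_).congr fun a => ?_
  · rintro a P ⟨h | h, -⟩ <;> rw [h] <;> exact Nat.le_succ _
  · cases R a <;> simp [Role.Over]

theorem NPPred.atomicConcept_over {A : α → AtomicConcept} (hA : NPFun A := by fun_prop)
    (hO : NPFun O := by fun_prop) : NPPred fun a => (A a).Over (O a) := by
  refine (NPPred.or (.eq (f := A) (g := fun _ => AtomicConcept.top)) (.or
    (.eq (f := A) (g := fun _ => AtomicConcept.bot)) (NPPred.exBdd (f := A)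
    (R := fun a P => A a = .named P ∧ P ∈ (O a).concepts)
    (.and .eq .mem) ?_))).congr fun a => ?_
  · rintro a P ⟨h, -⟩
    rw [h]
    exact Nat.le_succ _
  · cases A a <;> simp [AtomicConcept.Over]

theorem NPPred.concept_over (hB : NPFun B := by fun_prop) (hO : NPFun O := by fun_prop) :
    NPPred fun a => (B a).Over (O a) := by
  refine (NPPred.or
    (NPPred.exBdd (f := B) (R := fun a A => B a = .atomic A ∧ A.Over (O a))
      (.and .eq .atomicConcept_over) ?_)
    (NPPred.exBdd (f := B) (R := fun a A => B a = .ex A ∧ A.Over (O a))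
      (.and .eq .role_over) ?_)).congr fun a => ?_
  · rintro a P ⟨h, -⟩
    rw [h]
    exact Nat.le_succ _
  · rintro a P ⟨h, -⟩
    rw [h]
    exact Nat.le_succ _
  · cases B a <;> simp [Concept.Over]

theorem NPPred.assertion_over {A : α → Assertion} (hA : NPFun A := by fun_prop)
    (hO : NPFun O := by fun_prop) : NPPred fun a => (A a).Over (O a) := by
  refine (NPPred.or
    (.exBdd (f := A) (R := fun a (x : Concept × Concept) =>
        (A a = .conceptIncl x.1 x.2 ∨ A a = .conceptDisj x.1 x.2) ∧ x.1.Over (O a) ∧ x.2.Over (O a))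
      (.and (.or .eq .eq) (.and .concept_over .concept_over)) ?_)
    (.exBdd (f := A) (R := fun a (x : Role × Role) =>
        (A a = .roleIncl x.1 x.2 ∨ A a = .roleDisj x.1 x.2) ∧ x.1.Over (O a) ∧ x.2.Over (O a))
      (.and (.or .eq .eq) (.and .role_over .role_over)) ?_)).congr fun a => ?_
  · rintro a P ⟨h | h, -⟩ <;> rw [h] <;> exact Nat.le_add_right _ 2
  · rintro a P ⟨h | h, -⟩ <;> rw [h] <;> exact Nat.le_add_right _ 2
  · cases A a <;> simp [Assertion.Over]

theorem NPPred.ontAtom_over {A : α → OntAtom} (hA : NPFun A := by fun_prop)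
    (hO : NPFun O := by fun_prop) : NPPred fun a => (A a).Over (O a) := by
  refine (NPPred.or
    (.exBdd (f := A) (R := fun a (x : AtomicConcept × Var) =>
        A a = .concept x.1 x.2 ∧ x.1.Over (O a))
      (.and .eq .atomicConcept_over) ?_)
    (.exBdd (f := A) (R := fun a (x : PredSym × Var × Var) =>
        A a = .role x.1 x.2.1 x.2.2 ∧ x.1 ∈ (O a).roles)
      (.and .eq .mem) ?_)).congr fun a => ?_
  · rintro a P ⟨h, -⟩
    rw [h]
    exact Nat.le_succ _
  · rintro a P ⟨h, -⟩
    rw [h]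
    exact Nat.le_succ _
  · cases A a <;> simp [OntAtom.Over]

theorem NPPred.ontology_wf (hO : NPFun O := by fun_prop) : NPPred fun a => (O a).WF :=
  .allMem (by fun_prop) .assertion_over

theorem NPPred.roleStep (hO : NPFun O := by fun_prop) (hR : NPFun R := by fun_prop)
    (hR' : NPFun R' := by fun_prop) : NPPred fun a => (O a).RoleStep (R a) (R' a) :=
  .or .mem .mem

theorem NPPred.conceptStep (hO : NPFun O := by fun_prop) (hB : NPFun B := by fun_prop)
    (hB' : NPFun B' := by fun_prop) : NPPred fun a => (O a).ConceptStep (B a) (B' a) := by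
  refine .or .mem (.or ?_ .eq)
  refine .exBdd (f := B) (.exBdd (f := fun x => B' x.1) (.and .eq (.and .eq .roleStep)) ?_) ?_
  · rintro ⟨a, S⟩ S' ⟨-, h, -⟩
    simp only at h ⊢
    rw [h]
    exact Nat.le_succ _
  · rintro a S ⟨S', h, -⟩
    rw [h]
    exact Nat.le_succ _

theorem NPPred.nonemptyStep (hO : NPFun O := by fun_prop) (hB : NPFun B := by fun_prop)
    (hB' : NPFun B' := by fun_prop) : NPPred fun a => (O a).NonemptyStep (B a) (B' a) := by
  refine .or .conceptStep (.exBdd (f := B) (.and .role_over (.and .eq .eq)) ?_)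
  rintro a S ⟨-, h, -⟩
  rw [h]
  exact Nat.le_succ _

/-- A list of roles that contains everything to which some role inclusion leads. -/
def roleNodes (O : Ontology) : List Role :=
  O.assertions.flatMap fun
    | .roleIncl _ R => [R, R.swap]
    | _ => []

theorem len_roleNodes_le (O : Ontology) : len (roleNodes O) ≤ 6 * len O := by
  have : len (roleNodes O) ≤ 6 * len O.assertions := by
    refine len_flatMap_le (by lia) fun α _ => ?_
    cases α with
    | roleIncl R R' =>
      rw [len_roleIncl, len_pair, len_cons, len_cons, len_nil, len_swap]
      lia
    | _ => rw [len_nil]; lia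
  have := len_ontology O
  lia

theorem mem_roleNodes {O : Ontology} {R R' : Role} (h : O.RoleStep R R') : R' ∈ roleNodes O := by
  rcases h with h | h
  · exact List.mem_flatMap.2 ⟨_, h, by simp⟩
  · exact List.mem_flatMap.2 ⟨_, h, by simp⟩

/-- A list of concepts that contains everything to which some inclusion leads. -/
def conceptNodes (O : Ontology) : List Concept :=
  .atomic .top :: ((O.assertions.flatMap fun
    | .conceptIncl _ B => [B]
    | .roleIncl _ R => [.ex R, .ex R.swap]
    | _ => []) ++ O.roles.flatMap fun P => [.ex (.atomic P), .ex (.inv P)])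

theorem len_conceptNodes_le (O : Ontology) : len (conceptNodes O) ≤ 6 * len O + 4 := by
  have h1 : len (O.assertions.flatMap fun
      | .conceptIncl _ B => [B]
      | .roleIncl _ R => [.ex R, .ex R.swap]
      | _ => []) ≤ 6 * len O.assertions := by
    refine len_flatMap_le (by lia) fun α _ => ?_
    cases α with
    | conceptIncl B B' =>
      rw [len_conceptIncl, len_pair, len_cons, len_nil]
      lia
    | roleIncl R R' =>
      rw [len_roleIncl, len_pair, len_cons, len_cons, len_nil, len_concept_ex, len_concept_ex,
        len_swap]
      lia
    | _ => rw [len_nil]; lia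
  have h2 : len (O.roles.flatMap fun P => [Concept.ex (.atomic P), Concept.ex (.inv P)]) ≤
      6 * len O.roles := by
    refine len_flatMap_le (by lia) fun P _ => ?_
    rw [len_cons, len_cons, len_nil, len_concept_ex, len_concept_ex, len_role_atomic, len_role_inv]
    lia
  have h3 := len_append (O.assertions.flatMap fun
      | .conceptIncl _ B => [B]
      | .roleIncl _ R => [.ex R, .ex R.swap]
      | _ => []) (O.roles.flatMap fun P => [Concept.ex (.atomic P), Concept.ex (.inv P)])
  have h4 : len (Concept.atomic .top) = 3 := rfl
  have := len_ontology O
  rw [conceptNodes, len_cons]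
  lia

theorem mem_conceptNodes {O : Ontology} {B B' : Concept} (h : O.NonemptyStep B B') :
    B' ∈ conceptNodes O := by
  rcases h with (h | ⟨R, R', rfl, rfl, h | h⟩ | rfl) | ⟨R, hR, rfl, rfl⟩
  · exact List.mem_cons_of_mem _ (List.mem_append_left _ (List.mem_flatMap.2 ⟨_, h, by simp⟩))
  · exact List.mem_cons_of_mem _ (List.mem_append_left _ (List.mem_flatMap.2 ⟨_, h, by simp⟩))
  · exact List.mem_cons_of_mem _ (List.mem_append_left _ (List.mem_flatMap.2 ⟨_, h, by simp⟩))
  · exact List.mem_cons_self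
  · refine List.mem_cons_of_mem _ (List.mem_append_right _ ?_)
    cases R with
    | atomic P => exact List.mem_flatMap.2 ⟨P, hR, by simp [Role.swap]⟩
    | inv P => exact List.mem_flatMap.2 ⟨P, hR, by simp [Role.swap]⟩

theorem NPPred.subRole (hO : NPFun O := by fun_prop) (hR : NPFun R := by fun_prop)
    (hR' : NPFun R' := by fun_prop) : NPPred fun a => (O a).SubRole (R a) (R' a) :=
  (NPPred.reflTransGen (r := Ontology.RoleStep) .roleStep roleNodes (6 * Polynomial.X)
    (fun O => by simpa using len_roleNodes_le O) fun _ _ _ => mem_roleNodes).comp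
    (hO.prodMk (hR.prodMk hR'))

theorem NPPred.subConcept (hO : NPFun O := by fun_prop) (hB : NPFun B := by fun_prop)
    (hB' : NPFun B' := by fun_prop) : NPPred fun a => (O a).SubConcept (B a) (B' a) :=
  (NPPred.reflTransGen (r := Ontology.ConceptStep) .conceptStep conceptNodes
    (6 * Polynomial.X + 4) (fun O => by simpa using len_conceptNodes_le O)
    fun _ _ _ h => mem_conceptNodes (Or.inl h)).comp (hO.prodMk (hB.prodMk hB'))

theorem NPPred.nonemptySteps (hO : NPFun O := by fun_prop) (hB : NPFun B := by fun_prop)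
    (hB' : NPFun B' := by fun_prop) :
    NPPred fun a => Relation.ReflTransGen (O a).NonemptyStep (B a) (B' a) :=
  (NPPred.reflTransGen (r := Ontology.NonemptyStep) .nonemptyStep conceptNodes
    (6 * Polynomial.X + 4) (fun O => by simpa using len_conceptNodes_le O)
    fun _ _ _ h => mem_conceptNodes h).comp (hO.prodMk (hB.prodMk hB'))

end Ontology

end StackProg

/-! ### Databases and the facts produced by the mapping, in NP -/

namespace StackProg

open OBDM
open Code (enc)

variable {α β γ δ : Type} [Code α] [Code β] [Code γ] [Code δ]

/-! ### Schemas and databases -/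

section Database

variable {S : α → Schema} {D : α → Database}

theorem NPPred.schema_wf (hS : NPFun S := by fun_prop) : NPPred fun a => (S a).WF := by
  -- An implication between equalities becomes a disjunction, with `bits_ne` in place of a negation.
  refine (NPPred.allMem hS (R := fun a p => ∀ p' ∈ S a, p.1 ≠ p'.1 ∨ p.2 = p'.2)
    (.allMem (by fun_prop) (.or .bits_ne .eq))).congr fun a => ?_
  exact forall₄_congr fun p _ p' _ => imp_iff_not_or.symm

theorem NPPred.relAtom_over {A : α → RelAtom (List Bool)} (hA : NPFun A := by fun_prop)
    (hS : NPFun S := by fun_prop) : NPPred fun a => (A a).Over (S a) := by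
  refine (NPPred.exMem hS (R := fun a p => (A a).pred = p.1 ∧ (A a).args.length = p.2)
    (.and .eq .length_eq)).congr fun a => ?_
  constructor
  · rintro ⟨p, hp, h1, h2⟩
    rwa [RelAtom.Over, h1, h2]
  · intro h
    exact ⟨_, h, rfl, rfl⟩

theorem NPPred.mem_dom {c : α → Const} (hc : NPFun c := by fun_prop)
    (hD : NPFun D := by fun_prop) : NPPred fun a => c a ∈ (D a).dom :=
  .exMem hD .mem

theorem NPPred.mem_tuples {c : α → List Const} {n : α → ℕ} (hc : NPFun c := by fun_prop)
    (hD : NPFun D := by fun_prop) (hn : NPFun n := by fun_prop) :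
    NPPred fun a => c a ∈ (D a).tuples (n a) :=
  .and .length_eq (.allMem hc .mem_dom)

end Database

/-! ### Answers over a database -/

theorem exists_forall_mem_eq {X Y : Type} {σ : List (X × Y)} (b : Y)
    (h : ∀ p ∈ σ, ∀ p' ∈ σ, p.1 = p'.1 → p.2 = p'.2) :
    ∃ f : X → Y, ∀ x y, (x, y) ∈ σ → f x = y := by
  classical
  refine ⟨fun x => if hx : ∃ y, (x, y) ∈ σ then hx.choose else b, fun x y hy => ?_⟩
  have hx : ∃ y, (x, y) ∈ σ := ⟨y, hy⟩
  simp only [dif_pos hx]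
  exact h _ hx.choose_spec _ hy rfl

/-- The assignment witnesses that the tuple is an answer. -/
def AnswerWitness (m : GLAV) (c : List Const) (D : Database) (σ : List (Var × Const)) : Prop :=
  (∀ p ∈ σ, ∀ p' ∈ σ, p.1 ≠ p'.1 ∨ p.2 = p'.2) ∧
    List.Forall₂ (fun x k => (x, k) ∈ σ) m.target c ∧
    ∀ a ∈ m.srcBody, ∃ b ∈ D, a.pred = b.pred ∧
      List.Forall₂ (fun x k => (x, k) ∈ σ) a.args b.args

theorem NPPred.answerWitness :
    NPPred fun x : (GLAV × List Const × Database) × List (Var × Const) =>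
      AnswerWitness x.1.1 x.1.2.1 x.1.2.2 x.2 := by
  refine .and (.allMem (by fun_prop) (.allMem (by fun_prop) (.or .bits_ne .eq))) (.and
    (.forall₂ (by fun_prop) (by fun_prop) .mem)
    (.allMem (by fun_prop) (.exMem (by fun_prop) (.and .eq
      (.forall₂ (by fun_prop) (by fun_prop) .mem)))))

theorem map_eq_of_forall₂ {β : Type} {σ : List (Var × β)} {f : Var → β} (hf : ∀ x y, (x, y) ∈ σ → f x = y)
    {l : List Var} {l' : List β} (h : List.Forall₂ (fun x k => (x, k) ∈ σ) l l') :
    l.map f = l' := by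
  induction h with
  | nil => rfl
  | cons h _ ih => rw [List.map_cons, ih, hf _ _ h]

theorem forall₂_map_of_mem {β : Type} {σ : List (Var × β)} {f : Var → β} {l : List Var}
    (h : ∀ x ∈ l, (x, f x) ∈ σ) : List.Forall₂ (fun x k => (x, k) ∈ σ) l (l.map f) := by
  rw [List.forall₂_map_right_iff, List.forall₂_same]
  exact h

theorem mem_answers_of_answerWitness {m : GLAV} {c : List Const} {D : Database}
    {σ : List (Var × Const)} (hc : ∀ k ∈ c, k ∈ D.dom) (h : AnswerWitness m c D σ) :
    c ∈ answers m.src D := by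
  obtain ⟨h1, h2, h3⟩ := h
  obtain ⟨f, hf⟩ := exists_forall_mem_eq (σ := σ) []
    fun p hp p' hp' => imp_iff_not_or.2 (h1 p hp p' hp')
  refine ⟨⟨h2.length_eq.symm, hc⟩, f, fun a ha => ?_, map_eq_of_forall₂ hf h2⟩
  obtain ⟨b, hb, h4, h5⟩ := h3 a ha
  have : a.map f = b := by
    obtain ⟨P, l⟩ := b
    rw [RelAtom.map, map_eq_of_forall₂ hf h5, h4]
  rwa [this]

theorem len_flatMap_args_le (l : List (RelAtom (List Bool))) :
    len (l.flatMap RelAtom.args) ≤ len l := by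
  have := len_flatMap_le (l := l) (f := RelAtom.args) (k := 1) one_pos fun a _ => by
    rw [len_relAtom]; lia
  lia

/-- The assignment is restricted to the variables of the source query. There its values are
constants of the database, which bounds its size. -/
theorem exists_answerWitness {m : GLAV} {c : List Const} {D : Database}
    (h : c ∈ answers m.src D) : (∀ k ∈ c, k ∈ D.dom) ∧ ∃ σ, AnswerWitness m c D σ ∧
      len σ ≤ len m * (len m + len D + 1) + 1 := by
  obtain ⟨⟨h1, h2⟩, f, h3, h4⟩ := h
  have h4 : m.target.map f = c := h4
  refine ⟨h2, (m.target ++ m.srcBody.flatMap RelAtom.args).map fun x => (x, f x), ⟨?_, ?_, ?_⟩, ?_⟩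
  · intro p hp p' hp'
    obtain ⟨x, -, rfl⟩ := List.mem_map.1 hp
    obtain ⟨y, -, rfl⟩ := List.mem_map.1 hp'
    by_cases hxy : x = y
    · exact Or.inr (by rw [hxy])
    · exact Or.inl hxy
  · rw [← h4]
    exact forall₂_map_of_mem fun x hx => List.mem_map.2 ⟨x, List.mem_append_left _ hx, rfl⟩
  · intro a ha
    refine ⟨_, h3 a ha, rfl, forall₂_map_of_mem fun x hx => List.mem_map.2 ⟨x, ?_, rfl⟩⟩
    exact List.mem_append_right _ (List.mem_flatMap.2 ⟨a, ha, hx⟩)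
  · have hlen : len (m.target ++ m.srcBody.flatMap RelAtom.args) ≤ len m := by
      have h5 := len_append m.target (m.srcBody.flatMap RelAtom.args)
      have h6 := len_flatMap_args_le m.srcBody
      rw [len_glav]
      lia
    refine len_le_mul ?_ fun p hp => ?_
    · rw [List.length_map]
      exact (length_lt_len _).le.trans hlen
    · obtain ⟨x, hx, rfl⟩ := List.mem_map.1 hp
      rw [len_pair]
      refine Nat.add_le_add ((len_le_of_mem hx).trans hlen) (Database.len_le_of_mem_dom ?_)
      rcases List.mem_append.1 hx with hx | hx
      · exact h2 _ (by rw [← h4]; exact List.mem_map_of_mem hx)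
      · obtain ⟨a, ha, hx⟩ := List.mem_flatMap.1 hx
        exact ⟨_, h3 a ha, List.mem_map_of_mem hx⟩

theorem NPPred.mem_answers {m : α → GLAV} {c : α → List Const} {D : α → Database}
    (hm : NPFun m := by fun_prop) (hc : NPFun c := by fun_prop) (hD : NPFun D := by fun_prop) :
    NPPred fun a => c a ∈ answers (m a).src (D a) := by
  have h := NPPred.ex (R := fun (x : GLAV × List Const × Database) σ =>
      (∀ k ∈ x.2.1, k ∈ x.2.2.dom) ∧ AnswerWitness x.1 x.2.1 x.2.2 σ)
    (.and (.allMem (by fun_prop) .mem_dom) .answerWitness)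
    (Polynomial.X * (2 * Polynomial.X + 1) + 1) (by
      rintro ⟨m, c, D⟩ ⟨σ, hc, hσ⟩
      obtain ⟨-, σ', h1, h2⟩ := exists_answerWitness (mem_answers_of_answerWitness hc hσ)
      refine ⟨σ', h2.trans ?_, hc, h1⟩
      simp only [len_pair, Polynomial.eval_add, Polynomial.eval_mul, Polynomial.eval_X,
        Polynomial.eval_ofNat, Polynomial.eval_one]
      gcongr <;> lia)
  refine (h.comp (hm.prodMk (hc.prodMk hD))).congr fun a => ?_
  constructor
  · rintro ⟨σ, h1, h2⟩
    exact mem_answers_of_answerWitness h1 h2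
  · intro h
    obtain ⟨h1, σ, h2, -⟩ := exists_answerWitness h
    exact ⟨σ, h1, h2⟩

/-! ### Zipping -/

theorem zip_eq_of_forall₂ {β γ : Type} {l : List β} {l' : List γ} {z : List (β × γ)}
    (h1 : List.Forall₂ (fun x p => p.1 = x) l z) (h2 : List.Forall₂ (fun x p => p.2 = x) l' z) :
    l.zip l' = z := by
  induction h1 generalizing l' with
  | nil => simp
  | @cons x p l z h _ ih =>
    cases h2 with
    | cons h' h2 =>
      rw [List.zip_cons_cons, ih h2, ← h, ← h']

theorem forall₂_zip {l : List β} {l' : List γ} (h : l.length = l'.length) :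
    List.Forall₂ (fun x p => p.1 = x) l (l.zip l') ∧
      List.Forall₂ (fun x p => p.2 = x) l' (l.zip l') ∧
      len (l.zip l') ≤ len l + len l' := by
  induction l generalizing l' with
  | nil =>
    obtain rfl : l' = [] := by simpa using h.symm
    simp [len_nil]
  | cons x l ih =>
    cases l' with
    | nil => simp at h
    | cons y l' =>
      obtain ⟨h1, h2, h3⟩ := ih (by simpa using h)
      refine ⟨.cons rfl h1, .cons rfl h2, ?_⟩
      rw [List.zip_cons_cons, len_cons, len_cons, len_cons, len_pair]
      lia

/-- `List.zip` truncates the longer list, while the guessed list of pairs must project onto both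
lists entirely. Equality of the lengths is therefore part of what is checked. -/
theorem NPPred.mem_zip {p : α → β × γ} {l : α → List β} {l' : α → List γ}
    (hp : NPFun p := by fun_prop) (hl : NPFun l := by fun_prop) (hl' : NPFun l' := by fun_prop) :
    NPPred fun a => (l a).length = (l' a).length ∧ p a ∈ (l a).zip (l' a) := by
  refine (NPPred.exBdd (f := fun a => (l a, l' a)) (R := fun a z =>
    List.Forall₂ (fun x p => p.1 = x) (l a) z ∧ List.Forall₂ (fun x p => p.2 = x) (l' a) z ∧
      p a ∈ z) (.and (.forall₂ (by fun_prop) (by fun_prop) .eq)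
      (.and (.forall₂ (by fun_prop) (by fun_prop) .eq) .mem)) ?_).congr fun a => ?_
  · rintro a z ⟨h1, h2, -⟩
    rw [← zip_eq_of_forall₂ h1 h2, len_pair]
    exact (forall₂_zip (h1.length_eq.trans h2.length_eq.symm)).2.2
  · constructor
    · rintro ⟨z, h1, h2, h⟩
      rw [zip_eq_of_forall₂ h1 h2]
      exact ⟨h1.length_eq.trans h2.length_eq.symm, h⟩
    · rintro ⟨h, h'⟩
      obtain ⟨h1, h2, -⟩ := forall₂_zip h
      exact ⟨_, h1, h2, h'⟩

/-! ### Systems -/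

section System

@[fun_prop]
theorem NPFun.root_const {c : α → Const} (hc : NPFun c) : NPFun fun a => Root.const (c a) :=
  (NPFun.of_enc (f := Root.const) [.bit .false, .bit .false] fun _ => rfl).comp hc

@[fun_prop]
theorem NPFun.root_null {m : α → GLAV} {c : α → List Const} {y : α → Var} (hm : NPFun m)
    (hc : NPFun c) (hy : NPFun y) : NPFun fun a => Root.null (m a) (c a) (y a) :=
  (NPFun.of_enc (f := fun p : GLAV × List Const × Var => Root.null p.1 p.2.1 p.2.2)
    [.bit .true] fun _ => rfl).comp (hm.prodMk (hc.prodMk hy))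

variable {s : α → System}

theorem NPPred.system_wf (hs : NPFun s := by fun_prop) : NPPred fun a => (s a).WF :=
  .and .ontology_wf (.and .schema_wf (.and
    (.allMem (by fun_prop) (.and (.allMem (by fun_prop) .relAtom_over)
      (.allMem (by fun_prop) .ontAtom_over)))
    (.allMem (by fun_prop) .relAtom_over)))

theorem NPPred.trigger {m : α → GLAV} {c : α → List Const} (hs : NPFun s := by fun_prop)
    (hm : NPFun m := by fun_prop) (hc : NPFun c := by fun_prop) :
    NPPred fun a => (s a).Trigger (m a) (c a) :=
  .and .mem .mem_answers

/-- `IndOf` in a checkable form: non-membership becomes inequality with every element, and the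
equality of lengths from `mem_zip` is included. It costs nothing, since for a trigger the lengths
agree (`indOf_iff`). -/
theorem NPPred.indOf {m : α → GLAV} {c : α → List Const} {x : α → Var} {r : α → Root}
    (hm : NPFun m := by fun_prop) (hc : NPFun c := by fun_prop) (hx : NPFun x := by fun_prop)
    (hr : NPFun r := by fun_prop) :
    NPPred fun a => (∃ k, ((m a).target.length = (c a).length ∧
      (x a, k) ∈ (m a).target.zip (c a)) ∧ r a = .const k) ∨
      ((∀ t ∈ (m a).target, x a ≠ t) ∧ r a = .null (m a) (c a) (x a)) := by
  refine .or (.exBdd (f := r) (.and .mem_zip .eq) ?_)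
    (.and (.allMem (by fun_prop) .bits_ne) .eq)
  rintro a k ⟨-, h⟩
  rw [h, len_const]
  lia

theorem indOf_iff {m : GLAV} {c : List Const} {x : Var} {r : Root}
    (h : m.target.length = c.length) : ((∃ k, (m.target.length = c.length ∧
      (x, k) ∈ m.target.zip c) ∧ r = .const k) ∨
      ((∀ t ∈ m.target, x ≠ t) ∧ r = .null m c x)) ↔ IndOf m c x r := by
  refine or_congr (exists_congr fun k => ?_) (and_congr_left fun _ => ?_)
  · rw [and_iff_right h]
  · constructor
    · intro h hx
      exact h x hx rfl
    · rintro h t ht rfl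
      exact h ht

theorem _root_.OBDM.System.Trigger.length_eq {Sys : System} {m : GLAV} {c : List Const}
    (h : Sys.Trigger m c) : m.target.length = c.length :=
  h.2.1.1.symm

/-- The mapping gives rise to the atom for `r` under the name `x`. -/
def TriggerInd (Sys : System) (m : GLAV) (c : List Const) (x : Var) (r : Root) : Prop :=
  Sys.Trigger m c ∧ IndOf m c x r

theorem NPPred.triggerInd {m : α → GLAV} {c : α → List Const} {x : α → Var} {r : α → Root}
    (hs : NPFun s := by fun_prop)
    (hm : NPFun m := by fun_prop) (hc : NPFun c := by fun_prop) (hx : NPFun x := by fun_prop)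
    (hr : NPFun r := by fun_prop) :
    NPPred fun a => TriggerInd (s a) (m a) (c a) (x a) (r a) :=
  ((NPPred.trigger hs hm hc).and (NPPred.indOf hm hc hx hr)).congr fun _ =>
    and_congr_right fun h => indOf_iff h.length_eq

/-- A bound for the code length of an assertion of the mapping with an answer. -/
noncomputable def triggerBound : Polynomial ℕ :=
  Polynomial.X * (Polynomial.X + 1) + 1 + Polynomial.X

theorem _root_.OBDM.System.Trigger.len_pair_le {Sys : System} {m : GLAV} {c : List Const}
    (h : Sys.Trigger m c) :
    len (m, c) ≤ triggerBound.eval (len Sys) := by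
  simp only [triggerBound, len_pair, Polynomial.eval_add, Polynomial.eval_mul, Polynomial.eval_X,
    Polynomial.eval_one]
  have h1 := h.len_le
  have h2 := len_le_of_mem h.1
  have h3 := len_system Sys
  lia

/-- The pair `(m, c)` is guessed, and being a trigger bounds its size. The trigger is checked again
with each use of `IndOf`, because only for triggers does `IndOf` have its checkable form. -/
theorem NPPred.baseRole {R : α → Role} {r r' : α → Root} (hs : NPFun s := by fun_prop)
    (hR : NPFun R := by fun_prop) (hr : NPFun r := by fun_prop) (hr' : NPFun r' := by fun_prop) :
    NPPred fun a => (s a).BaseRole (R a) (r a) (r' a) := by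
  refine (NPPred.exPoly (f := s) (R := fun a (y : GLAV × List Const) =>
    ∃ z : PredSym × Var × Var, OntAtom.role z.1 z.2.1 z.2.2 ∈ y.1.ontBody ∧
      ((R a = .atomic z.1 ∧ TriggerInd (s a) y.1 y.2 z.2.1 (r a) ∧
          TriggerInd (s a) y.1 y.2 z.2.2 (r' a)) ∨
        (R a = .inv z.1 ∧ TriggerInd (s a) y.1 y.2 z.2.2 (r a) ∧
          TriggerInd (s a) y.1 y.2 z.2.1 (r' a)))) triggerBound
    (.exBdd (f := fun x => x.2.1.ontBody) (.and .mem (.or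
      (.and .eq (.and .triggerInd .triggerInd)) (.and .eq (.and .triggerInd .triggerInd)))) ?_)
    ?_).congr fun a => ?_
  · rintro ⟨a, m, c⟩ z ⟨h, -⟩
    exact (Nat.le_succ _).trans (len_le_of_mem h)
  · rintro a ⟨m, c⟩ ⟨z, -, ⟨-, h, -⟩ | ⟨-, h, -⟩⟩ <;> exact h.1.len_pair_le
  · constructor
    · rintro ⟨⟨m, c⟩, ⟨P, x, y⟩, h1, ⟨h2, h3, h4⟩ | ⟨h2, h3, h4⟩⟩
      · exact ⟨m, c, h3.1, P, x, y, h1, Or.inl ⟨h2, h3.2, h4.2⟩⟩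
      · exact ⟨m, c, h3.1, P, x, y, h1, Or.inr ⟨h2, h3.2, h4.2⟩⟩
    · rintro ⟨m, c, h, P, x, y, h1, ⟨h2, h3, h4⟩ | ⟨h2, h3, h4⟩⟩
      · exact ⟨(m, c), (P, x, y), h1, Or.inl ⟨h2, ⟨h, h3⟩, h, h4⟩⟩
      · exact ⟨(m, c), (P, x, y), h1, Or.inr ⟨h2, ⟨h, h3⟩, h, h4⟩⟩

theorem NPPred.baseConcept {B : α → Concept} {r : α → Root} (hs : NPFun s := by fun_prop)
    (hB : NPFun B := by fun_prop) (hr : NPFun r := by fun_prop) :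
    NPPred fun a => (s a).BaseConcept (B a) (r a) := by
  refine (NPPred.exPoly (f := s) (R := fun a (y : GLAV × List Const) =>
    (∃ z : AtomicConcept × Var, OntAtom.concept z.1 z.2 ∈ y.1.ontBody ∧
      B a = .atomic z.1 ∧ TriggerInd (s a) y.1 y.2 z.2 (r a)) ∨
    ∃ z : PredSym × Var × Var, OntAtom.role z.1 z.2.1 z.2.2 ∈ y.1.ontBody ∧
      ((B a = .ex (.atomic z.1) ∧ TriggerInd (s a) y.1 y.2 z.2.1 (r a)) ∨
        (B a = .ex (.inv z.1) ∧ TriggerInd (s a) y.1 y.2 z.2.2 (r a)))) triggerBound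
    (.or (.exBdd (f := fun x => x.2.1.ontBody) (.and .mem (.and .eq .triggerInd)) ?_)
      (.exBdd (f := fun x => x.2.1.ontBody) (.and .mem (.or
        (.and .eq .triggerInd) (.and .eq .triggerInd))) ?_))
    ?_).congr fun a => ?_
  · rintro ⟨a, m, c⟩ z ⟨h, -⟩
    exact (Nat.le_succ _).trans (len_le_of_mem h)
  · rintro ⟨a, m, c⟩ z ⟨h, -⟩
    exact (Nat.le_succ _).trans (len_le_of_mem h)
  · rintro a ⟨m, c⟩ (⟨z, -, -, h⟩ | ⟨z, -, ⟨-, h⟩ | ⟨-, h⟩⟩) <;> exact h.1.len_pair_le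
  · constructor
    · rintro ⟨⟨m, c⟩, ⟨⟨A, x⟩, h1, h2, h3⟩ | ⟨⟨P, x, y⟩, h1, ⟨h2, h3⟩ | ⟨h2, h3⟩⟩⟩
      · exact ⟨m, c, h3.1, Or.inl ⟨A, x, h1, h2, h3.2⟩⟩
      · exact ⟨m, c, h3.1, Or.inr ⟨P, x, y, h1, Or.inl ⟨h2, h3.2⟩⟩⟩
      · exact ⟨m, c, h3.1, Or.inr ⟨P, x, y, h1, Or.inr ⟨h2, h3.2⟩⟩⟩
    · rintro ⟨m, c, h, ⟨A, x, h1, h2, h3⟩ | ⟨P, x, y, h1, ⟨h2, h3⟩ | ⟨h2, h3⟩⟩⟩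
      · exact ⟨(m, c), Or.inl ⟨(A, x), h1, h2, h, h3⟩⟩
      · exact ⟨(m, c), Or.inr ⟨(P, x, y), h1, Or.inl ⟨h2, h, h3⟩⟩⟩
      · exact ⟨(m, c), Or.inr ⟨(P, x, y), h1, Or.inr ⟨h2, h, h3⟩⟩⟩

end System

end StackProg

/-! ### The canonical model and the decision problem in NP -/

namespace StackProg

open OBDM
open Code (enc)

variable {α β γ δ : Type} [Code α] [Code β] [Code γ] [Code δ]

/-! ### The canonical model -/

theorem len_lt_of_eq_cons {l l' : List α} {a : α} (h : l = a :: l') :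
    len (a, l') < len l := by
  rw [h, len_cons, len_pair]
  exact Nat.lt_succ_self _

theorem _root_.OBDM.System.BaseConcept.len_concept_le {Sys : System} {B : Concept} {r : Root}
    (h : Sys.BaseConcept B r) : len B ≤ len Sys + 1 := by
  obtain ⟨m, c, ht, h⟩ := h
  have h1 := len_le_of_mem ht.1
  have h2 := len_system Sys
  have h3 := len_glav m
  rcases h with ⟨A, x, hm, rfl, -⟩ | ⟨P, x, y, hm, ⟨rfl, -⟩ | ⟨rfl, -⟩⟩
  · have h4 := len_le_of_mem hm
    rw [len_ontAtom_concept] at h4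
    rw [len_concept_atomic]
    lia
  · have h4 := len_le_of_mem hm
    rw [len_ontAtom_role] at h4
    rw [len_concept_ex, len_role_atomic]
    lia
  · have h4 := len_le_of_mem hm
    rw [len_ontAtom_role] at h4
    rw [len_concept_ex, len_role_inv]
    lia

theorem eval_X_add (n m : ℕ) [m.AtLeastTwo] :
    (Polynomial.X + OfNat.ofNat m : Polynomial ℕ).eval n = n + OfNat.ofNat m := by simp

variable {s : α → System} {B : α → Concept} {R : α → Role} {e e' : α → Elem}

theorem NPPred.holdsC (hs : NPFun s := by fun_prop) (hB : NPFun B := by fun_prop)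
    (he : NPFun e := by fun_prop) : NPPred fun a => (s a).HoldsC (B a) (e a) := by
  refine (NPPred.or
    (.and (.eq (f := fun a => (e a).2) (g := fun _ => []))
      -- The code of the concept ⊤ has length 3; for base concepts `+ 1` would do.
      (.exPoly (f := s) (Polynomial.X + 3) (R := fun a B₀ => (B₀ = .atomic .top ∨
        (s a).BaseConcept B₀ (e a).1) ∧ (s a).ontology.SubConcept B₀ (B a))
        (.and (.or .eq .baseConcept) .subConcept) ?_))
    (.exBdd (f := fun a => (e a).2) (R := fun a (p : Role × List Role) => (e a).2 = p.1 :: p.2 ∧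
      (s a).ontology.SubConcept (.ex p.1.swap) (B a))
      (.and (.eq (by fun_prop) (.cons (by fun_prop) (by fun_prop))) .subConcept) ?_)).congr
      fun a => ?_
  · rintro a B₀ ⟨rfl | h, -⟩
    · rw [eval_X_add]
      exact Nat.le_add_left 3 _
    · have := h.len_concept_le
      rw [eval_X_add]
      lia
  · rintro a p ⟨h, -⟩
    exact (len_lt_of_eq_cons h).le
  · unfold System.HoldsC
    obtain ⟨r, _ | ⟨S, p⟩⟩ := e a <;> simp

theorem _root_.OBDM.System.BaseRole.len_role_le {Sys : System} {R : Role} {r r' : Root}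
    (h : Sys.BaseRole R r r') : len R ≤ len Sys := by
  have := h.baseConcept.len_concept_le
  rw [len_concept_ex] at this
  lia

theorem NPPred.holdsR (hs : NPFun s := by fun_prop) (hR : NPFun R := by fun_prop)
    (he : NPFun e := by fun_prop) (he' : NPFun e' := by fun_prop) :
    NPPred fun a => (s a).HoldsR (R a) (e a) (e' a) := by
  refine .or (.exBdd (f := s) (.and .eq (.and .eq (.and .baseRole .subRole))) ?_) (.or
    (.exBdd (f := e') (.and (.eq (by fun_prop) (.prodMk (by fun_prop)
      (.cons (by fun_prop) (by fun_prop)))) (.and .holdsC .subRole)) ?_)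
    (.exBdd (f := e) (.and (.eq (by fun_prop) (.prodMk (by fun_prop)
      (.cons (by fun_prop) (by fun_prop)))) (.and .holdsC .subRole)) ?_))
  · rintro a R₀ ⟨-, -, h, -⟩
    exact h.len_role_le
  · rintro a S ⟨h, -⟩
    rw [h, len_pair, len_cons]
    lia
  · rintro a S ⟨h, -⟩
    rw [h, len_pair, len_cons]
    lia

/-- A bound for the code length of the roots that have a property. -/
noncomputable def rootPoly : Polynomial ℕ :=
  Polynomial.X * (Polynomial.X + 1) + 2 * Polynomial.X + 2

theorem eval_rootPoly (n : ℕ) : rootPoly.eval n = System.rootBound n := by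
  simp [rootPoly, System.rootBound]

theorem NPPred.nonemptyC (hs : NPFun s := by fun_prop) (hB : NPFun B := by fun_prop) :
    NPPred fun a => (s a).NonemptyC (B a) := by
  refine .exPoly (f := s) (Polynomial.X + 3) (.and (.or .eq
    (.exPoly (f := fun x => s x.1) rootPoly .baseConcept ?_)) .nonemptySteps) ?_
  · rintro ⟨a, B₀⟩ r h
    rw [eval_rootPoly]
    exact h.len_le
  · rintro a B₀ ⟨rfl | ⟨r, h⟩, -⟩
    · rw [eval_X_add]
      exact Nat.le_add_left 3 _
    · have := h.len_concept_le
      rw [eval_X_add]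
      lia

/-- Removal of the last role of a path. -/
def PathStep (x y : System × Root × List Role) : Prop :=
  ∃ R, x = (y.1, y.2.1, R :: y.2.2) ∧ y.1.HoldsC (.ex R) (y.2.1, y.2.2)

/-- The path consists of at most one role, which exists by itself. -/
def PathEnd (x : System × Root × List Role) : Prop :=
  x.2.2 = [] ∨ ∃ R, x.2 = (.point, [R]) ∧ x.1.NonemptyC (.ex R)

/-- Recursion on the path is recast as iteration of a step that shortens it, so that `NPPred.iter`
applies. -/
theorem validPath_iff (x : System × Root × List Role) :
    x.1.ValidPath x.2.1 x.2.2 ↔ ∃ y, Relation.ReflTransGen PathStep x y ∧ PathEnd y := by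
  constructor
  · obtain ⟨Sys, r, p⟩ := x
    intro h
    induction p with
    | nil => exact ⟨_, .refl, Or.inl rfl⟩
    | cons R p ih =>
      rcases h with ⟨h1, h2⟩ | ⟨rfl, rfl, h⟩
      · obtain ⟨y, h3, h4⟩ := ih h1
        exact ⟨y, .head ⟨R, rfl, h2⟩ h3, h4⟩
      · exact ⟨_, .refl, Or.inr ⟨R, rfl, h⟩⟩
  · rintro ⟨y, h, hy⟩
    induction h using Relation.ReflTransGen.head_induction_on with
    | refl =>
      obtain ⟨Sys, r, p⟩ := y
      rcases hy with rfl | ⟨R, h, hR⟩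
      · trivial
      · obtain ⟨rfl, rfl⟩ := Prod.mk.inj h
        exact Or.inr ⟨rfl, rfl, hR⟩
    | head h _ ih =>
      obtain ⟨R, rfl, h⟩ := h
      exact Or.inl ⟨ih, h⟩

theorem NPPred.valid (hs : NPFun s := by fun_prop) (he : NPFun e := by fun_prop) :
    NPPred fun a => (s a).Valid (e a) := by
  have h : NPPred fun x => ∃ y, Relation.ReflTransGen PathStep x y ∧ PathEnd y := by
    refine NPPred.iter ?_ ?_ ?_
    · refine .exBdd (f := fun x => x.1.2.2) (.and (.eq (by fun_prop)
        (.prodMk (by fun_prop) (.prodMk (by fun_prop) (.cons (by fun_prop) (by fun_prop)))))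
        .holdsC) ?_
      rintro ⟨x, y⟩ R ⟨h, -⟩
      simp only at h ⊢
      rw [h, len_cons]
      lia
    · refine .or (.eq (f := fun x : System × Root × List Role => x.2.2) (g := fun _ => []))
        (.exBdd (f := fun x => x.2.2) (.and (.eq (by fun_prop)
          (.prodMk (by fun_prop) (.cons (by fun_prop) (by fun_prop)))) .nonemptyC) ?_)
      rintro x R ⟨h, -⟩
      rw [h, len_cons]
      lia
    · rintro x y ⟨R, rfl, -⟩
      rw [len_pair, len_pair, len_pair, len_pair, len_cons]
      lia
  exact (h.comp (hs.prodMk he)).congr fun a => (validPath_iff (s a, e a)).symm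

/-- A bound for the code length of pruned elements. -/
noncomputable def elemPoly (n : Polynomial ℕ) : Polynomial ℕ :=
  rootPoly + ((n + 1) * (Polynomial.X + 2) + 1)

theorem eval_elemPoly (p : Polynomial ℕ) (n : ℕ) :
    (elemPoly p).eval n = System.elemBound (p.eval n) n := by
  simp [elemPoly, System.elemBound, eval_rootPoly]

/-- Well-formedness is part of the predicate because the bound on pruned elements depends on it. -/
theorem NPPred.violation (hs : NPFun s := by fun_prop) :
    NPPred fun a => (s a).WF ∧ (s a).Violation := by
  have h : NPPred fun Sys : System =>
      (∃ e, Sys.WF ∧ Sys.Valid e ∧ (Sys.HoldsC (.atomic .bot) e ∨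
        ∃ p : Concept × Concept, Assertion.conceptDisj p.1 p.2 ∈ Sys.ontology.assertions ∧
          Sys.HoldsC p.1 e ∧ Sys.HoldsC p.2 e)) ∨
      ∃ e : Elem × Elem, Sys.WF ∧ Sys.Valid e.1 ∧ Sys.Valid e.2 ∧
        ∃ p : Role × Role, Assertion.roleDisj p.1 p.2 ∈ Sys.ontology.assertions ∧
          Sys.HoldsR p.1 e.1 e.2 ∧ Sys.HoldsR p.2 e.1 e.2 := by
    refine .or
      (.ex (.and .system_wf (.and .valid (.or .holdsC
        (.exBdd (f := fun x => x.1.ontology.assertions) (.and .mem (.and .holdsC .holdsC)) ?_))))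
        (elemPoly 0) ?_)
      (.ex (.and .system_wf (.and .valid (.and .valid
        (.exBdd (f := fun x => x.1.ontology.assertions) (.and .mem (.and .holdsR .holdsR)) ?_))))
        (2 * elemPoly 2) ?_)
    · rintro x p ⟨h, -⟩
      exact (Nat.le_add_right _ 2).trans (len_le_of_mem h)
    · rintro Sys ⟨e, hW, he, h⟩
      -- For the concepts of a single element no parent has to be kept.
      refine ⟨System.cut Sys ∅ e, ?_, hW, he.cut hW, h.imp (fun h => h.cut)
        fun ⟨p, h1, h2, h3⟩ => ⟨p, h1, h2.cut, h3.cut⟩⟩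
      rw [eval_elemPoly]
      exact System.len_cut_le hW he (by simp)
    · rintro x p ⟨h, -⟩
      exact (Nat.le_add_right _ 2).trans (len_le_of_mem h)
    · classical
      rintro Sys ⟨⟨e, e'⟩, hW, he, he', p, h1, h2, h3⟩
      have hm : e ∈ ({e, e'} : Finset Elem) := by simp
      have hm' : e' ∈ ({e, e'} : Finset Elem) := by simp
      -- For a violated role disjointness, both ends of the edge must be pruned together.
      refine ⟨(System.cut Sys {e, e'} e, System.cut Sys {e, e'} e'), ?_, hW, he.cut hW, he'.cut hW,
        p, h1, h2.cut hm hm', h3.cut hm hm'⟩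
      have hc : ({e, e'} : Finset Elem).card ≤ 2 := Finset.card_le_two
      have h4 := System.len_cut_le hW he hc
      have h5 := System.len_cut_le hW he' hc
      rw [len_pair, Polynomial.eval_mul, eval_elemPoly]
      simp only [Polynomial.eval_ofNat]
      lia
  refine (h.comp hs).congr fun a => ?_
  constructor
  · rintro (⟨e, hW, he, h | ⟨p, h⟩⟩ | ⟨e, hW, he, he', p, h⟩)
    · exact ⟨hW, Or.inl ⟨e, he, h⟩⟩
    · exact ⟨hW, Or.inr (Or.inl ⟨e, he, _, _, h⟩)⟩
    · exact ⟨hW, Or.inr (Or.inr ⟨_, _, he, he', _, _, h⟩)⟩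
  · rintro ⟨hW, ⟨e, he, h⟩ | ⟨e, he, B₁, B₂, h⟩ | ⟨e, e', he, he', R₁, R₂, h⟩⟩
    · exact Or.inl ⟨e, hW, he, Or.inl h⟩
    · exact Or.inl ⟨e, hW, he, Or.inr ⟨(B₁, B₂), h⟩⟩
    · exact Or.inr ⟨(e, e'), hW, he, he', (R₁, R₂), h⟩

/-! ### Matches of queries -/

theorem NPPred.atomHolds {τ : α → List (Var × Elem)} {A : α → OntAtom}
    (hs : NPFun s := by fun_prop) (hτ : NPFun τ := by fun_prop) (hA : NPFun A := by fun_prop) :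
    NPPred fun a => (s a).AtomHolds (τ a) (A a) := by
  refine (NPPred.or
    (.exBdd (f := A) (R := fun a (x : AtomicConcept × Var) => A a = .concept x.1 x.2 ∧
      ∃ p ∈ τ a, p.1 = x.2 ∧ (s a).HoldsC (.atomic x.1) p.2)
      (.and .eq (.exMem (by fun_prop) (.and .eq .holdsC))) ?_)
    (.exBdd (f := A) (R := fun a (x : PredSym × Var × Var) => A a = .role x.1 x.2.1 x.2.2 ∧
      ∃ p ∈ τ a, ∃ p' ∈ τ a, p.1 = x.2.1 ∧ p'.1 = x.2.2 ∧ (s a).HoldsR (.atomic x.1) p.2 p'.2)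
      (.and .eq (.exMem (by fun_prop) (.exMem (by fun_prop) (.and .eq (.and .eq .holdsR)))))
      ?_)).congr fun a => ?_
  · rintro a P ⟨h, -⟩
    rw [h]
    exact Nat.le_succ _
  · rintro a P ⟨h, -⟩
    rw [h]
    exact Nat.le_succ _
  · constructor
    · rintro (⟨x, h, ⟨y, e⟩, h1, h2, h3⟩ | ⟨x, h, ⟨y, e⟩, h1, ⟨y', e'⟩, h2, h3, h4, h5⟩)
      · rw [h]
        exact ⟨e, h2 ▸ h1, h3⟩
      · rw [h]
        exact ⟨e, e', h3 ▸ h1, h4 ▸ h2, h5⟩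
    · intro h
      cases hA : A a with
      | concept C x =>
        rw [hA] at h
        obtain ⟨e, h1, h2⟩ := h
        exact Or.inl ⟨(C, x), rfl, (x, e), h1, rfl, h2⟩
      | role P x y =>
        rw [hA] at h
        obtain ⟨e, e', h1, h2, h3⟩ := h
        exact Or.inr ⟨(P, x, y), rfl, (x, e), h1, (y, e'), h2, rfl, rfl, h3⟩

theorem NPPred.match {τ : α → List (Var × Elem)} {d : α → CQ OntAtom} {c : α → List Const}
    (hs : NPFun s := by fun_prop) (hd : NPFun d := by fun_prop) (hc : NPFun c := by fun_prop)
    (hτ : NPFun τ := by fun_prop) : NPPred fun a => (s a).Match (d a) (c a) (τ a) := by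
  refine ((NPPred.allMem hτ (R := fun a p => ∀ p' ∈ τ a, p.1 ≠ p'.1 ∨ p.2 = p'.2)
    (.allMem (by fun_prop) (.or .bits_ne .eq))).congr fun a => ?_).and (.and
    (.allMem (by fun_prop) .valid) (.and (.forall₂ (by fun_prop) (by fun_prop) .mem)
      (.allMem (by fun_prop) .atomHolds)))
  exact forall₄_congr fun p _ p' _ => imp_iff_not_or.symm

/-- The first two conditions on the system and the tuple are those under which a match can be
shortened: roles of paths belong to the alphabet, and pruning leaves the constants of `c` in place.
-/
theorem NPPred.exists_match {d : α → CQ OntAtom} {c : α → List Const}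
    (hs : NPFun s := by fun_prop) (hd : NPFun d := by fun_prop) (hc : NPFun c := by fun_prop) :
    NPPred fun a => ∃ τ, ((s a).WF ∧ ∀ k ∈ c a, k ∈ (s a).database.dom) ∧
      (s a).Match (d a) (c a) τ := by
  refine (NPPred.ex (R := fun (x : System × CQ OntAtom × List Const) τ =>
    (x.1.WF ∧ ∀ k ∈ x.2.2, k ∈ x.1.database.dom) ∧ x.1.Match x.2.1 x.2.2 τ)
    (.and (.and .system_wf (.allMem (by fun_prop) .mem_dom)) .match)
    (Polynomial.X * (Polynomial.X + elemPoly Polynomial.X + 1) + 1) ?_).comp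
    (hs.prodMk (hd.prodMk hc))
  rintro ⟨Sys, d, c⟩ ⟨τ, ⟨hW, hc⟩, h⟩
  obtain ⟨τ', h1, h2⟩ := System.exists_short_match hW hc h
  refine ⟨τ', h2.trans ?_, ⟨hW, hc⟩, h1⟩
  simp only [Polynomial.eval_add, Polynomial.eval_mul, Polynomial.eval_X, Polynomial.eval_one,
    eval_elemPoly, System.elemBound, System.rootBound, len_pair]
  gcongr <;> lia

/-! ### The decision problem -/

theorem NPPred.mem_cert {q : α → UCQ} {c : α → List Const} (hs : NPFun s := by fun_prop)
    (hq : NPFun q := by fun_prop) (hc : NPFun c := by fun_prop) :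
    NPPred fun a => (s a).WF ∧ c a ∈ (s a).cert (q a) := by
  have h : NPPred fun a => c a ∈ (s a).database.tuples (q a).arity ∧
      (((s a).WF ∧ (s a).Violation) ∨ ∃ d ∈ (q a).disjuncts, ∃ τ,
        ((s a).WF ∧ ∀ k ∈ c a, k ∈ (s a).database.dom) ∧ (s a).Match d (c a) τ) :=
    .and .mem_tuples (.or .violation (.exMem (by fun_prop) .exists_match))
  refine h.congr fun a => ?_
  rw [System.mem_cert_iff]
  constructor
  · rintro ⟨h1, ⟨hW, hV⟩ | ⟨d, hd, τ, ⟨hW, -⟩, h⟩⟩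
    · exact ⟨hW, h1, Or.inl hV⟩
    · exact ⟨hW, h1, Or.inr ⟨d, hd, τ, h⟩⟩
  · rintro ⟨hW, h1, hV | ⟨d, hd, τ, h⟩⟩
    · exact ⟨h1, Or.inl ⟨hW, hV⟩⟩
    · exact ⟨h1, Or.inr ⟨d, hd, τ, ⟨hW, h1.2⟩, h⟩⟩

theorem NPPred.completeCharacterization : NPPred fun J : Instance =>
    J.WF ∧ J.system.IsCompleteCharacterization J.dataset J.query := by
  -- Each tuple has its own disjunct and match, or a violation. `J.system.WF` is repeated for each
  -- of them only because `mem_cert` delivers it together with membership.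
  have h : NPPred fun J : Instance => J.WF ∧
      ∀ c ∈ J.dataset.tuples, J.system.WF ∧ c ∈ J.system.cert J.query :=
    .and (.and .system_wf (.and (.allMem (by fun_prop) .mem_tuples)
      (.allMem (by fun_prop) (.and .length_eq (.allMem (by fun_prop) .ontAtom_over)))))
      (.allMem (by fun_prop) .mem_cert)
  refine h.congr fun J => ?_
  exact and_congr_right fun hW => forall₂_congr fun c _ => and_iff_right hW.1

end StackProg

theorem mainTheorem6 : Complexity.InNP OBDM.completeVQDEF := by
  refine StackProg.CheckableLang.inNP
    (StackProg.CheckableLang.congr StackProg.NPPred.completeCharacterization fun x => ?_)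
  constructor
  · rintro ⟨J, hx, hW, h⟩
    exact ⟨J, hW, h, hx⟩
  · rintro ⟨J, hW, h, hx⟩
    exact ⟨J, hx, hW, h⟩
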